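/- Let $\beta_k\ge 0$ ($k\ge 1$) be rates with $B_2=\sum_{k\ge1}k^2\beta_k<\infty$. A configuration is a sequence $(\sigma(i))_{i\in\mathbb Z}$ in $\mathbb Z\cup\{\pm\infty\}$ with $\sigma(i)+1\le\sigma(i+1)$ for all $i$. Let $\{\mathcal D_i^k : i\in\mathbb Z,\ k\ge1\}$ be mutually independent homogeneous Poisson point processes on $[0,\infty)$, $\mathcal D_i^k$ of rate $\beta_k$. Given an initial configuration $(\sigma(i,0))_{i\in\mathbb Z}$ that may be random but is independent of the Poisson processes, the exclusion process $\sigma(i,t)$ is the (almost surely unique) process such that at each epoch $\tau$ of $\mathcal D_i^k$ $$\sigma(i,\tau)=\min\{\sigma(i,\tau-)+k,\ \sigma(i+1,\tau-)-1\},$$ while $\sigma(i,\cdot)$ is constant between epochs of $\bigcup_k\mathcal D_i^k$. Let $\xi$ be this process started from $\xi(i,0)=i$ for $i\le 0$ and $\xi(i,0)=\infty$ for $i>0$. Write $[a]$ for the largest integer $\le a$. Then there is a finite, continuous, convex function $g$ on $(-\infty,0]$, depending only on the rates $(\beta_k)$, such that $n^{-1}\xi([nx],nt)\to t\,g(x/t)$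 in probability as $n\to\infty$ for all $x\le 0$ and $t>0$, and such that the following holds. Let $\sigma_n$, $n\in\mathbb N$, be processes of the above kind with these rates, $\sigma_n$ being defined on a probability space $(\Omega_n,\mathcal F_n,P_n)$, and let $u_0:\mathbb R\to\mathbb R$ be an increasing function such that, for every $y\in\mathbb R$ and $\varepsilon>0$, $$\lim_{n\to\infty}P_n\big(|\sigma_n([ny],0)-n\,u_0(y)|\ge n\varepsilon\big)=0 .$$ Then for every $x\in\mathbb R$ and $t>0$ the infimum $$u(x,t)=\inf_{y\ge x}\Big\{u_0(y)+t\,g\Big(\frac{x-y}{t}\Big)\Big\}$$ is finite, and for every $\varepsilon>0$ $$\lim_{n\to\infty}P_n\big(|\sigma_n([nx],nt)-n\,u(x,t)|\ge n\varepsilon\big)=0 .$$ -/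

import Mathlib

open MeasureTheory ProbabilityTheory Filter Topology
open scoped NNReal ENNReal

universe u

noncomputable section

namespace LongJumpExclusion

/-! ### Rates -/

/-- The moments `B_m = ∑_{k ≥ 1} k ^ m β_k` of the sequence of jump rates. -/
def rateMoment (β : ℕ+ → ℝ≥0) (m : ℕ) : ℝ≥0∞ :=
  ∑' k : ℕ+, ((k : ℕ) : ℝ≥0∞) ^ m * (β k : ℝ≥0∞)

/-! ### Particle configurations -/

/-- Possible particle locations: `ℤ ∪ {-∞, +∞}`. -/
abbrev Site : Type := WithBot (WithTop ℤ)

/-- An integer as a (finite) location. -/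
def Site.ofInt (z : ℤ) : Site := ((z : WithTop ℤ) : WithBot (WithTop ℤ))

/-- The location `+∞`. -/
def Site.infty : Site := ((⊤ : WithTop ℤ) : WithBot (WithTop ℤ))

/-- A location as an extended real number. -/
def Site.toEReal (s : Site) : EReal :=
  (WithBot.map (WithTop.map (fun z : ℤ => (z : ℝ))) s : WithBot (WithTop ℝ))

/-- Exclusion and no passing: `σ(i) + 1 ≤ σ(i+1)` for all labels `i`. -/
def IsConfiguration (σ : ℤ → Site) : Prop :=
  ∀ i : ℤ, σ i + Site.ofInt 1 ≤ σ (i + 1)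

/-- The step configuration: particle `i` sits at `i` for `i ≤ 0` and at `+∞` for `i > 0`. -/
def stepConfiguration (i : ℤ) : Site :=
  if i ≤ 0 then Site.ofInt i else Site.infty

/-! ### The jump rule -/

/-- A path `η i t` (location of particle `i` at time `t`) with initial configuration `σ₀` that obeys
the jump rule driven by the sets of epochs `D i k` (times at which particle `i` attempts to jump
`k` steps to the right). At an epoch `τ` of `D i k` the new location of particle `i` is
`min {η(i, τ-) + k, η(i+1, τ-) - 1}`, where the left limits of these piecewise constant paths are the
values at all times `s < τ` close enough to `τ`; between epochs particle `i` does not move. -/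
structure IsEvolution (D : ℤ → ℕ+ → Set ℝ≥0) (σ₀ : ℤ → Site) (η : ℤ → ℝ≥0 → Site) : Prop where
  initial : ∀ i, η i 0 = σ₀ i
  constant : ∀ i (s t : ℝ≥0), s ≤ t → (∀ k, D i k ∩ Set.Ioc s t = ∅) → η i t = η i s
  jump : ∀ i k, ∀ τ ∈ D i k,
    ∀ᶠ s in 𝓝[<] τ, η i τ = min (η i s + Site.ofInt (k : ℕ)) (η (i + 1) s + Site.ofInt (-1))

open Classical in
/-- The exclusion process with initial configuration `σ₀` driven by the epochs `D`. For almost every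
realization of the Poisson processes there is exactly one path that obeys the jump rule, and this
is that path; on the remaining realizations the value is immaterial. -/
def evolution (D : ℤ → ℕ+ → Set ℝ≥0) (σ₀ : ℤ → Site) : ℤ → ℝ≥0 → Site :=
  if h : ∃ η, IsEvolution D σ₀ η then h.choose else fun i _ => σ₀ i

/-! ### Poisson processes of attempted jumps -/

section Random

variable {Ω : Type u} [MeasurableSpace Ω]

/-- The number of points of the random set `N` in the time interval `[a, b)`. -/
def count (N : Ω → Set ℝ≥0) (a b : ℝ≥0) (ω : Ω) : ℕ∞ :=
  (N ω ∩ Set.Ico a b).encard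

/-- The σ-algebra generated by the counts of a random set of times. -/
abbrev pointSigma {Ω : Type u} (N : Ω → Set ℝ≥0) : MeasurableSpace Ω :=
  ⨆ (a : ℝ≥0) (b : ℝ≥0), MeasurableSpace.comap (count N a b) ⊤

/-- `N` is a homogeneous Poisson point process on `[0, ∞)` with rate `r` under `P`: Poisson counts with
mean `r (b - a)` on `[a, b)`, and independent counts on successive intervals. -/
structure IsPoissonProcess (r : ℝ≥0) (N : Ω → Set ℝ≥0) (P : Measure Ω) : Prop where
  measurable_count : ∀ a b : ℝ≥0, Measurable (count N a b)
  law_count : ∀ a b : ℝ≥0, a ≤ b →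
    P.map (count N a b) = (poissonMeasure (r * (b - a))).map (fun m : ℕ => (m : ℕ∞))
  indep_increments : ∀ c : ℕ → ℝ≥0, Monotone c →
    iIndepFun (fun j : ℕ => count N (c j) (c (j + 1))) P

/-- The random sets `D i k`, `i ∈ ℤ`, `k ≥ 1`, are mutually independent homogeneous Poisson point
processes on `[0, ∞)`, and `D i k` has rate `β k`. -/
structure IsJumpClocks (β : ℕ+ → ℝ≥0) (D : ℤ → ℕ+ → Ω → Set ℝ≥0) (P : Measure Ω) : Prop where
  poisson : ∀ i k, IsPoissonProcess (β k) (D i k) P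
  indep : iIndep (fun p : ℤ × ℕ+ => pointSigma (D p.1 p.2)) P

/-- The σ-algebra generated by a random configuration. -/
abbrev configSigma {Ω : Type u} (σ₀ : Ω → ℤ → Site) : MeasurableSpace Ω :=
  ⨆ i : ℤ, MeasurableSpace.comap (fun ω => σ₀ ω i) ⊤

/-- `σ₀` is a random particle configuration that is independent of the jump clocks `D`. -/
structure IsInitialConfiguration (D : ℤ → ℕ+ → Ω → Set ℝ≥0) (σ₀ : Ω → ℤ → Site)
    (P : Measure Ω) : Prop where
  measurable : ∀ (i : ℤ) (s : Site), MeasurableSet {ω | σ₀ ω i = s}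
  configuration : ∀ᵐ ω ∂P, IsConfiguration (σ₀ ω)
  indep_clocks : Indep (configSigma σ₀) (⨆ (i : ℤ) (k : ℕ+), pointSigma (D i k)) P

/-- The location at time `t` of particle `i` in the exclusion process that is constructed from the
clocks `D` and the random initial configuration `σ₀`. -/
def process {Ω : Type u} (D : ℤ → ℕ+ → Ω → Set ℝ≥0) (σ₀ : Ω → ℤ → Site) (i : ℤ) (t : ℝ≥0)
    (ω : Ω) : Site :=
  evolution (fun j k => D j k ω) (σ₀ ω) i t

end Random

/-! ### Scaling limits -/

/-- `X n / n → c` in probability, where `X n` is defined on the probability space `(Ω n, P n)`: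
`P n (|X n - n c| ≥ n ε) → 0` for every `ε > 0`. Infinite values of `X n` are at infinite
distance from `n c`. -/
def ScaledTendstoInProb {Ω : ℕ → Type*} [∀ n, MeasurableSpace (Ω n)] (P : ∀ n, Measure (Ω n))
    (X : ∀ n, Ω n → Site) (c : ℝ) : Prop :=
  ∀ ε : ℝ, 0 < ε → Tendsto
    (fun n : ℕ => P n {ω | ENNReal.ofReal (n * ε) ≤
      EReal.abs (Site.toEReal (X n ω) - ((n * c : ℝ) : EReal))}) atTop (𝓝 0)

/-- `g` is the limit shape of the exclusion process `ξ` with rates `β` started from the step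
configuration: `ξ([nx], nt) / n → t g(x/t)` in probability for all `x ≤ 0` and `t > 0`. -/
def IsLimitShape (β : ℕ+ → ℝ≥0) (g : ℝ → ℝ) : Prop :=
  ∀ (Ω : Type u) [MeasurableSpace Ω] (P : Measure Ω) [IsProbabilityMeasure P]
    (D : ℤ → ℕ+ → Ω → Set ℝ≥0), IsJumpClocks β D P →
    ∀ (x : ℝ) (t : ℝ≥0), x ≤ 0 → 0 < t →
      ScaledTendstoInProb (fun _ : ℕ => P)
        (fun n => process D (fun _ => stepConfiguration) ⌊(n : ℝ) * x⌋ ((n : ℝ≥0) * t))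
        ((t : ℝ) * g (x / t))

/-- The values `u₀(y) + t g((x - y)/t)`, `y ≥ x`, whose infimum is the Hopf-Lax formula. -/
def hopfLaxValues (u₀ g : ℝ → ℝ) (x t : ℝ) : Set ℝ :=
  {r | ∃ y : ℝ, x ≤ y ∧ r = u₀ y + t * g ((x - y) / t)}

/-- The Hopf-Lax formula `u(x,t) = inf_{y ≥ x} {u₀(y) + t g((x - y)/t)}`. -/
def hopfLax (u₀ g : ℝ → ℝ) (x t : ℝ) : ℝ :=
  sInf (hopfLaxValues u₀ g x t)

end LongJumpExclusion

end

/-!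
Write particles in labels. The jump rule `η(i) ← min {η(i) + k, η(i + 1) - 1}` is linear over the
min-plus semiring: pathwise, for the same clocks, it commutes with minima of configurations and with
adding constants (`evolution_min`, `evolution_add_const`). Almost surely every particle attempts
finitely many jumps in finite time and there are particles arbitrarily far to the right which do not
attempt any (`ae_goodClocks`), so that the evolution exists and is unique (`exists_isEvolution`,
`IsEvolution.unique`). A configuration lies below each step configuration placed at one of its
particles, and above a finite minimum of step configurations and one close-packed configuration. This
gives the two halves of the variational formula: `evolution_le_of_stepAt` and
`le_evolution_of_grid`. Given a law of large numbers for the step process, a finite grid of labels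
suffices in the lower bound, since the limit shape is continuous and since the step process has hardly
moved far behind its front; the probability of a finite union of bad events tends to `0`
(`tendsto_hopfLax`).

For the step process, time is cut into steps of length `1 / N` and at most one jump per particle is
executed in each step, in parallel. For a fixed particle and a fixed time horizon this agrees with the
step process unless two epochs fall into the same time step, which has vanishing probability as
`N → ∞` (`tendsto_measure_step_ne`). Displacements `disp` of the discrete process are subadditive in
(label, time) (`disp_add_le`), and the second summand is a copy of the displacement that is
independent of the first. Hence mean displacements are subadditive, their scaling limit `limDisp`
exists and is convex, and the limit shape is `g(x) = x + limDisp(-x)`.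

The second moment of the rates bounds the variance of a block displacement, so that a sum of
independent blocks exceeds its mean by little in `L¹` (`integral_excess_le`). An upper bound in `L¹`
together with convergence of the mean gives convergence in `L¹` (`eventually_integral_abs_le`); no
subadditive ergodic theorem is required. All estimates are uniform in `N`, and the passage to
continuous time is made along an ultrafilter of values of `N`.

Two further estimates concern the ends of the profile. A particle with `m` particles in front of it
moves only after these have attempted jumps in succession, which makes its mean displacement at time
`s` of order `s ^ (m + 1) / (m + 1)!` (`meanDisp_le_choose`); thus `limDisp` vanishes at infinity.
Continuity at the front, where convexity says nothing, comes from a first moment bound on the Laplace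
transform: in `disp_add_le` equality holds for some restart particle (`exists_disp_add_ge`), and
summing over all of them bounds the Laplace transform by a power of its value for the free leading
particle (`pow_mul_expDisp_le`, `le_meanDisp_mul`).
-/

noncomputable section

namespace LongJumpExclusion

/-! ### One particle driven by its right neighbour -/

/-- The path `q` of one particle that starts at `a`, attempts jumps at the epochs `E k`, and is
blocked by a right neighbour with path `p`. -/
structure IsParticlePath (E : ℕ+ → Set ℝ≥0) (p : ℝ≥0 → Site) (a : Site) (q : ℝ≥0 → Site) :
    Prop where
  initial : q 0 = a
  constant : ∀ s t : ℝ≥0, s ≤ t → (∀ k, E k ∩ Set.Ioc s t = ∅) → q t = q s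
  jump : ∀ k, ∀ τ ∈ E k,
    ∀ᶠ s in 𝓝[<] τ, q τ = min (q s + Site.ofInt (k : ℕ)) (p s + Site.ofInt (-1))

/-- The epochs of all jump lengths in the time interval `(0, t]`. -/
def epochs (E : ℕ+ → Set ℝ≥0) (t : ℝ≥0) : Set ℝ≥0 := {τ | 0 < τ ∧ τ ≤ t ∧ ∃ k, τ ∈ E k}

/-- The path is eventually constant to the left of every positive time. -/
def HasLeftValues (p : ℝ≥0 → Site) : Prop := ∀ τ, 0 < τ → ∃ v, ∀ᶠ s in 𝓝[<] τ, p s = v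

lemma nhdsLT_neBot_of_pos {τ : ℝ≥0} (h : 0 < τ) : (𝓝[<] τ).NeBot :=
  nhdsLT_neBot_of_exists_lt ⟨0, h⟩

lemma eventually_epochs_eq {E : ℕ+ → Set ℝ≥0} (hE : ∀ T, (epochs E T).Finite) {τ : ℝ≥0}
    (hτ : 0 < τ) : ∀ᶠ s in 𝓝[<] τ, s < τ ∧ ∀ k, E k ∩ Set.Ioo s τ = ∅ := by
  have hfin : (epochs E τ \ {τ}).Finite := (hE τ).subset Set.sdiff_subset
  obtain ⟨r, hr0, hr⟩ : ∃ r, r < τ ∧ ∀ x ∈ epochs E τ \ {τ}, x ≤ r := by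
    by_cases hne : (epochs E τ \ {τ}).Nonempty
    · obtain ⟨r, hr, hmax⟩ := Set.exists_max_image _ id hfin hne
      exact ⟨r, lt_of_le_of_ne hr.1.2.1 hr.2, hmax⟩
    · exact ⟨0, hτ, fun x hx => absurd ⟨x, hx⟩ hne⟩
  filter_upwards [Ioo_mem_nhdsLT hr0] with s hs
  refine ⟨hs.2, fun k => Set.eq_empty_of_forall_notMem ?_⟩
  rintro x ⟨hxE, hx1, hx2⟩
  have := hr x ⟨⟨lt_of_le_of_lt zero_le hx1, hx2.le, k, hxE⟩, hx2.ne⟩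
  exact absurd (lt_of_lt_of_le (hs.1.trans hx1) this) (lt_irrefl _)

lemma IsParticlePath.hasLeftValues {E : ℕ+ → Set ℝ≥0} (hE : ∀ T, (epochs E T).Finite)
    {p q : ℝ≥0 → Site} {a : Site} (h : IsParticlePath E p a q) : HasLeftValues q := by
  intro τ hτ
  have := nhdsLT_neBot_of_pos hτ
  obtain ⟨s₀, hs₀, h0⟩ := (eventually_epochs_eq hE hτ).exists
  refine ⟨q s₀, ?_⟩
  filter_upwards [Ioo_mem_nhdsLT hs₀] with s hs
  refine h.constant _ _ hs.1.le fun k => Set.eq_empty_of_forall_notMem ?_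
  rintro x ⟨hx, hx1, hx2⟩
  exact (h0 k).subset ⟨hx, hx1, hx2.trans_lt hs.2⟩

/-- A particle path is determined by its initial value and the path of the right neighbour. -/
lemma IsParticlePath.unique {E : ℕ+ → Set ℝ≥0} (hE : ∀ T, (epochs E T).Finite)
    {p p' q q' : ℝ≥0 → Site} {a : Site} (h : IsParticlePath E p a q)
    (h' : IsParticlePath E p' a q') {T : ℝ≥0} (hp : ∀ t ≤ T, p t = p' t) :
    ∀ t ≤ T, q t = q' t := by
  suffices H : ∀ n : ℕ, ∀ t ≤ T, (epochs E t).ncard = n → q t = q' t from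
    fun t ht => H _ t ht rfl
  intro n
  induction n using Nat.strong_induction_on with
  | _ n ih =>
    intro t ht hn
    by_cases hne : (epochs E t).Nonempty
    · obtain ⟨τ, ⟨hτ0, hτt, k, hk⟩, hmax⟩ := Set.exists_max_image _ id (hE t) hne
      have hc : ∀ k, E k ∩ Set.Ioc τ t = ∅ := fun k =>
        Set.eq_empty_of_forall_notMem fun x ⟨hx, hx1, hx2⟩ =>
          absurd (hmax x ⟨hτ0.trans hx1, hx2, k, hx⟩) (not_le.2 hx1)
      rw [h.constant _ _ hτt hc, h'.constant _ _ hτt hc]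
      have := nhdsLT_neBot_of_pos hτ0
      obtain ⟨s, hs, h1, h2⟩ := ((eventually_mem_nhdsWithin).and
        ((h.jump k τ hk).and (h'.jump k τ hk))).exists
      have hst : s < τ := hs
      have hsT : s ≤ T := (hst.le.trans hτt).trans ht
      have hlt : (epochs E s).ncard < n := by
        rw [← hn]
        refine Set.ncard_lt_ncard ⟨fun x hx => ⟨hx.1, hx.2.1.trans (hst.le.trans hτt), hx.2.2⟩,
          fun hsub => ?_⟩ (hE t)
        exact absurd (hsub ⟨hτ0, hτt, k, hk⟩).2.1 (not_le.2 hst)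
      rw [h1, h2, hp s hsT, ih _ hlt s hsT rfl]
    · have hc : ∀ k, E k ∩ Set.Ioc 0 t = ∅ := fun k =>
        Set.eq_empty_of_forall_notMem fun x ⟨hx, hx1, hx2⟩ => hne ⟨x, hx1, hx2, k, hx⟩
      rw [h.constant _ _ zero_le hc, h'.constant _ _ zero_le hc, h.initial, h'.initial]

/-- A particle path exists: it is computed by applying the jump rule successively at the finitely
many epochs. -/
lemma exists_isParticlePath {E : ℕ+ → Set ℝ≥0} (hE : ∀ T, (epochs E T).Finite)
    (hdisj : ∀ k k' τ, τ ∈ E k → τ ∈ E k' → k = k') {p : ℝ≥0 → Site} (hp : HasLeftValues p)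
    (a : Site) : ∃ q, IsParticlePath E p a q := by
  classical
  have hv : ∀ τ, ∃ v, 0 < τ → ∀ᶠ s in 𝓝[<] τ, p s = v := fun τ => by
    by_cases h : 0 < τ
    · obtain ⟨v, hv⟩ := hp τ h
      exact ⟨v, fun _ => hv⟩
    · exact ⟨⊥, fun h' => absurd h' h⟩
  choose v hv using hv
  have hkk : ∀ τ, ∃ k : ℕ+, (∃ k', τ ∈ E k') → τ ∈ E k := fun τ => by
    by_cases h : ∃ k', τ ∈ E k'
    · obtain ⟨k, hk⟩ := h
      exact ⟨k, fun _ => hk⟩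
    · exact ⟨1, fun h' => absurd h' h⟩
  choose κ hκ using hkk
  let F : ℝ≥0 → Finset ℝ≥0 := fun t => (hE t).toFinset
  let st : ℝ≥0 → Site → Site := fun τ b =>
    min (b + Site.ofInt ((κ τ : ℕ+) : ℕ)) (v τ + Site.ofInt (-1))
  let q : ℝ≥0 → Site := fun t => ((F t).sort (· ≥ ·)).foldr st a
  have hmem : ∀ t x, x ∈ F t ↔ 0 < x ∧ x ≤ t ∧ ∃ k, x ∈ E k := fun t x => by
    simp [F, epochs]
  refine ⟨q, ⟨?_, ?_, ?_⟩⟩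
  · have : F 0 = ∅ := by
      ext x
      simp only [hmem, Finset.notMem_empty, iff_false]
      rintro ⟨h1, h2, -⟩
      exact absurd h1 (not_lt.2 h2)
    simp [q, this]
  · intro s t hst hc
    have : F t = F s := by
      ext x
      simp only [hmem]
      refine ⟨fun ⟨h1, h2, k, hk⟩ => ⟨h1, ?_, k, hk⟩, fun ⟨h1, h2, h3⟩ => ⟨h1, h2.trans hst, h3⟩⟩
      by_contra hlt
      exact (hc k).subset ⟨hk, not_le.1 hlt, h2⟩
    simp [q, this]
  · intro k τ hk
    rcases eq_or_lt_of_le (zero_le (a := τ)) with h0 | h0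
    · have hb : 𝓝[<] τ = ⊥ := by
        rw [← h0]
        have : Set.Iio (0 : ℝ≥0) = ∅ := by ext; simp
        rw [this, nhdsWithin_empty]
      rw [hb]
      exact eventually_bot
    · filter_upwards [eventually_epochs_eq hE h0, hv τ h0] with s ⟨hs, hs'⟩ hps
      have hκk : κ τ = k := hdisj _ _ τ (hκ τ ⟨k, hk⟩) hk
      have hns : τ ∉ F s := by
        rw [hmem]
        rintro ⟨-, h, -⟩
        exact absurd h (not_le.2 hs)
      have hF : F τ = insert τ (F s) := by
        ext x
        simp only [Finset.mem_insert, hmem]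
        constructor
        · rintro ⟨h1, h2, k', hk'⟩
          rcases eq_or_lt_of_le h2 with h3 | h3
          · exact Or.inl h3
          · refine Or.inr ⟨h1, ?_, k', hk'⟩
            by_contra hlt
            exact (hs' k').subset ⟨hk', not_le.1 hlt, h3⟩
        · rintro (rfl | ⟨h1, h2, h3⟩)
          · exact ⟨h0, le_rfl, k, hk⟩
          · exact ⟨h1, h2.trans hs.le, h3⟩
      have hge : ∀ b ∈ F s, τ ≥ b := fun b hb => (((hmem s b).1 hb).2.1).trans hs.le
      have hq : q τ = st τ (q s) := by
        simp only [q]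
        rw [hF, Finset.sort_insert _ hge hns, List.foldr_cons]
      rw [hq]
      simp only [st, hκk, hps]

/-! ### Existence and uniqueness of the evolution -/

/-- Realizations of the clocks for which the exclusion process is well defined: the epochs of each
particle are locally finite, jumps of different lengths of one particle never coincide, and for
every time horizon there are particles arbitrarily far to the right that do not attempt to move. -/
structure GoodClocks (D : ℤ → ℕ+ → Set ℝ≥0) : Prop where
  finite : ∀ i T, (epochs (D i) T).Finite
  disjoint : ∀ i k k' τ, τ ∈ D i k → τ ∈ D i k' → k = k'
  frozen : ∀ i T, ∃ m, i ≤ m ∧ epochs (D m) T = ∅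

lemma inter_Ioc_of_epochs_eq_empty {E : ℕ+ → Set ℝ≥0} {T s t : ℝ≥0} (h : epochs E T = ∅)
    (ht : t ≤ T) (k : ℕ+) : E k ∩ Set.Ioc s t = ∅ :=
  Set.eq_empty_of_forall_notMem fun _ ⟨hx, hx1, hx2⟩ =>
    h.subset ⟨zero_le.trans_lt hx1, hx2.trans ht, k, hx⟩

lemma IsEvolution.isParticlePath {D : ℤ → ℕ+ → Set ℝ≥0} {σ₀ : ℤ → Site} {η : ℤ → ℝ≥0 → Site}
    (h : IsEvolution D σ₀ η) (i : ℤ) : IsParticlePath (D i) (η (i + 1)) (σ₀ i) (η i) :=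
  ⟨h.initial i, h.constant i, h.jump i⟩

lemma isEvolution_of_isParticlePath {D : ℤ → ℕ+ → Set ℝ≥0} {σ₀ : ℤ → Site} {η : ℤ → ℝ≥0 → Site}
    (h : ∀ i, IsParticlePath (D i) (η (i + 1)) (σ₀ i) (η i)) : IsEvolution D σ₀ η :=
  ⟨fun i => (h i).initial, fun i => (h i).constant, fun i => (h i).jump⟩

/-- Particles to the left of `m` are determined by their initial positions and by the path of
particle `m`. -/
lemma eqOn_of_isParticlePath {D : ℤ → ℕ+ → Set ℝ≥0} (hD : GoodClocks D) {σ₀ : ℤ → Site}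
    {η η' : ℤ → ℝ≥0 → Site} {i m : ℤ}
    (h : ∀ j, i ≤ j → j < m → IsParticlePath (D j) (η (j + 1)) (σ₀ j) (η j))
    (h' : ∀ j, i ≤ j → j < m → IsParticlePath (D j) (η' (j + 1)) (σ₀ j) (η' j))
    {T : ℝ≥0} (hm : ∀ t ≤ T, η m t = η' m t) :
    ∀ j, i ≤ j → j ≤ m → ∀ t ≤ T, η j t = η' j t := by
  have key : ∀ n : ℕ, i ≤ m - n → ∀ t ≤ T, η (m - n) t = η' (m - n) t := by
    intro n
    induction n with
    | zero => simpa using fun _ => hm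
    | succ n ih =>
      intro hi
      have e : m - ((n + 1 : ℕ) : ℤ) + 1 = m - n := by push_cast; ring
      refine (h _ hi (by push_cast; omega)).unique (hD.finite _) (h' _ hi (by push_cast; omega)) ?_
      rw [e]
      exact ih (by push_cast at hi; omega)
  intro j hj hjm
  have := key (m - j).toNat (by omega)
  have e : m - ((m - j).toNat : ℤ) = j := by omega
  rwa [e] at this

/-- Uniqueness of the evolution, in local form: the particles `j ≥ i` do not feel the particles to
the left of `i`. -/
lemma IsEvolution.unique {D : ℤ → ℕ+ → Set ℝ≥0} (hD : GoodClocks D) {σ₀ σ₀' : ℤ → Site}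
    {η η' : ℤ → ℝ≥0 → Site} (h : IsEvolution D σ₀ η) (h' : IsEvolution D σ₀' η') {i : ℤ}
    (hσ : ∀ j, i ≤ j → σ₀ j = σ₀' j) (t : ℝ≥0) : η i t = η' i t := by
  obtain ⟨m, him, hm⟩ := hD.frozen i t
  refine eqOn_of_isParticlePath hD (σ₀ := σ₀) (fun j _ _ => h.isParticlePath j)
    (fun j hj _ => ?_) (T := t) (fun s hs => ?_) i le_rfl him t le_rfl
  · rw [hσ j hj]
    exact h'.isParticlePath j
  · rw [h.constant m 0 s zero_le (inter_Ioc_of_epochs_eq_empty hm hs),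
      h'.constant m 0 s zero_le (inter_Ioc_of_epochs_eq_empty hm hs), h.initial, h'.initial,
      hσ m him]

/-- The paths of the particles `j ≤ m` when particle `m` is held fixed. -/
lemma exists_paths_left_of {D : ℤ → ℕ+ → Set ℝ≥0} (hD : GoodClocks D) (σ₀ : ℤ → Site) (m : ℤ) :
    ∃ η : ℤ → ℝ≥0 → Site, (∀ t, η m t = σ₀ m) ∧
      ∀ j, j < m → IsParticlePath (D j) (η (j + 1)) (σ₀ j) (η j) := by
  have hex : ∀ (j : ℤ) (p : {p : ℝ≥0 → Site // HasLeftValues p}),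
      ∃ q : {p : ℝ≥0 → Site // HasLeftValues p}, IsParticlePath (D j) p.1 (σ₀ j) q.1 := by
    rintro j ⟨p, hp⟩
    obtain ⟨q, hq⟩ := exists_isParticlePath (hD.finite j) (hD.disjoint j) hp (σ₀ j)
    exact ⟨⟨q, hq.hasLeftValues (hD.finite j)⟩, hq⟩
  choose next hnext using hex
  let path : ℕ → {p : ℝ≥0 → Site // HasLeftValues p} := fun n =>
    Nat.rec ⟨fun _ => σ₀ m, fun _ _ => ⟨_, Eventually.of_forall fun _ => rfl⟩⟩
      (fun n p => next (m - n - 1) p) n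
  refine ⟨fun j => (path (m - j).toNat).1, fun t => by simp [path], fun j hj => ?_⟩
  obtain ⟨n, rfl⟩ : ∃ n : ℕ, j = m - n - 1 := ⟨(m - j - 1).toNat, by omega⟩
  have e1 : (m - (m - n - 1 + 1)).toNat = n := by omega
  have e2 : (m - (m - n - 1)).toNat = n + 1 := by omega
  simp only [e1, e2]
  exact hnext (m - n - 1) (path n)

lemma exists_isEvolution {D : ℤ → ℕ+ → Set ℝ≥0} (hD : GoodClocks D) (σ₀ : ℤ → Site) :
    ∃ η, IsEvolution D σ₀ η := by
  choose fr hfr hfr0 using hD.frozen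
  choose ζ hζm hζ using exists_paths_left_of hD σ₀
  -- holding any frozen particle `m` fixed gives the same paths up to time `T`
  have cons : ∀ i T m m', i ≤ m → m ≤ m' → epochs (D m) T = ∅ → epochs (D m') T = ∅ →
      ∀ t ≤ T, ζ m i t = ζ m' i t := by
    intro i T m m' him hmm hm hm' t ht
    refine eqOn_of_isParticlePath hD (i := i) (σ₀ := σ₀) (fun j _ hj => hζ m j hj)
      (fun j _ hj => hζ m' j (hj.trans_le hmm)) (T := T) (fun s hs => ?_) i le_rfl him t ht
    rw [hζm]
    rcases eq_or_lt_of_le hmm with rfl | hlt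
    · rw [hζm]
    · rw [(hζ m' m hlt).constant 0 s zero_le (inter_Ioc_of_epochs_eq_empty hm hs),
        (hζ m' m hlt).initial]
  have mono : ∀ j {s T : ℝ≥0}, s ≤ T → epochs (D j) T = ∅ → epochs (D j) s = ∅ :=
    fun j s T hs h => Set.eq_empty_of_forall_notMem fun x hx =>
      h.subset ⟨hx.1, hx.2.1.trans hs, hx.2.2⟩
  have key : ∀ i T m, i ≤ m → epochs (D m) T = ∅ → ∀ t ≤ T, ζ (fr i t) i t = ζ m i t := by
    intro i T m him hm t ht
    rcases le_total m (fr i t) with h | h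
    · exact (cons i t _ _ him h (mono m ht hm) (hfr0 i t) t le_rfl).symm
    · exact cons i t _ _ (hfr i t) h (hfr0 i t) (mono m ht hm) t le_rfl
  refine ⟨fun i t => ζ (fr i t) i t, isEvolution_of_isParticlePath fun i => ⟨?_, ?_, ?_⟩⟩
  · have h1 := hfr0 (i + 1) 0
    have h2 := hfr (i + 1) 0
    simp only [key i 0 _ (by omega) h1 0 le_rfl]
    exact (hζ _ i (by omega)).initial
  · intro s t hst hc
    have h1 := hfr0 (i + 1) t
    have h2 := hfr (i + 1) t
    simp only [key i t _ (by omega) h1 t le_rfl, key i t _ (by omega) h1 s hst]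
    exact (hζ _ i (by omega)).constant s t hst hc
  · intro k τ hk
    have h1 := hfr0 (i + 1) τ
    have h2 := hfr (i + 1) τ
    filter_upwards [(hζ (fr (i + 1) τ) i (by omega)).jump k τ hk, eventually_mem_nhdsWithin]
      with s hs hsτ
    have hsτ' : s ≤ τ := le_of_lt hsτ
    simp only [key i τ _ (by omega) h1 τ le_rfl, key i τ _ (by omega) h1 s hsτ',
      key (i + 1) τ _ h2 h1 s hsτ']
    exact hs

lemma evolution_isEvolution {D : ℤ → ℕ+ → Set ℝ≥0} (hD : GoodClocks D) (σ₀ : ℤ → Site) :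
    IsEvolution D σ₀ (evolution D σ₀) := by
  have h := exists_isEvolution hD σ₀
  rw [evolution, dif_pos h]
  exact h.choose_spec

lemma evolution_eq_of_isEvolution {D : ℤ → ℕ+ → Set ℝ≥0} (hD : GoodClocks D) {σ₀ : ℤ → Site}
    {η : ℤ → ℝ≥0 → Site} (h : IsEvolution D σ₀ η) (i : ℤ) (t : ℝ≥0) :
    evolution D σ₀ i t = η i t :=
  (evolution_isEvolution hD σ₀).unique hD h (fun _ _ => rfl) t

/-! ### Min-plus linearity -/

lemma IsEvolution.min {D : ℤ → ℕ+ → Set ℝ≥0} {σ₀ σ₀' : ℤ → Site} {η η' : ℤ → ℝ≥0 → Site}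
    (h : IsEvolution D σ₀ η) (h' : IsEvolution D σ₀' η') :
    IsEvolution D (fun i => min (σ₀ i) (σ₀' i)) (fun i t => min (η i t) (η' i t)) where
  initial i := by rw [h.initial, h'.initial]
  constant i s t hst hc := by rw [h.constant i s t hst hc, h'.constant i s t hst hc]
  jump i k τ hk := by
    filter_upwards [h.jump i k τ hk, h'.jump i k τ hk] with s h1 h2
    rw [h1, h2, min_add, min_add, min_min_min_comm]

lemma IsEvolution.add_const {D : ℤ → ℕ+ → Set ℝ≥0} {σ₀ : ℤ → Site} {η : ℤ → ℝ≥0 → Site}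
    (h : IsEvolution D σ₀ η) (c : Site) :
    IsEvolution D (fun i => σ₀ i + c) (fun i t => η i t + c) where
  initial i := by rw [h.initial]
  constant i s t hst hc := by rw [h.constant i s t hst hc]
  jump i k τ hk := by
    filter_upwards [h.jump i k τ hk] with s h1
    rw [h1, min_add, add_right_comm, add_right_comm (η (i + 1) s)]

lemma evolution_add_const {D : ℤ → ℕ+ → Set ℝ≥0} (hD : GoodClocks D) (σ₀ : ℤ → Site) (c : Site)
    (i : ℤ) (t : ℝ≥0) : evolution D (fun j => σ₀ j + c) i t = evolution D σ₀ i t + c :=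
  evolution_eq_of_isEvolution hD ((evolution_isEvolution hD σ₀).add_const c) i t

lemma evolution_min {D : ℤ → ℕ+ → Set ℝ≥0} (hD : GoodClocks D) (σ₀ σ₀' : ℤ → Site)
    (i : ℤ) (t : ℝ≥0) : evolution D (fun j => min (σ₀ j) (σ₀' j)) i t =
      min (evolution D σ₀ i t) (evolution D σ₀' i t) :=
  evolution_eq_of_isEvolution hD
    ((evolution_isEvolution hD σ₀).min (evolution_isEvolution hD σ₀')) i t

lemma evolution_mono {D : ℤ → ℕ+ → Set ℝ≥0} (hD : GoodClocks D) {σ₀ σ₀' : ℤ → Site} {i : ℤ}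
    (hσ : ∀ j, i ≤ j → σ₀ j ≤ σ₀' j) (t : ℝ≥0) : evolution D σ₀ i t ≤ evolution D σ₀' i t := by
  have h := (evolution_isEvolution hD σ₀).min (evolution_isEvolution hD σ₀')
  rw [(evolution_isEvolution hD σ₀).unique hD h (fun j hj => (min_eq_left (hσ j hj)).symm) t]
  exact min_le_right _ _

/-- The step configuration in which particle `j` is the rightmost one and sits at `0`. -/
def stepAt (j : ℤ) (i : ℤ) : Site := stepConfiguration (i - j)

lemma evolution_shift {D : ℤ → ℕ+ → Set ℝ≥0} (hD : GoodClocks D) (j i : ℤ) (t : ℝ≥0) :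
    evolution D (stepAt j) i t = evolution (fun m => D (m + j)) stepConfiguration (i - j) t := by
  have hD' : GoodClocks (fun m => D (m + j)) :=
    ⟨fun i T => hD.finite _ T, fun i => hD.disjoint _, fun i T => by
      obtain ⟨m, hm, h⟩ := hD.frozen (i + j) T
      exact ⟨m - j, by omega, by simpa using h⟩⟩
  have h := evolution_isEvolution hD (stepAt j)
  have h2 : IsEvolution (fun m => D (m + j)) stepConfiguration
      (fun m s => evolution D (stepAt j) (m + j) s) :=
    ⟨fun m => by rw [h.initial]; simp [stepAt], fun m => h.constant _, fun m k τ hk => by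
      have := h.jump (m + j) k τ hk
      rwa [add_right_comm] at this⟩
  rw [evolution_eq_of_isEvolution hD' h2]
  simp

lemma ofInt_add (a b : ℤ) : Site.ofInt (a + b) = Site.ofInt a + Site.ofInt b := rfl

lemma ofInt_le {a b : ℤ} : Site.ofInt a ≤ Site.ofInt b ↔ a ≤ b := by
  simp [Site.ofInt]

lemma le_infty (s : Site) : s ≤ Site.infty := le_top

lemma ofInt_min (a b : ℤ) : Site.ofInt (min a b) = min (Site.ofInt a) (Site.ofInt b) :=
  (Monotone.map_min (f := Site.ofInt) fun _ _ h => ofInt_le.2 h)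

lemma infty_add_ofInt (a : ℤ) : Site.infty + Site.ofInt a = Site.infty := rfl

/-- A close-packed configuration cannot move. -/
lemma evolution_packed {D : ℤ → ℕ+ → Set ℝ≥0} (hD : GoodClocks D) (i : ℤ) (t : ℝ≥0) :
    evolution D Site.ofInt i t = Site.ofInt i := by
  refine evolution_eq_of_isEvolution hD (η := fun i _ => Site.ofInt i)
    ⟨fun _ => rfl, fun _ _ _ _ _ => rfl, fun i k τ _ => Eventually.of_forall fun s => ?_⟩ i t
  rw [← ofInt_add, ← ofInt_add, ← ofInt_min]
  congr 1
  have := k.pos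
  omega

lemma IsConfiguration.add_le {σ : ℤ → Site} (h : IsConfiguration σ) {i j : ℤ} (hij : i ≤ j) :
    σ i + Site.ofInt (j - i) ≤ σ j := by
  obtain ⟨n, rfl⟩ := Int.le.dest hij
  clear hij
  induction n with
  | zero =>
    have : Site.ofInt 0 = 0 := rfl
    simp [this]
  | succ n ih =>
    have e : i + ((n + 1 : ℕ) : ℤ) - i = (i + n - i) + 1 := by push_cast; ring
    rw [e, ofInt_add, ← add_assoc]
    have := h (i + n)
    push_cast
    rw [← add_assoc i]
    exact (add_le_add_left ih _).trans this

/-- The upper bound in the variational formula: the process is bounded above by the process that is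
started from the step configuration whose rightmost particle is particle `j`. -/
lemma evolution_le_of_stepAt {D : ℤ → ℕ+ → Set ℝ≥0} (hD : GoodClocks D) {σ : ℤ → Site}
    (hσ : IsConfiguration σ) (i j : ℤ) (z : ℤ) (hz : σ j ≤ Site.ofInt z) (t : ℝ≥0) :
    evolution D σ i t ≤ evolution D (stepAt j) i t + Site.ofInt z := by
  rw [← evolution_add_const hD]
  refine evolution_mono hD (fun m _ => ?_) t
  rw [stepAt, stepConfiguration]
  split_ifs with h
  · have h1 := hσ.add_le (show m ≤ j by omega)
    have h2 : σ m = (σ m + Site.ofInt (j - m)) + Site.ofInt (m - j) := by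
      rw [add_assoc, ← ofInt_add, show j - m + (m - j) = 0 by ring]
      exact (add_zero _).symm
    rw [h2, add_comm (Site.ofInt (m - j))]
    exact add_le_add_left (h1.trans hz) _
  · rw [infty_add_ofInt]
    exact le_infty _

/-- The lower bound in the variational formula, for a finite grid `j 0, ..., j K` of labels:
between grid points the initial configuration is bounded below by its value at the left grid point,
and to the right of the last grid point it is at least as spread out as a packed configuration. -/
lemma le_evolution_of_grid {D : ℤ → ℕ+ → Set ℝ≥0} (hD : GoodClocks D) {σ : ℤ → Site}
    (hσ : IsConfiguration σ) (j z : ℕ → ℤ) (K : ℕ)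
    (hz : ∀ l ≤ K, Site.ofInt (z l) ≤ σ (j l)) (t : ℝ≥0) (b : Site)
    (hb : ∀ l < K, b ≤ evolution D (stepAt (j (l + 1))) (j 0) t + Site.ofInt (z l))
    (hbK : b ≤ Site.ofInt (j 0 - j K + z K)) : b ≤ evolution D σ (j 0) t := by
  let w : ℕ → ℤ → Site := fun n => Nat.rec (fun m => Site.ofInt m + Site.ofInt (z K - j K))
    (fun l w m => min (w m) (stepAt (j (l + 1)) m + Site.ofInt (z l))) n
  have hw : ∀ n ≤ K, b ≤ evolution D (w n) (j 0) t := by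
    intro n
    induction n with
    | zero =>
      intro _
      change b ≤ evolution D (fun m => Site.ofInt m + Site.ofInt (z K - j K)) (j 0) t
      rw [evolution_add_const hD, evolution_packed hD, ← ofInt_add]
      convert hbK using 2
      ring
    | succ n ih =>
      intro hn
      change b ≤ evolution D
        (fun m => min (w n m) (stepAt (j (n + 1)) m + Site.ofInt (z n))) (j 0) t
      rw [evolution_min hD, evolution_add_const hD]
      exact le_min (ih (by omega)) (hb n (by omega))
  refine (hw K le_rfl).trans (evolution_mono hD (fun m hm => ?_) t)
  have hwmono : ∀ n l, l < n → w n m ≤ stepAt (j (l + 1)) m + Site.ofInt (z l) := by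
    intro n
    induction n with
    | zero => intro l hl; omega
    | succ n ih =>
      intro l hl
      rcases Nat.lt_succ_iff_lt_or_eq.1 hl with h | rfl
      · exact (min_le_left _ _).trans (ih l h)
      · exact min_le_right _ _
  have hw0 : ∀ n, w n m ≤ Site.ofInt m + Site.ofInt (z K - j K) := by
    intro n
    induction n with
    | zero => exact le_rfl
    | succ n ih => exact (min_le_left _ _).trans ih
  by_cases hmK : j K ≤ m
  · refine (hw0 K).trans ?_
    have h1 := hσ.add_le hmK
    refine le_trans (le_of_eq ?_) ((add_le_add_left (hz K le_rfl) _).trans h1)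
    rw [← ofInt_add, ← ofInt_add]
    congr 1
    ring
  · obtain ⟨l, hlK, hl1, hl2⟩ : ∃ l < K, j l ≤ m ∧ m < j (l + 1) := by
      by_contra hcon
      push Not at hcon
      have : ∀ l ≤ K, j l ≤ m := by
        intro l
        induction l with
        | zero => exact fun _ => hm
        | succ l ih => exact fun h => hcon l (by omega) (ih (by omega))
      exact hmK (this K le_rfl)
    refine (hwmono K l hlK).trans ?_
    have h1 := hσ.add_le hl1
    refine le_trans ?_ ((add_le_add_left (hz l hlK.le) _).trans h1)
    rw [stepAt, stepConfiguration, if_pos (by omega), ← ofInt_add, ← ofInt_add, ofInt_le]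
    omega

/-! ### The exclusion process in discrete time -/

/-- Displacements in the discrete-time step process: `disp κ m L` is the distance that particle `-m`,
which starts at `-m` behind `m` other particles, has covered after `L` time steps, where `κ p l` is
the length of the jump that particle `-p` attempts at time step `l` and all particles are updated in
parallel. In terms of displacements the exclusion rule says that particle `-(m + 1)` cannot overtake
the displacement of particle `-m`. -/
def disp (κ : ℕ → ℕ → ℕ) : ℕ → ℕ → ℕ
  | _, 0 => 0
  | 0, L + 1 => disp κ 0 L + κ 0 L
  | m + 1, L + 1 => min (disp κ (m + 1) L + κ (m + 1) L) (disp κ m L)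

/-- The jump lengths as seen from particle `-a` at time `b`. -/
def shiftJumps (κ : ℕ → ℕ → ℕ) (a b : ℕ) : ℕ → ℕ → ℕ := fun p l => κ (p + a) (l + b)

section Deterministic

variable (κ : ℕ → ℕ → ℕ)

@[simp] lemma disp_zero_right (m : ℕ) : disp κ m 0 = 0 := by simp [disp]

lemma disp_zero_succ (L : ℕ) : disp κ 0 (L + 1) = disp κ 0 L + κ 0 L := by simp [disp]

lemma disp_succ_succ (m L : ℕ) :
    disp κ (m + 1) (L + 1) = min (disp κ (m + 1) L + κ (m + 1) L) (disp κ m L) := by simp [disp]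

lemma disp_succ_le (m L : ℕ) : disp κ (m + 1) L ≤ disp κ m L := by
  induction L generalizing m with
  | zero => simp
  | succ L ih =>
    rw [disp_succ_succ]
    refine (min_le_right _ _).trans ?_
    cases m with
    | zero => rw [disp_zero_succ]; omega
    | succ m =>
      rw [disp_succ_succ]
      exact le_min (Nat.le_add_right _ _) (ih m)

lemma disp_antitone_left {m m' : ℕ} (h : m ≤ m') (L : ℕ) : disp κ m' L ≤ disp κ m L :=
  antitone_nat_of_succ_le (f := fun m => disp κ m L) (fun m => disp_succ_le κ m L) h

lemma disp_le_disp_succ (m L : ℕ) : disp κ m L ≤ disp κ m (L + 1) := by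
  cases m with
  | zero => rw [disp_zero_succ]; omega
  | succ m =>
    rw [disp_succ_succ]
    exact le_min (Nat.le_add_right _ _) (disp_succ_le κ m L)

lemma disp_monotone_right (m : ℕ) {L L' : ℕ} (h : L ≤ L') : disp κ m L ≤ disp κ m L' :=
  monotone_nat_of_le_succ (f := fun L => disp κ m L) (disp_le_disp_succ κ m) h

lemma disp_succ_right_le_add (m L : ℕ) : disp κ m (L + 1) ≤ disp κ m L + κ m L := by
  cases m with
  | zero => rw [disp_zero_succ]
  | succ m =>
    rw [disp_succ_succ]
    exact min_le_left _ _

lemma disp_le_disp_zero (m L : ℕ) : disp κ m L ≤ disp κ 0 L :=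
  disp_antitone_left κ (Nat.zero_le m) L

lemma disp_zero_eq_sum (L : ℕ) : disp κ 0 L = ∑ l ∈ Finset.range L, κ 0 l := by
  induction L with
  | zero => simp
  | succ L ih => rw [disp_zero_succ, ih, Finset.sum_range_succ]

/-- Subadditivity: restart the process at time `b` with particle `-a` as the rightmost particle. -/
lemma disp_add_le (a b m L : ℕ) :
    disp κ (a + m) (b + L) ≤ disp κ a b + disp (shiftJumps κ a b) m L := by
  induction L generalizing m with
  | zero => simpa using disp_antitone_left κ (Nat.le_add_right a m) b
  | succ L ih =>
    rw [← add_assoc b]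
    cases m with
    | zero =>
      rw [disp_zero_succ]
      have h1 := disp_succ_right_le_add κ (a + 0) (b + L)
      have h2 := ih 0
      have e : shiftJumps κ a b 0 L = κ (a + 0) (b + L) := by
        simp [shiftJumps, add_comm]
      omega
    | succ m =>
      rw [← add_assoc a, disp_succ_succ, disp_succ_succ]
      have h1 := ih (m + 1)
      have h2 := ih m
      have e : shiftJumps κ a b (m + 1) L = κ (a + m + 1) (b + L) := by
        simp only [shiftJumps]; congr 1 <;> ring
      rw [← add_assoc a] at h1
      rw [e]
      omega

/-- In the subadditive inequality, equality holds for the best choice of the restart particle. -/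
lemma exists_disp_add_ge (m b L : ℕ) :
    ∃ a ≤ m, disp κ a b + disp (shiftJumps κ a b) (m - a) L ≤ disp κ m (b + L) := by
  induction L generalizing m with
  | zero => exact ⟨m, le_rfl, by simp⟩
  | succ L ih =>
    rw [← add_assoc b]
    have step : disp κ m (b + L + 1) = disp κ m (b + L) + κ m (b + L) ∨
        ∃ m', m = m' + 1 ∧ disp κ m (b + L + 1) = disp κ m' (b + L) := by
      cases m with
      | zero => left; rw [disp_zero_succ]
      | succ m' =>
        rw [disp_succ_succ]
        rcases min_choice (disp κ (m' + 1) (b + L) + κ (m' + 1) (b + L)) (disp κ m' (b + L))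
          with h | h
        · exact Or.inl h
        · exact Or.inr ⟨m', rfl, h⟩
    rcases step with h | ⟨m', rfl, h⟩
    · obtain ⟨a, ha, hle⟩ := ih m
      refine ⟨a, ha, ?_⟩
      have h1 := disp_succ_right_le_add (shiftJumps κ a b) (m - a) L
      have e : shiftJumps κ a b (m - a) L = κ m (b + L) := by
        simp only [shiftJumps, Nat.sub_add_cancel ha, add_comm]
      omega
    · obtain ⟨a, ha, hle⟩ := ih m'
      refine ⟨a, by omega, ?_⟩
      have e : m' + 1 - a = (m' - a) + 1 := by omega
      rw [e, disp_succ_succ, h]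
      have := min_le_right (disp (shiftJumps κ a b) (m' - a + 1) L +
        shiftJumps κ a b (m' - a + 1) L) (disp (shiftJumps κ a b) (m' - a) L)
      omega

/-- A particle gains at most the displacement of its right neighbour, and only when it attempts a
jump. -/
lemma disp_succ_succ_le (m L : ℕ) : disp κ (m + 1) (L + 1) ≤
    disp κ (m + 1) L + κ (m + 1) L * disp κ m L := by
  rw [disp_succ_succ]
  rcases Nat.eq_zero_or_pos (κ (m + 1) L) with h | h
  · rw [h]; simp
  · exact (min_le_right _ _).trans ((Nat.le_mul_of_pos_left _ h).trans (Nat.le_add_left _ _))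

/-- Displacements are dominated by the sum over successive blocks of `m` particles and `L` steps. -/
lemma disp_mul_le_sum (m L r : ℕ) : disp κ (r * m) (r * L) ≤
    ∑ q ∈ Finset.range r, disp (shiftJumps κ (q * m) (q * L)) m L := by
  induction r with
  | zero => simp
  | succ r ih =>
    rw [Finset.sum_range_succ, Nat.succ_mul, Nat.succ_mul]
    exact (disp_add_le κ _ _ _ _).trans (Nat.add_le_add_right ih _)

end Deterministic

/-- Only the jumps attempted before time `L` matter for the displacements at time `L`. -/
lemma measurable_disp {Ω : Type*} {mΩ : MeasurableSpace Ω} {κ : ℕ → ℕ → Ω → ℕ} {L : ℕ}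
    (h : ∀ p, ∀ l < L, Measurable (κ p l)) (m : ℕ) :
    Measurable fun ω => disp (fun p l => κ p l ω) m L := by
  induction L generalizing m with
  | zero => simp
  | succ L ih =>
    have ih' := ih fun p l hl => h p l (by omega)
    cases m with
    | zero =>
      simp only [disp_zero_succ]
      exact (ih' 0).add (h 0 L (by omega))
    | succ m =>
      simp only [disp_succ_succ]
      exact ((ih' (m + 1)).add (h (m + 1) L (by omega))).min (ih' m)

/-! ### Independent arrays of Poisson counts -/

/-- The law of a Poisson count with mean `r`, as a law on `ℕ∞`. -/
def countLaw (r : ℝ≥0) : Measure ℕ∞ := (poissonMeasure r).map (fun m : ℕ => (m : ℕ∞))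

instance (r : ℝ≥0) : IsProbabilityMeasure (countLaw r) :=
  Measure.isProbabilityMeasure_map (measurable_of_countable _).aemeasurable

lemma countLaw_apply (r : ℝ≥0) (s : Set ℕ∞) :
    countLaw r s = poissonMeasure r ((fun m : ℕ => (m : ℕ∞)) ⁻¹' s) :=
  Measure.map_apply (measurable_of_countable _) (DiscreteMeasurableSpace.forall_measurableSet s)

lemma poissonMeasure_real_compl (r : ℝ≥0) (s : Set ℕ) :
    (poissonMeasure r).real sᶜ = 1 - (poissonMeasure r).real s :=
  probReal_compl_eq_one_sub (DiscreteMeasurableSpace.forall_measurableSet s)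

lemma countLaw_ne_zero_le (r : ℝ≥0) : countLaw r {n | n ≠ 0} ≤ r := by
  rw [countLaw_apply]
  have e : (fun m : ℕ => (m : ℕ∞)) ⁻¹' {n | n ≠ 0} = {0}ᶜ := by ext; simp
  rw [e, ← ofReal_measureReal, poissonMeasure_real_compl, poissonMeasure_real_singleton,
    ← ENNReal.ofReal_coe_nnreal]
  refine ENNReal.ofReal_le_ofReal ?_
  have := Real.add_one_le_exp (-(r : ℝ))
  simp only [pow_zero, Nat.factorial_zero, Nat.cast_one, mul_one, div_one]
  linarith

lemma countLaw_one_lt_le (r : ℝ≥0) : countLaw r {n | 1 < n} ≤ (r : ℝ≥0∞) ^ 2 := by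
  rw [countLaw_apply]
  have e : (fun m : ℕ => (m : ℕ∞)) ⁻¹' {n | 1 < n} = ({0} ∪ {1})ᶜ := by
    ext m
    simp only [Set.mem_preimage, Set.mem_ofPred_eq, Set.mem_compl_iff, Set.mem_union,
      Set.mem_singleton_iff]
    rw [Nat.one_lt_cast]
    omega
  rw [e, ← ofReal_measureReal, poissonMeasure_real_compl,
    measureReal_union (by simp) (DiscreteMeasurableSpace.forall_measurableSet _),
    poissonMeasure_real_singleton, poissonMeasure_real_singleton,
    ← ENNReal.ofReal_coe_nnreal, ← ENNReal.ofReal_pow (NNReal.coe_nonneg r)]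
  refine ENNReal.ofReal_le_ofReal ?_
  have h1 := Real.add_one_le_exp (-(r : ℝ))
  have h2 : (0 : ℝ) ≤ r := r.2
  simp only [pow_zero, Nat.factorial_zero, Nat.cast_one, mul_one, div_one, pow_one,
    Nat.factorial_one]
  nlinarith

lemma countLaw_top (r : ℝ≥0) : countLaw r {⊤} = 0 := by
  rw [countLaw_apply]
  have e : (fun m : ℕ => (m : ℕ∞)) ⁻¹' {⊤} = ∅ := by ext; simp
  rw [e, measure_empty]

/-- Arrays of counts, indexed by particle, time step and jump length. -/
abbrev CountArray : Type := ℕ × ℕ × ℕ+ → ℕ∞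

/-- Independent Poisson counts, with mean `r k` for the jump length `k`. -/
def arrayLaw (r : ℕ+ → ℝ≥0) : Measure CountArray :=
  Measure.infinitePi fun j => countLaw (r j.2.2)

instance (r : ℕ+ → ℝ≥0) : IsProbabilityMeasure (arrayLaw r) := by
  unfold arrayLaw; infer_instance

/-- The length of the jump that is attempted in a time step, `0` if there is none. If there are
several attempts in the time step, all but the shortest one are discarded; in the continuous-time
limit this does not happen. -/
def jumpLength (c : ℕ+ → ℕ∞) : ℕ := sInf {n | ∃ k : ℕ+, (k : ℕ) = n ∧ c k ≠ 0}

/-- The jump lengths for an array of counts. -/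
def jumps (c : CountArray) (p l : ℕ) : ℕ := jumpLength fun k => c (p, l, k)

lemma jumpLength_eq_zero_iff (c : ℕ+ → ℕ∞) : jumpLength c = 0 ↔ ∀ k, c k = 0 := by
  rw [jumpLength, Nat.sInf_eq_zero]
  constructor
  · rintro (⟨k, hk, -⟩ | h) k'
    · exact absurd hk k.ne_zero
    · by_contra hk
      exact h.subset ⟨k', rfl, hk⟩
  · intro h
    right
    ext n
    simp [h]

lemma jumpLength_eq_iff (c : ℕ+ → ℕ∞) (k : ℕ+) :
    jumpLength c = k ↔ c k ≠ 0 ∧ ∀ k' < k, c k' = 0 := by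
  constructor
  · intro h
    have hne : {n | ∃ k : ℕ+, (k : ℕ) = n ∧ c k ≠ 0}.Nonempty := by
      by_contra hne
      rw [Set.not_nonempty_iff_eq_empty] at hne
      have : jumpLength c = 0 := by rw [jumpLength, hne, Nat.sInf_empty]
      exact k.ne_zero (h ▸ this)
    obtain ⟨k₀, hk₀, hc⟩ := Nat.sInf_mem hne
    rw [← jumpLength, h] at hk₀
    obtain rfl := PNat.coe_injective hk₀
    refine ⟨hc, fun k' hk' => ?_⟩
    by_contra hk
    have := Nat.notMem_of_lt_sInf (m := k') (s := {n | ∃ k : ℕ+, (k : ℕ) = n ∧ c k ≠ 0})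
      (by rw [← jumpLength, h]; exact_mod_cast hk')
    exact this ⟨k', rfl, hk⟩
  · rintro ⟨h1, h2⟩
    refine le_antisymm (Nat.sInf_le ⟨k, rfl, h1⟩) (le_csInf ⟨_, k, rfl, h1⟩ ?_)
    rintro n ⟨k', rfl, hk'⟩
    by_contra hlt
    exact hk' (h2 k' (by exact_mod_cast not_le.1 hlt))

lemma measurable_jumpLength : Measurable jumpLength := by
  refine measurable_to_countable' fun n => ?_
  have hm : ∀ k : ℕ+, MeasurableSet {c : ℕ+ → ℕ∞ | c k = 0} := fun k =>
    measurableSet_eq_fun (measurable_pi_apply k) measurable_const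
  rcases Nat.eq_zero_or_pos n with rfl | hn
  · have : jumpLength ⁻¹' {0} = ⋂ k, {c | c k = 0} := by
      ext c
      simp [jumpLength_eq_zero_iff]
    rw [this]
    exact MeasurableSet.iInter hm
  · have : jumpLength ⁻¹' {n} =
        {c | c ⟨n, hn⟩ = 0}ᶜ ∩ ⋂ k, ⋂ (_ : k < ⟨n, hn⟩), {c | c k = 0} := by
      ext c
      simpa using jumpLength_eq_iff c ⟨n, hn⟩
    rw [this]
    exact (hm _).compl.inter (MeasurableSet.iInter fun k => MeasurableSet.iInter fun _ => hm k)

/-- A jump length is at most the sum of the lengths of all the attempts. -/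
lemma jumpLength_pow_le (c : ℕ+ → ℕ∞) {j : ℕ} (hj : j ≠ 0) : ((jumpLength c : ℕ) : ℝ≥0∞) ^ j ≤
    ∑' k : ℕ+, ((k : ℕ) : ℝ≥0∞) ^ j * {n : ℕ∞ | n ≠ 0}.indicator 1 (c k) := by
  rcases Nat.eq_zero_or_pos (jumpLength c) with h | h
  · simp [h, hj]
  · have := (jumpLength_eq_iff c ⟨_, h⟩).1 rfl
    refine le_trans (le_of_eq ?_) (ENNReal.le_tsum (⟨jumpLength c, h⟩ : ℕ+))
    rw [Set.indicator_of_mem (by exact this.1)]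
    simp

section Law

variable (r : ℕ+ → ℝ≥0)

lemma arrayLaw_eval (j : ℕ × ℕ × ℕ+) (s : Set ℕ∞) :
    arrayLaw r {c | c j ∈ s} = countLaw (r j.2.2) s := by
  have h := (measurePreserving_eval_infinitePi (fun j : ℕ × ℕ × ℕ+ => countLaw (r j.2.2)) j)
  exact h.measure_preimage (DiscreteMeasurableSpace.forall_measurableSet s).nullMeasurableSet

lemma lintegral_jumps_pow_le (p l : ℕ) {j : ℕ} (hj : j ≠ 0) :
    ∫⁻ c, ((jumps c p l : ℕ) : ℝ≥0∞) ^ j ∂(arrayLaw r) ≤ rateMoment r j := by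
  have hmeas : ∀ k : ℕ+, Measurable fun c : CountArray =>
      {n : ℕ∞ | n ≠ 0}.indicator (1 : ℕ∞ → ℝ≥0∞) (c (p, l, k)) := fun k =>
    (measurable_of_countable ({n : ℕ∞ | n ≠ 0}.indicator (1 : ℕ∞ → ℝ≥0∞))).comp
      (measurable_pi_apply (p, l, k))
  calc ∫⁻ c, ((jumps c p l : ℕ) : ℝ≥0∞) ^ j ∂(arrayLaw r)
      ≤ ∫⁻ c, ∑' k : ℕ+, ((k : ℕ) : ℝ≥0∞) ^ j *
          {n : ℕ∞ | n ≠ 0}.indicator 1 (c (p, l, k)) ∂(arrayLaw r) :=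
        lintegral_mono fun c => jumpLength_pow_le _ hj
    _ = ∑' k : ℕ+, ((k : ℕ) : ℝ≥0∞) ^ j * arrayLaw r {c | c (p, l, k) ∈ {n : ℕ∞ | n ≠ 0}} := by
        rw [lintegral_tsum fun k => ((hmeas k).const_mul _).aemeasurable]
        congr 1 with k
        rw [lintegral_const_mul _ (hmeas k)]
        congr 1
        rw [← lintegral_indicator_one]
        · rfl
        · exact measurable_pi_apply (p, l, k) (DiscreteMeasurableSpace.forall_measurableSet _)
    _ ≤ rateMoment r j := by
        refine ENNReal.tsum_le_tsum fun k => ?_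
        rw [arrayLaw_eval]
        gcongr
        exact countLaw_ne_zero_le _

lemma rateMoment_mono {j j' : ℕ} (h : j ≤ j') : rateMoment r j ≤ rateMoment r j' := by
  refine ENNReal.tsum_le_tsum fun k => ?_
  gcongr
  exact_mod_cast k.pos

/-! ### Stationarity and independence of the increments -/

/-- The displacement, as a real number, of particle `-(a + m)` at time `b + L` after restarting at
time `b` with particle `-a` as the rightmost particle. -/
def dispFrom (a b m L : ℕ) (c : CountArray) : ℝ := disp (shiftJumps (jumps c) a b) m L

lemma dispFrom_nonneg (a b m L : ℕ) (c : CountArray) : 0 ≤ dispFrom a b m L c := Nat.cast_nonneg _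

/-- The σ-algebra of the counts in the time steps in `A`. -/
abbrev timeSigma (A : Set ℕ) : MeasurableSpace CountArray :=
  ⨆ j ∈ {j : ℕ × ℕ × ℕ+ | j.2.1 ∈ A}, MeasurableSpace.comap (fun c : CountArray => c j) inferInstance

lemma measurable_dispFrom_comp {Ω : Type*} {mΩ : MeasurableSpace Ω} {c : Ω → CountArray}
    {a b L : ℕ} (h : ∀ p l k, b ≤ l → l < b + L → Measurable fun ω => c ω (p, l, k)) (m : ℕ) :
    Measurable fun ω => dispFrom a b m L (c ω) := by
  have h : Measurable fun ω => disp (fun p l => shiftJumps (jumps (c ω)) a b p l) m L :=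
    measurable_disp (κ := fun p l ω => shiftJumps (jumps (c ω)) a b p l) (fun p l hl =>
      measurable_jumpLength.comp (measurable_pi_lambda _ fun k =>
        h (p + a) (l + b) k (by omega) (by omega))) m
  exact (measurable_of_countable (fun n : ℕ => (n : ℝ))).comp h

lemma measurable_dispFrom_timeSigma (a b m L : ℕ) :
    Measurable[timeSigma (Set.Ico b (b + L))] (dispFrom a b m L) := by
  refine @measurable_dispFrom_comp CountArray (timeSigma (Set.Ico b (b + L))) id a b L ?_ m
  intro p l k h1 h2
  exact Measurable.mono (comap_measurable _)
    (le_iSup₂_of_le (f := fun (j : ℕ × ℕ × ℕ+) (_ : j ∈ {j : ℕ × ℕ × ℕ+ | j.2.1 ∈ Set.Ico b (b + L)}) =>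
      MeasurableSpace.comap (fun c : CountArray => c j) inferInstance) (p, l, k) ⟨h1, h2⟩ le_rfl)
    le_rfl

lemma timeSigma_le (A : Set ℕ) : timeSigma A ≤ MeasurableSpace.pi :=
  iSup₂_le fun j _ => measurable_iff_comap_le.1 (measurable_pi_apply j)

lemma measurable_dispFrom (a b m L : ℕ) : Measurable (dispFrom a b m L) :=
  (measurable_dispFrom_timeSigma a b m L).mono (timeSigma_le _) le_rfl

lemma indepFun_dispFrom (a b m L a' b' m' L' : ℕ) (h : b + L ≤ b') :
    IndepFun (dispFrom a b m L) (dispFrom a' b' m' L') (arrayLaw r) := by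
  have hi : iIndepFun (fun (j : ℕ × ℕ × ℕ+) (c : CountArray) => c j) (arrayLaw r) :=
    iIndepFun_infinitePi (P := fun j : ℕ × ℕ × ℕ+ => countLaw (r j.2.2)) (X := fun _ n => n)
      fun _ => measurable_id
  have h2 : Indep (timeSigma (Set.Ico b (b + L))) (timeSigma (Set.Ico b' (b' + L')))
      (arrayLaw r) := by
    refine indep_iSup_of_disjoint (fun j => measurable_iff_comap_le.1 (measurable_pi_apply j)) hi ?_
    rw [Set.disjoint_left]
    rintro j ⟨h1, h2⟩ ⟨h3, h4⟩
    omega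
  rw [IndepFun_iff_Indep]
  exact indep_of_indep_of_le_left (indep_of_indep_of_le_right h2
    (measurable_iff_comap_le.1 (measurable_dispFrom_timeSigma a' b' m' L')))
    (measurable_iff_comap_le.1 (measurable_dispFrom_timeSigma a b m L))

lemma identDistrib_dispFrom (a b m L : ℕ) :
    IdentDistrib (dispFrom a b m L) (dispFrom 0 0 m L) (arrayLaw r) (arrayLaw r) where
  aemeasurable_fst := (measurable_dispFrom _ _ _ _).aemeasurable
  aemeasurable_snd := (measurable_dispFrom _ _ _ _).aemeasurable
  map_eq := by
    have hinj : Function.Injective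
        (fun j : ℕ × ℕ × ℕ+ => ((j.1 + a, j.2.1 + b, j.2.2) : ℕ × ℕ × ℕ+)) := by
      rintro ⟨p, l, k⟩ ⟨p', l', k'⟩ h
      simp only [Prod.mk.injEq] at h ⊢
      exact ⟨by omega, by omega, h.2.2⟩
    have h := Measure.map_infinitePi_infinitePi_of_inj
      (P := fun j : ℕ × ℕ × ℕ+ => countLaw (r j.2.2)) hinj
    have h' : (arrayLaw r).map (fun c j => c (j.1 + a, j.2.1 + b, j.2.2)) = arrayLaw r := h
    conv_rhs => rw [← h']
    rw [Measure.map_map (measurable_dispFrom _ _ _ _)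
      (measurable_pi_lambda _ fun _ => measurable_pi_apply _)]
    rfl

lemma dispFrom_le_dispFrom_zero (a b m L : ℕ) (c : CountArray) :
    dispFrom a b m L c ≤ dispFrom a b 0 L c :=
  Nat.cast_le.2 (disp_le_disp_zero _ _ _)

lemma dispFrom_zero_eq_sum (L : ℕ) (c : CountArray) :
    dispFrom 0 0 0 L c = ∑ l ∈ Finset.range L, dispFrom (l * 0) (l * 1) 0 1 c := by
  have h : ∀ l, disp (shiftJumps (jumps c) (l * 0) (l * 1)) 0 1 = jumps c 0 l := fun l => by
    rw [disp_zero_succ, disp_zero_right]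
    simp [shiftJumps]
  simp only [dispFrom, h]
  rw [disp_zero_eq_sum, Nat.cast_sum]
  rfl

variable {r} (hr : rateMoment r 2 < ∞)
include hr

lemma memLp_dispFrom_one (a b : ℕ) : MemLp (dispFrom a b 0 1) 2 (arrayLaw r) := by
  rw [memLp_two_iff_integrable_sq (measurable_dispFrom _ _ _ _).aestronglyMeasurable]
  refine ⟨((measurable_dispFrom _ _ _ _).pow_const 2).aestronglyMeasurable, ?_⟩
  rw [hasFiniteIntegral_iff_ofReal (Eventually.of_forall fun c => sq_nonneg _)]
  have h : ∀ c, ENNReal.ofReal (dispFrom a b 0 1 c ^ 2) = ((jumps c a b : ℕ) : ℝ≥0∞) ^ 2 :=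
    fun c => by
      rw [ENNReal.ofReal_pow (dispFrom_nonneg _ _ _ _ _), dispFrom, ENNReal.ofReal_natCast,
        disp_zero_succ, disp_zero_right]
      simp [shiftJumps]
  simp only [h]
  exact (lintegral_jumps_pow_le r a b two_ne_zero).trans_lt hr

end Law

/-! ### Moment estimates in discrete time -/

/-- The moments of the rates as real numbers; the junk value at `∞` does not matter since only finite
moments occur. -/
def realMoment (r : ℕ+ → ℝ≥0) (j : ℕ) : ℝ := (rateMoment r j).toReal

lemma realMoment_nonneg (r : ℕ+ → ℝ≥0) (j : ℕ) : 0 ≤ realMoment r j := ENNReal.toReal_nonneg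

/-- The expected displacement of particle `-m` after `L` steps. -/
def meanDisp (r : ℕ+ → ℝ≥0) (m L : ℕ) : ℝ := ∫ c, dispFrom 0 0 m L c ∂(arrayLaw r)

section Moments

variable {r : ℕ+ → ℝ≥0} (hr : rateMoment r 2 < ∞)

lemma integral_dispFrom (a b m L : ℕ) :
    ∫ c, dispFrom a b m L c ∂(arrayLaw r) = meanDisp r m L :=
  (identDistrib_dispFrom r a b m L).integral_eq

lemma dispFrom_add_le (a b m L : ℕ) (c : CountArray) :
    dispFrom 0 0 (a + m) (b + L) c ≤ dispFrom 0 0 a b c + dispFrom a b m L c := by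
  have := disp_add_le (jumps c) a b m L
  simp only [dispFrom]
  exact_mod_cast this

lemma meanDisp_nonneg (m L : ℕ) : 0 ≤ meanDisp r m L :=
  integral_nonneg fun _ => dispFrom_nonneg _ _ _ _ _

include hr

lemma memLp_dispFrom (a b m L : ℕ) : MemLp (dispFrom a b m L) 2 (arrayLaw r) := by
  rw [(identDistrib_dispFrom r a b m L).memLp_iff]
  have h0 : MemLp (dispFrom 0 0 0 L) 2 (arrayLaw r) := by
    have h : dispFrom 0 0 0 L = fun c => ∑ l ∈ Finset.range L, dispFrom (l * 0) (l * 1) 0 1 c :=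
      funext fun c => dispFrom_zero_eq_sum L c
    rw [h]
    exact memLp_finsetSum _ fun l _ => memLp_dispFrom_one hr _ _
  refine h0.mono (measurable_dispFrom _ _ _ _).aestronglyMeasurable (Eventually.of_forall fun c => ?_)
  rw [Real.norm_of_nonneg (dispFrom_nonneg _ _ _ _ _), Real.norm_of_nonneg (dispFrom_nonneg _ _ _ _ _)]
  exact dispFrom_le_dispFrom_zero _ _ _ _ _

lemma integrable_dispFrom (a b m L : ℕ) : Integrable (dispFrom a b m L) (arrayLaw r) :=
  (memLp_dispFrom hr a b m L).integrable one_le_two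

lemma integral_dispFrom_one_pow_le {j : ℕ} (hj : j ≠ 0) (hj2 : j ≤ 2) :
    ∫ c, dispFrom 0 0 0 1 c ^ j ∂(arrayLaw r) ≤ realMoment r j := by
  have h : ∀ c, ENNReal.ofReal (dispFrom 0 0 0 1 c ^ j) = ((jumps c 0 0 : ℕ) : ℝ≥0∞) ^ j :=
    fun c => by
      rw [ENNReal.ofReal_pow (dispFrom_nonneg _ _ _ _ _), dispFrom, ENNReal.ofReal_natCast,
        disp_zero_succ, disp_zero_right]
      simp [shiftJumps]
  rw [integral_eq_lintegral_of_nonneg_ae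
    (Eventually.of_forall fun c => pow_nonneg (dispFrom_nonneg _ _ _ _ _) _)
    ((measurable_dispFrom _ _ _ _).pow_const j).aestronglyMeasurable]
  simp only [h]
  exact ENNReal.toReal_mono ((rateMoment_mono r hj2).trans_lt hr).ne
    (lintegral_jumps_pow_le r 0 0 hj)

lemma meanDisp_zero_one_le : meanDisp r 0 1 ≤ realMoment r 1 := by
  simpa [meanDisp] using integral_dispFrom_one_pow_le hr one_ne_zero one_le_two

lemma meanDisp_zero_eq (L : ℕ) : meanDisp r 0 L = L * meanDisp r 0 1 := by
  rw [meanDisp]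
  simp only [dispFrom_zero_eq_sum]
  rw [integral_finsetSum _ fun l _ => integrable_dispFrom hr _ _ _ _]
  simp [integral_dispFrom]

lemma meanDisp_zero_le (L : ℕ) : meanDisp r 0 L ≤ L * realMoment r 1 := by
  rw [meanDisp_zero_eq hr]
  exact mul_le_mul_of_nonneg_left (meanDisp_zero_one_le hr) (Nat.cast_nonneg _)

lemma meanDisp_antitone {m m' : ℕ} (h : m ≤ m') (L : ℕ) : meanDisp r m' L ≤ meanDisp r m L :=
  integral_mono (integrable_dispFrom hr _ _ _ _) (integrable_dispFrom hr _ _ _ _) fun _ =>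
    Nat.cast_le.2 (disp_antitone_left _ h L)

lemma meanDisp_mono (m : ℕ) {L L' : ℕ} (h : L ≤ L') : meanDisp r m L ≤ meanDisp r m L' :=
  integral_mono (integrable_dispFrom hr _ _ _ _) (integrable_dispFrom hr _ _ _ _) fun _ =>
    Nat.cast_le.2 (disp_monotone_right _ m h)

lemma meanDisp_le (m L : ℕ) : meanDisp r m L ≤ L * realMoment r 1 :=
  (meanDisp_antitone hr (Nat.zero_le m) L).trans (meanDisp_zero_le hr L)

lemma meanDisp_add_le (a b m L : ℕ) :
    meanDisp r (a + m) (b + L) ≤ meanDisp r a b + meanDisp r m L := by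
  rw [← integral_dispFrom (r := r) a b m L, meanDisp, meanDisp,
    ← integral_add (integrable_dispFrom hr _ _ _ _) (integrable_dispFrom hr _ _ _ _)]
  exact integral_mono (integrable_dispFrom hr _ _ _ _)
    ((integrable_dispFrom hr _ _ _ _).add (integrable_dispFrom hr _ _ _ _)) fun c =>
      dispFrom_add_le a b m L c

/-- The displacements in successive blocks are independent and identically distributed. -/
lemma variance_sum_blocks (m L n : ℕ) :
    Var[fun c => ∑ q ∈ Finset.range n, dispFrom (q * m) (q * L) m L c; arrayLaw r] =
      n * Var[dispFrom 0 0 m L; arrayLaw r] := by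
  have e : (fun c => ∑ q ∈ Finset.range n, dispFrom (q * m) (q * L) m L c) =
      ∑ q ∈ Finset.range n, dispFrom (q * m) (q * L) m L := by
    ext c
    simp
  rw [e, IndepFun.variance_sum (fun q _ => memLp_dispFrom hr _ _ _ _)]
  · simp [(identDistrib_dispFrom r _ _ m L).variance_eq]
  · have key : ∀ i j : ℕ, i < j → IndepFun (dispFrom (i * m) (i * L) m L)
        (dispFrom (j * m) (j * L) m L) (arrayLaw r) := fun i j hij => by
      refine indepFun_dispFrom r _ _ _ _ _ _ _ _ ?_
      calc i * L + L = (i + 1) * L := by ring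
        _ ≤ j * L := Nat.mul_le_mul_right _ hij
    intro i _ j _ hij
    rcases lt_or_gt_of_ne hij with h | h
    · exact key i j h
    · exact (key j i h).symm

/-- A bound for the second moment of the displacement after `L` steps. -/
def sqBound (r : ℕ+ → ℝ≥0) (L : ℕ) : ℝ := L * realMoment r 2 + (L * realMoment r 1) ^ 2

lemma integral_dispFrom_zero_sq_le (L : ℕ) :
    ∫ c, dispFrom 0 0 0 L c ^ 2 ∂(arrayLaw r) ≤ sqBound r L := by
  have h1 := variance_sum_blocks hr 0 1 L
  simp only [← dispFrom_zero_eq_sum] at h1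
  have h2 := variance_eq_sub (memLp_dispFrom hr 0 0 0 L)
  have h3 : Var[dispFrom 0 0 0 1; arrayLaw r] ≤ realMoment r 2 :=
    (variance_le_expectation_sq (measurable_dispFrom _ _ _ _).aestronglyMeasurable).trans
      (integral_dispFrom_one_pow_le hr two_ne_zero le_rfl)
  have h4 := meanDisp_zero_le hr L
  have h5 : (∫ c, dispFrom 0 0 0 L c ∂(arrayLaw r)) ^ 2 ≤ (L * realMoment r 1) ^ 2 :=
    pow_le_pow_left₀ (meanDisp_nonneg (r := r) 0 L) h4 2
  have h6 : (L : ℝ) * Var[dispFrom 0 0 0 1; arrayLaw r] ≤ L * realMoment r 2 :=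
    mul_le_mul_of_nonneg_left h3 (Nat.cast_nonneg _)
  have h7 : Var[dispFrom 0 0 0 L; arrayLaw r] = L * Var[dispFrom 0 0 0 1; arrayLaw r] := h1
  simp only [Pi.pow_apply] at h2
  rw [sqBound]
  linarith

lemma variance_dispFrom_le (m L : ℕ) : Var[dispFrom 0 0 m L; arrayLaw r] ≤ sqBound r L := by
  refine (variance_le_expectation_sq (measurable_dispFrom _ _ _ _).aestronglyMeasurable).trans
    (le_trans ?_ (integral_dispFrom_zero_sq_le hr L))
  refine integral_mono (memLp_dispFrom hr 0 0 m L).integrable_sq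
    (memLp_dispFrom hr 0 0 0 L).integrable_sq fun c => ?_
  exact pow_le_pow_left₀ (dispFrom_nonneg _ _ _ _ _) (dispFrom_le_dispFrom_zero _ _ _ _ _) 2

/-- The displacement over `n` blocks exceeds the sum of the expected block displacements by an
amount that is sublinear in `n`. -/
lemma integral_excess_le (m L n : ℕ) {δ : ℝ} (hδ : 0 < δ) :
    ∫ c, max (dispFrom 0 0 (n * m) (n * L) c - n * meanDisp r m L) 0 ∂(arrayLaw r) ≤
      δ * n + sqBound r L / δ := by
  rcases Nat.eq_zero_or_pos n with rfl | hn
  · have h0 : ∀ c, dispFrom 0 0 (0 * m) (0 * L) c = 0 := fun c => by simp [dispFrom]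
    simp only [h0]
    have : 0 ≤ sqBound r L := by
      have := realMoment_nonneg r 2
      rw [sqBound]; positivity
    simp only [Nat.cast_zero, zero_mul, sub_zero, max_self, integral_zero, mul_zero, zero_add]
    positivity
  have hn' : (0 : ℝ) < n := by exact_mod_cast hn
  set W : CountArray → ℝ := fun c => ∑ q ∈ Finset.range n, dispFrom (q * m) (q * L) m L c with hW
  have hWL : MemLp W 2 (arrayLaw r) := memLp_finsetSum _ fun q _ => memLp_dispFrom hr _ _ _ _
  have hWE : ∫ c, W c ∂(arrayLaw r) = n * meanDisp r m L := by
    rw [hW, integral_finsetSum _ fun l _ => integrable_dispFrom hr _ _ _ _]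
    simp [integral_dispFrom]
  have hvar : ∫ c, (W c - n * meanDisp r m L) ^ 2 ∂(arrayLaw r) ≤ n * sqBound r L := by
    rw [← hWE, ← variance_eq_integral hWL.aemeasurable, hW, variance_sum_blocks hr]
    exact mul_le_mul_of_nonneg_left (variance_dispFrom_le hr m L) hn'.le
  have hint : Integrable (fun c => (W c - n * meanDisp r m L) ^ 2) (arrayLaw r) :=
    (hWL.sub (memLp_const _)).integrable_sq
  have hδn : 0 < δ * n := by positivity
  calc ∫ c, max (dispFrom 0 0 (n * m) (n * L) c - n * meanDisp r m L) 0 ∂(arrayLaw r)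
      ≤ ∫ c, (δ * n + (W c - n * meanDisp r m L) ^ 2 / (δ * n)) ∂(arrayLaw r) := by
        refine integral_mono (((integrable_dispFrom hr _ _ _ _).sub (integrable_const _)).sup
          (integrable_const 0)) ((integrable_const _).add (hint.div_const _)) fun c => ?_
        have h1 : dispFrom 0 0 (n * m) (n * L) c ≤ W c := by
          have := disp_mul_le_sum (jumps c) m L n
          simp only [hW, dispFrom]
          exact_mod_cast this
        refine max_le ?_ (by positivity)
        refine (sub_le_sub_right h1 _).trans ?_
        set x := W c - n * meanDisp r m L
        rw [← sub_le_iff_le_add', le_div_iff₀ hδn]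
        nlinarith [sq_nonneg (x - δ * n), sq_nonneg x, sq_nonneg (δ * n)]
    _ ≤ δ * n + (n * sqBound r L) / (δ * n) := by
        rw [integral_add (integrable_const _) (hint.div_const _), integral_const, integral_div]
        simp only [probReal_univ, smul_eq_mul, one_mul]
        gcongr
    _ = δ * n + sqBound r L / δ := by
        congr 1
        field_simp

/-- Far behind the front nothing has moved: the displacement of particle `-m` needs jump attempts of
`m + 1` particles in succession. -/
lemma meanDisp_le_choose (m L : ℕ) :
    meanDisp r m L ≤ realMoment r 1 ^ (m + 1) * (L.choose (m + 1) : ℕ) := by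
  induction L generalizing m with
  | zero =>
    have : ∀ c, dispFrom 0 0 m 0 c = 0 := fun c => by simp [dispFrom]
    simp [meanDisp, this]
  | succ L ih =>
    have hm1 := realMoment_nonneg r 1
    cases m with
    | zero =>
      have := meanDisp_zero_le hr (L + 1)
      simp only [zero_add, pow_one, Nat.choose_one_right]
      linarith
    | succ m =>
      have hind : IndepFun (dispFrom 0 0 m L) (dispFrom (m + 1) L 0 1) (arrayLaw r) :=
        indepFun_dispFrom r _ _ _ _ _ _ _ _ (by omega)
      have hprod : Integrable (fun c => dispFrom 0 0 m L c * dispFrom (m + 1) L 0 1 c)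
          (arrayLaw r) :=
        hind.integrable_mul (integrable_dispFrom hr _ _ _ _) (integrable_dispFrom hr _ _ _ _)
      have h1 : meanDisp r (m + 1) (L + 1) ≤
          meanDisp r (m + 1) L + meanDisp r m L * meanDisp r 0 1 := by
        rw [← integral_dispFrom (r := r) (m + 1) L 0 1, meanDisp, meanDisp, meanDisp,
          ← hind.integral_fun_mul_eq_mul_integral (measurable_dispFrom _ _ _ _).aestronglyMeasurable
            (measurable_dispFrom _ _ _ _).aestronglyMeasurable,
          ← integral_add (integrable_dispFrom hr _ _ _ _) hprod]
        refine integral_mono (integrable_dispFrom hr _ _ _ _)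
          ((integrable_dispFrom hr _ _ _ _).add hprod) fun c => ?_
        have h2 := disp_succ_succ_le (jumps c) m L
        have h3 : disp (shiftJumps (jumps c) (m + 1) L) 0 1 = jumps c (m + 1) L := by
          rw [disp_zero_succ, disp_zero_right]
          simp [shiftJumps]
        simp only [dispFrom, h3]
        rw [mul_comm (jumps c (m + 1) L)] at h2
        exact_mod_cast h2
      calc meanDisp r (m + 1) (L + 1) ≤ _ := h1
        _ ≤ realMoment r 1 ^ (m + 2) * (L.choose (m + 2) : ℕ) +
            realMoment r 1 ^ (m + 1) * (L.choose (m + 1) : ℕ) * realMoment r 1 :=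
          add_le_add (ih (m + 1)) (mul_le_mul (ih m) (meanDisp_zero_one_le hr)
            (meanDisp_nonneg _ _) (by positivity))
        _ = _ := by
          rw [Nat.choose_succ_succ L (m + 1)]
          push_cast
          ring

lemma meanDisp_le_pow_div_factorial (m L : ℕ) :
    meanDisp r m L ≤ (L * realMoment r 1) ^ (m + 1) / (m + 1).factorial := by
  refine (meanDisp_le_choose hr m L).trans ?_
  have hm1 := realMoment_nonneg r 1
  have h := Nat.choose_le_pow_div (α := ℝ) (m + 1) L
  calc _ ≤ realMoment r 1 ^ (m + 1) * ((L : ℝ) ^ (m + 1) / (m + 1).factorial) := by gcongr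
    _ = _ := by rw [mul_pow]; ring

/-! ### Exponential moments and a lower bound close to the front -/

omit hr

/-- The Laplace transform of the displacement. -/
def expDisp (r : ℕ+ → ℝ≥0) (θ : ℝ) (m L : ℕ) : ℝ :=
  ∫ c, Real.exp (-θ * dispFrom 0 0 m L c) ∂(arrayLaw r)

lemma integrable_exp {θ : ℝ} (hθ : 0 ≤ θ) {X : CountArray → ℝ} (hX : Measurable X)
    (h0 : ∀ c, 0 ≤ X c) : Integrable (fun c => Real.exp (-θ * X c)) (arrayLaw r) := by
  refine Integrable.of_bound (C := 1) (by fun_prop) (Eventually.of_forall fun c => ?_)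
  rw [Real.norm_of_nonneg (Real.exp_pos _).le, Real.exp_le_one_iff]
  nlinarith [h0 c]

lemma expDisp_le_one {θ : ℝ} (hθ : 0 ≤ θ) (m L : ℕ) : expDisp r θ m L ≤ 1 := by
  have := integral_mono (μ := arrayLaw r) (integrable_exp hθ (measurable_dispFrom 0 0 m L)
    (dispFrom_nonneg _ _ _ _)) (integrable_const (1 : ℝ)) fun c => by
      rw [Real.exp_le_one_iff]
      nlinarith [dispFrom_nonneg 0 0 m L c]
  simpa [expDisp] using this

lemma expDisp_nonneg (θ : ℝ) (m L : ℕ) : 0 ≤ expDisp r θ m L :=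
  integral_nonneg fun _ => (Real.exp_pos _).le

/-- The first moment bound for the Laplace transform: the minimum over the restart particle is
replaced by a sum. -/
lemma expDisp_add_le {θ : ℝ} (hθ : 0 ≤ θ) (m b L : ℕ) : expDisp r θ m (b + L) ≤
    ∑ a ∈ Finset.range (m + 1), expDisp r θ a b * expDisp r θ (m - a) L := by
  have hmeas : Measurable fun x : ℝ => Real.exp (-θ * x) := by fun_prop
  have hind : ∀ a, IndepFun (fun c => Real.exp (-θ * dispFrom 0 0 a b c))
      (fun c => Real.exp (-θ * dispFrom a b (m - a) L c)) (arrayLaw r) := fun a =>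
    (indepFun_dispFrom r 0 0 a b a b (m - a) L (by omega)).comp hmeas hmeas
  have hint : ∀ a b m L, Integrable (fun c => Real.exp (-θ * dispFrom a b m L c)) (arrayLaw r) :=
    fun a b m L => integrable_exp hθ (measurable_dispFrom a b m L) (dispFrom_nonneg _ _ _ _)
  have hprod : ∀ a, Integrable (fun c => Real.exp (-θ * dispFrom 0 0 a b c) *
      Real.exp (-θ * dispFrom a b (m - a) L c)) (arrayLaw r) := fun a =>
    (hind a).integrable_mul (hint _ _ _ _) (hint _ _ _ _)
  have h1 : ∀ a, expDisp r θ a b * expDisp r θ (m - a) L = ∫ c, Real.exp (-θ * dispFrom 0 0 a b c) *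
      Real.exp (-θ * dispFrom a b (m - a) L c) ∂(arrayLaw r) := fun a => by
    rw [(hind a).integral_fun_mul_eq_mul_integral (hint _ _ _ _).aestronglyMeasurable
      (hint _ _ _ _).aestronglyMeasurable]
    congr 1
    exact (((identDistrib_dispFrom r a b (m - a) L).comp hmeas).integral_eq).symm
  simp only [h1]
  rw [← integral_finsetSum _ fun a _ => hprod a]
  refine integral_mono (hint _ _ _ _) (integrable_finsetSum _ fun a _ => hprod a) fun c => ?_
  obtain ⟨a, ha, hle⟩ := exists_disp_add_ge (jumps c) m b L
  have hle' : dispFrom 0 0 a b c + dispFrom a b (m - a) L c ≤ dispFrom 0 0 m (b + L) c := by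
    simp only [dispFrom]
    exact_mod_cast hle
  calc Real.exp (-θ * dispFrom 0 0 m (b + L) c)
      ≤ Real.exp (-θ * dispFrom 0 0 a b c) * Real.exp (-θ * dispFrom a b (m - a) L c) := by
        rw [← Real.exp_add]
        refine Real.exp_le_exp.2 ?_
        nlinarith
    _ ≤ _ := Finset.single_le_sum (f := fun a => Real.exp (-θ * dispFrom 0 0 a b c) *
          Real.exp (-θ * dispFrom a b (m - a) L c)) (fun a _ => by positivity)
          (Finset.mem_range.2 (by omega))

lemma pow_mul_expDisp_le {θ z : ℝ} (hθ : 0 ≤ θ) (hz : 0 < z) (hz2 : z ≤ 1 / 2) (m L n : ℕ) :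
    z ^ m * expDisp r θ m (n * L) ≤ (expDisp r θ 0 L + 2 * z) ^ n := by
  have hgeo : ∀ M : ℕ, ∑ j ∈ Finset.range (M + 1), z ^ j * expDisp r θ j L ≤
      expDisp r θ 0 L + 2 * z - 2 * z ^ (M + 1) := by
    intro M
    induction M with
    | zero => simp
    | succ M ih =>
      rw [Finset.sum_range_succ]
      have h1 : z ^ (M + 1) * expDisp r θ (M + 1) L ≤ z ^ (M + 1) * 1 :=
        mul_le_mul_of_nonneg_left (expDisp_le_one hθ _ _) (by positivity)
      have h2 : z ^ (M + 1 + 1) ≤ z ^ (M + 1) * (1 / 2) := by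
        rw [pow_succ]
        exact mul_le_mul_of_nonneg_left hz2 (by positivity)
      linarith
  have hC : 0 ≤ expDisp r θ 0 L + 2 * z := by
    have := expDisp_nonneg (r := r) θ 0 L
    positivity
  induction n generalizing m with
  | zero =>
    have h1 := expDisp_le_one (r := r) hθ m (0 * L)
    have h2 : z ^ m ≤ 1 := pow_le_one₀ hz.le (by linarith)
    rw [pow_zero]
    exact mul_le_one₀ h2 (expDisp_nonneg _ _ _) h1
  | succ n ih =>
    rw [Nat.succ_mul]
    calc z ^ m * expDisp r θ m (n * L + L)
        ≤ z ^ m * ∑ a ∈ Finset.range (m + 1), expDisp r θ a (n * L) * expDisp r θ (m - a) L :=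
          mul_le_mul_of_nonneg_left (expDisp_add_le hθ _ _ _) (by positivity)
      _ = ∑ a ∈ Finset.range (m + 1), (z ^ a * expDisp r θ a (n * L)) *
            (z ^ (m - a) * expDisp r θ (m - a) L) := by
          rw [Finset.mul_sum]
          refine Finset.sum_congr rfl fun a ha => ?_
          have : z ^ m = z ^ a * z ^ (m - a) := by
            rw [← pow_add, Nat.add_sub_cancel' (Nat.lt_succ_iff.1 (Finset.mem_range.1 ha))]
          rw [this]
          ring
      _ ≤ ∑ a ∈ Finset.range (m + 1), (expDisp r θ 0 L + 2 * z) ^ n *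
            (z ^ (m - a) * expDisp r θ (m - a) L) := by
          refine Finset.sum_le_sum fun a _ => mul_le_mul_of_nonneg_right (ih a) ?_
          have := expDisp_nonneg (r := r) θ (m - a) L
          positivity
      _ = (expDisp r θ 0 L + 2 * z) ^ n *
            ∑ j ∈ Finset.range (m + 1), z ^ j * expDisp r θ j L := by
          rw [← Finset.mul_sum, ← Finset.sum_range_reflect]
          congr 1
          refine Finset.sum_congr rfl fun a ha => ?_
          have : m - (m + 1 - 1 - a) = a := by
            have := Finset.mem_range.1 ha
            omega
          rw [this]
      _ ≤ _ := by
          rw [pow_succ]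
          refine mul_le_mul_of_nonneg_left ((hgeo m).trans ?_) (by positivity)
          have : 0 < z ^ (m + 1) := by positivity
          linarith

include hr

lemma expDisp_zero_le {θ : ℝ} (hθ : 0 ≤ θ) (L : ℕ) :
    expDisp r θ 0 L ≤ 1 - θ * meanDisp r 0 L + θ ^ 2 / 2 * sqBound r L := by
  have hi := integrable_dispFrom hr 0 0 0 L
  have hs := (memLp_dispFrom hr 0 0 0 L).integrable_sq
  have h1 : expDisp r θ 0 L ≤ ∫ c, (1 - θ * dispFrom 0 0 0 L c + θ ^ 2 / 2 * dispFrom 0 0 0 L c ^ 2)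
      ∂(arrayLaw r) := by
    refine integral_mono (integrable_exp hθ (measurable_dispFrom 0 0 0 L) (dispFrom_nonneg _ _ _ _))
      (((integrable_const _).sub (hi.const_mul _)).add (hs.const_mul _)) fun c => ?_
    have hx : 0 ≤ θ * dispFrom 0 0 0 L c := mul_nonneg hθ (dispFrom_nonneg _ _ _ _ _)
    have key : ∀ x : ℝ, 0 ≤ x → Real.exp (-x) ≤ 1 - x + x ^ 2 / 2 := by
      intro x hx
      -- the product of the quadratic Taylor polynomials at `x` and `-x` is at least `1`
      have h1 := Real.quadratic_le_exp_of_nonneg hx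
      rw [Real.exp_neg, inv_le_iff_one_le_mul₀ (Real.exp_pos _)]
      nlinarith [mul_le_mul_of_nonneg_left h1
        (show 0 ≤ 1 - x + x ^ 2 / 2 by nlinarith [sq_nonneg (x - 1)]), sq_nonneg (x ^ 2)]
    have := key _ hx
    simp only
    rw [neg_mul]
    refine this.trans (le_of_eq ?_)
    ring
  have hi' : Integrable (fun c => 1 - θ * dispFrom 0 0 0 L c) (arrayLaw r) :=
    (integrable_const _).sub (hi.const_mul _)
  rw [integral_add hi' (hs.const_mul _),
    integral_sub (integrable_const _) (hi.const_mul _), integral_const_mul, integral_const_mul] at h1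
  have h2 := integral_dispFrom_zero_sq_le hr L
  simp only [integral_const, probReal_univ, smul_eq_mul, mul_one] at h1
  have h3 : θ ^ 2 / 2 * ∫ c, dispFrom 0 0 0 L c ^ 2 ∂(arrayLaw r) ≤ θ ^ 2 / 2 * sqBound r L :=
    mul_le_mul_of_nonneg_left h2 (by positivity)
  rw [meanDisp]
  linarith

lemma exp_le_expDisp {θ : ℝ} (hθ : 0 ≤ θ) (m L : ℕ) :
    Real.exp (-θ * meanDisp r m L) ≤ expDisp r θ m L := by
  have hi := integrable_dispFrom hr 0 0 m L
  set μ := meanDisp r m L with hμ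
  have h1 : ∫ c, (Real.exp (-θ * μ) + Real.exp (-θ * μ) * (-θ) * (dispFrom 0 0 m L c - μ))
      ∂(arrayLaw r) ≤ expDisp r θ m L := by
    refine integral_mono ((integrable_const _).add ((hi.sub (integrable_const _)).const_mul _))
      (integrable_exp hθ (measurable_dispFrom 0 0 m L) (dispFrom_nonneg _ _ _ _)) fun c => ?_
    have h2 : Real.exp (-θ * dispFrom 0 0 m L c) =
        Real.exp (-θ * μ) * Real.exp (-θ * (dispFrom 0 0 m L c - μ)) := by
      rw [← Real.exp_add]
      ring_nf
    have h3 := Real.add_one_le_exp (-θ * (dispFrom 0 0 m L c - μ))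
    simp only
    rw [h2]
    nlinarith [Real.exp_pos (-θ * μ)]
  have hi' : Integrable (fun c => dispFrom 0 0 m L c - μ) (arrayLaw r) :=
    hi.sub (integrable_const _)
  rw [integral_add (integrable_const _) (hi'.const_mul _), integral_const_mul, integral_sub hi (integrable_const _)] at h1
  have h4 : ∫ c, dispFrom 0 0 m L c ∂(arrayLaw r) = μ := rfl
  simpa [h4] using h1

/-- A lower bound for the displacement that is sharp for `m / n` small. -/
lemma le_meanDisp_mul {θ z : ℝ} (hθ : 0 ≤ θ) (hz : 0 < z) (hz2 : z ≤ 1 / 2) (m L n : ℕ) :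
    m * Real.log z + n * (θ * meanDisp r 0 L - θ ^ 2 / 2 * sqBound r L - 2 * z) ≤
      θ * meanDisp r m (n * L) := by
  have h1 := pow_mul_expDisp_le (r := r) hθ hz hz2 m L n
  have h2 := exp_le_expDisp hr hθ m (n * L)
  have h3 := expDisp_zero_le hr hθ L
  have hC : 0 ≤ expDisp r θ 0 L + 2 * z := by
    have := expDisp_nonneg (r := r) θ 0 L
    positivity
  have h4 : (expDisp r θ 0 L + 2 * z) ^ n ≤
      Real.exp (n * (-θ * meanDisp r 0 L + θ ^ 2 / 2 * sqBound r L + 2 * z)) := by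
    rw [Real.exp_nat_mul]
    refine pow_le_pow_left₀ hC ?_ n
    refine le_trans ?_ (Real.add_one_le_exp _)
    linarith
  have h5 : z ^ m = Real.exp (m * Real.log z) := by
    rw [Real.exp_nat_mul, Real.exp_log hz]
  have h6 : Real.exp (m * Real.log z + -θ * meanDisp r m (n * L)) ≤
      Real.exp (n * (-θ * meanDisp r 0 L + θ ^ 2 / 2 * sqBound r L + 2 * z)) := by
    rw [Real.exp_add, ← h5]
    exact (mul_le_mul_of_nonneg_left h2 (by positivity)).trans (h1.trans h4)
  have := Real.exp_le_exp.1 h6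
  linarith

end Moments

/-! ### The continuous-time limit of the expected displacements -/

/-- The mean numbers of attempts in time steps of length `1 / N`. -/
def stepRates (β : ℕ+ → ℝ≥0) (N : ℕ) : ℕ+ → ℝ≥0 := fun k => β k * (N : ℝ≥0)⁻¹

lemma rateMoment_stepRates (β : ℕ+ → ℝ≥0) (N j : ℕ) :
    rateMoment (stepRates β N) j = rateMoment β j * ((N : ℝ≥0)⁻¹ : ℝ≥0) := by
  simp only [rateMoment, stepRates]
  rw [← ENNReal.tsum_mul_right]
  simp only [ENNReal.coe_mul, mul_assoc]

lemma realMoment_stepRates (β : ℕ+ → ℝ≥0) (N j : ℕ) :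
    realMoment (stepRates β N) j = realMoment β j / N := by
  rw [realMoment, rateMoment_stepRates, ENNReal.toReal_mul, realMoment, div_eq_mul_inv]
  simp

/-- The expected displacement of particle `-m` at time `s` when time is discretized with steps of
length `1 / N`. -/
def gridMean (β : ℕ+ → ℝ≥0) (N m : ℕ) (s : ℝ) : ℝ := meanDisp (stepRates β N) m ⌈s * N⌉₊

/-- The limit of the expected displacements for fine discretizations, along a fixed ultrafilter: by
compactness it exists without a proof that the full sequence converges, and it respects sums and
inequalities. -/
def limMean (β : ℕ+ → ℝ≥0) (m : ℕ) (s : ℝ) : ℝ :=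
  limUnder (hyperfilter ℕ : Filter ℕ) fun N => gridMean β N m s

lemma tendsto_ceil_mul_div {s : ℝ} (hs : 0 ≤ s) :
    Tendsto (fun N : ℕ => (⌈s * N⌉₊ : ℝ) / N) (hyperfilter ℕ : Filter ℕ) (𝓝 s) :=
  ((tendsto_nat_ceil_mul_div_atTop hs).comp tendsto_natCast_atTop_atTop).mono_left
    Nat.hyperfilter_le_atTop

lemma ceil_div_le {s : ℝ} (hs : 0 ≤ s) (N : ℕ) : (⌈s * N⌉₊ : ℝ) / N ≤ s + 1 := by
  rcases Nat.eq_zero_or_pos N with rfl | hN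
  · simp; linarith
  · have hN' : (1 : ℝ) ≤ N := by exact_mod_cast hN
    have := (Nat.ceil_lt_add_one (show 0 ≤ s * N by positivity)).le
    rw [div_le_iff₀ (by linarith)]
    nlinarith

section Limits

variable {β : ℕ+ → ℝ≥0} (hβ : rateMoment β 2 < ∞)

lemma gridMean_nonneg (N m : ℕ) (s : ℝ) : 0 ≤ gridMean β N m s := meanDisp_nonneg _ _

include hβ

lemma stepRates_lt_top (N : ℕ) : rateMoment (stepRates β N) 2 < ∞ := by
  rw [rateMoment_stepRates]
  exact ENNReal.mul_lt_top hβ ENNReal.coe_lt_top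

lemma gridMean_le (N m : ℕ) (s : ℝ) : gridMean β N m s ≤ (⌈s * N⌉₊ : ℝ) / N * realMoment β 1 := by
  refine (meanDisp_le (stepRates_lt_top hβ N) m _).trans (le_of_eq ?_)
  rw [realMoment_stepRates]
  ring

lemma tendsto_limMean (m : ℕ) {s : ℝ} (hs : 0 ≤ s) :
    Tendsto (fun N => gridMean β N m s) (hyperfilter ℕ : Filter ℕ) (𝓝 (limMean β m s)) := by
  refine tendsto_nhds_limUnder ?_
  have hmem : ∀ N, gridMean β N m s ∈ Set.Icc (0 : ℝ) ((s + 1) * realMoment β 1) := fun N =>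
    ⟨gridMean_nonneg _ _ _, (gridMean_le hβ N m s).trans
      (mul_le_mul_of_nonneg_right (ceil_div_le hs N) (realMoment_nonneg _ _))⟩
  obtain ⟨x, -, hx⟩ := isCompact_Icc.ultrafilter_le_nhds
    ((hyperfilter ℕ).map fun N => gridMean β N m s) (by
      rw [Ultrafilter.coe_map, le_principal_iff]
      exact mem_map.2 (univ_mem' hmem))
  exact ⟨x, hx⟩

lemma limMean_nonneg (m : ℕ) {s : ℝ} (hs : 0 ≤ s) : 0 ≤ limMean β m s :=
  ge_of_tendsto' (tendsto_limMean hβ m hs) fun _ => gridMean_nonneg _ _ _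

lemma limMean_le (m : ℕ) {s : ℝ} (hs : 0 ≤ s) : limMean β m s ≤ s * realMoment β 1 :=
  le_of_tendsto_of_tendsto' (tendsto_limMean hβ m hs) ((tendsto_ceil_mul_div hs).mul_const _)
    fun N => gridMean_le hβ N m s

lemma limMean_antitone {m m' : ℕ} (h : m ≤ m') {s : ℝ} (hs : 0 ≤ s) :
    limMean β m' s ≤ limMean β m s :=
  le_of_tendsto_of_tendsto' (tendsto_limMean hβ m' hs) (tendsto_limMean hβ m hs)
    fun N => meanDisp_antitone (stepRates_lt_top hβ N) h _

lemma limMean_add_le (a m : ℕ) {s t : ℝ} (hs : 0 ≤ s) (ht : 0 ≤ t) :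
    limMean β (a + m) (s + t) ≤ limMean β a s + limMean β m t := by
  refine le_of_tendsto_of_tendsto' (tendsto_limMean hβ (a + m) (add_nonneg hs ht))
    ((tendsto_limMean hβ a hs).add (tendsto_limMean hβ m ht)) fun N => ?_
  refine le_trans (meanDisp_mono (stepRates_lt_top hβ N) _ ?_)
    (meanDisp_add_le (stepRates_lt_top hβ N) _ _ _ _)
  rw [add_mul]
  exact Nat.ceil_add_le _ _

lemma limMean_one_le (m : ℕ) : limMean β m 1 ≤ realMoment β 1 ^ (m + 1) / (m + 1).factorial := by
  have h := (((tendsto_ceil_mul_div zero_le_one).mul_const (realMoment β 1)).pow (m + 1)).div_const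
    ((m + 1).factorial : ℝ)
  rw [one_mul] at h
  refine le_of_tendsto_of_tendsto' (tendsto_limMean hβ m zero_le_one) h fun N => ?_
  refine (meanDisp_le_pow_div_factorial (stepRates_lt_top hβ N) m _).trans (le_of_eq ?_)
  rw [realMoment_stepRates]
  ring

lemma le_limMean_natCast {θ z : ℝ} (hθ : 0 ≤ θ) (hz : 0 < z) (hz2 : z ≤ 1 / 2) (m n : ℕ) :
    m * Real.log z + n * (θ * limMean β 0 1 -
      θ ^ 2 / 2 * (realMoment β 2 + realMoment β 1 ^ 2) - 2 * z) ≤ θ * limMean β m n := by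
  have h1 := ((tendsto_limMean hβ 0 zero_le_one).const_mul θ)
  have h2 := (((h1.sub_const (θ ^ 2 / 2 * (realMoment β 2 + realMoment β 1 ^ 2))).sub_const
    (2 * z)).const_mul (n : ℝ)).const_add (m * Real.log z)
  refine le_of_tendsto_of_tendsto h2 ((tendsto_limMean hβ m n.cast_nonneg).const_mul θ) ?_
  filter_upwards [Nat.hyperfilter_le_atTop (eventually_ge_atTop 1)] with N hN
  have hN' : (N : ℝ) ≠ 0 := by positivity
  have h := le_meanDisp_mul (stepRates_lt_top hβ N) hθ hz hz2 m N n
  have e1 : ⌈(1 : ℝ) * N⌉₊ = N := by simp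
  have e2 : ⌈(n : ℝ) * N⌉₊ = n * N := by exact_mod_cast Nat.ceil_natCast (R := ℝ) (n * N)
  have e3 : sqBound (stepRates β N) N = realMoment β 2 + realMoment β 1 ^ 2 := by
    rw [sqBound, realMoment_stepRates, realMoment_stepRates, mul_div_cancel₀ _ hN',
      mul_div_cancel₀ _ hN']
  simp only [gridMean, e1, e2]
  rwa [e3] at h

/-! ### The limiting displacement -/

omit hβ

/-- The limiting displacement at time `1`, in the hydrodynamic scaling, of the particle that starts
at distance `y` behind the front. -/
def limDisp (β : ℕ+ → ℝ≥0) (y : ℝ) : ℝ := ⨅ s : {s : ℝ // 0 < s}, limMean β ⌊s.1 * y⌋₊ s.1 / s.1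

include hβ

lemma limDisp_le (y : ℝ) {s : ℝ} (hs : 0 < s) : limDisp β y ≤ limMean β ⌊s * y⌋₊ s / s :=
  ciInf_le (f := fun s : {s : ℝ // 0 < s} => limMean β ⌊s.1 * y⌋₊ s.1 / s.1)
    ⟨0, by
      rintro _ ⟨s, rfl⟩
      exact div_nonneg (limMean_nonneg hβ _ s.2.le) s.2.le⟩ ⟨s, hs⟩

lemma limDisp_nonneg (y : ℝ) : 0 ≤ limDisp β y :=
  have : Nonempty {s : ℝ // 0 < s} := ⟨⟨1, one_pos⟩⟩
  le_ciInf fun s => div_nonneg (limMean_nonneg hβ _ s.2.le) s.2.le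

/-- Subadditivity in real time: `⌊s / s₀⌋` blocks of length `s₀` and a remainder. -/
lemma tendsto_limDisp {y : ℝ} (hy : 0 ≤ y) :
    Tendsto (fun s : ℝ => limMean β ⌊s * y⌋₊ s / s) atTop (𝓝 (limDisp β y)) := by
  refine tendsto_order.2 ⟨fun a ha => ?_, fun a ha => ?_⟩
  · filter_upwards [eventually_gt_atTop 0] with s hs
    exact ha.trans_le (limDisp_le hβ y hs)
  · have : Nonempty {s : ℝ // 0 < s} := ⟨⟨1, one_pos⟩⟩
    obtain ⟨⟨s₀, hs₀⟩, hlt⟩ := exists_lt_of_ciInf_lt ha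
    simp only at hlt
    set F₀ := limMean β ⌊s₀ * y⌋₊ s₀ with hF₀
    have hblock : ∀ n : ℕ, limMean β (n * ⌊s₀ * y⌋₊) (n * s₀) ≤ n * F₀ := by
      intro n
      induction n with
      | zero => simpa using limMean_le hβ 0 le_rfl
      | succ n ih =>
        have := limMean_add_le hβ (n * ⌊s₀ * y⌋₊) ⌊s₀ * y⌋₊ (s := n * s₀) (t := s₀)
          (by positivity) hs₀.le
        rw [Nat.succ_mul]
        push_cast
        rw [add_mul, one_mul, add_mul, one_mul]
        linarith
    have hlim : Tendsto (fun s : ℝ => F₀ / s₀ + s₀ * realMoment β 1 / s) atTop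
        (𝓝 (F₀ / s₀ + 0)) := tendsto_const_nhds.add (tendsto_const_nhds.div_atTop tendsto_id)
    rw [add_zero] at hlim
    filter_upwards [hlim.eventually (gt_mem_nhds hlt), eventually_gt_atTop 0] with s hs hs0
    refine lt_of_le_of_lt ?_ hs
    have hF0 : 0 ≤ F₀ := limMean_nonneg hβ _ hs₀.le
    set n := ⌊s / s₀⌋₊
    have hn1 : (n : ℝ) ≤ s / s₀ := Nat.floor_le (by positivity)
    have hn2 : s / s₀ < n + 1 := Nat.lt_floor_add_one _
    have hn3 : n * s₀ ≤ s := by rwa [le_div_iff₀ hs₀] at hn1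
    have hn4 : s < (n + 1) * s₀ := by rwa [div_lt_iff₀ hs₀] at hn2
    have hm : n * ⌊s₀ * y⌋₊ ≤ ⌊s * y⌋₊ := by
      refine Nat.le_floor ?_
      push_cast
      have := Nat.floor_le (show 0 ≤ s₀ * y by positivity)
      calc (n : ℝ) * ⌊s₀ * y⌋₊ ≤ n * (s₀ * y) := by gcongr
        _ = (n * s₀) * y := by ring
        _ ≤ s * y := by gcongr
    have h1 : limMean β ⌊s * y⌋₊ s ≤ n * F₀ + (s - n * s₀) * realMoment β 1 := by
      refine (limMean_antitone hβ hm hs0.le).trans ?_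
      have h2 := limMean_add_le hβ (n * ⌊s₀ * y⌋₊) 0 (s := n * s₀) (t := s - n * s₀)
        (by positivity) (by linarith)
      rw [add_zero, add_sub_cancel] at h2
      have h3 := limMean_le hβ 0 (s := s - n * s₀) (by linarith)
      linarith [hblock n]
    have hb := realMoment_nonneg β 1
    have h4 : limMean β ⌊s * y⌋₊ s ≤ s / s₀ * F₀ + s₀ * realMoment β 1 := by
      refine h1.trans (add_le_add (by gcongr) (by gcongr; linarith))
    rw [div_le_iff₀ hs0, add_mul, div_mul_cancel₀ _ hs0.ne']
    refine h4.trans (le_of_eq ?_)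
    ring

lemma limDisp_antitone {y y' : ℝ} (hy : 0 ≤ y) (h : y ≤ y') : limDisp β y' ≤ limDisp β y := by
  refine le_of_tendsto_of_tendsto (tendsto_limDisp hβ (hy.trans h)) (tendsto_limDisp hβ hy) ?_
  filter_upwards [eventually_gt_atTop 0] with s hs
  have : ⌊s * y⌋₊ ≤ ⌊s * y'⌋₊ := Nat.floor_le_floor (by gcongr)
  exact div_le_div_of_nonneg_right (limMean_antitone hβ this hs.le) hs.le

/-- Convexity follows from subadditivity by splitting the time interval `[0, s]` in proportion. -/
lemma convexOn_limDisp : ConvexOn ℝ (Set.Ici 0) (limDisp β) := by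
  refine ⟨convex_Ici 0, fun y hy y' hy' a b ha hb hab => ?_⟩
  rw [Set.mem_Ici] at hy hy'
  simp only [smul_eq_mul]
  rcases eq_or_lt_of_le ha with rfl | ha
  · obtain rfl : b = 1 := by linarith
    simp
  rcases eq_or_lt_of_le hb with rfl | hb
  · obtain rfl : a = 1 := by linarith
    simp
  have h1 := ((tendsto_limDisp hβ hy).comp (tendsto_id.const_mul_atTop ha)).const_mul a
  have h2 := ((tendsto_limDisp hβ hy').comp (tendsto_id.const_mul_atTop hb)).const_mul b
  refine le_of_tendsto_of_tendsto (tendsto_limDisp hβ (by positivity)) (h1.add h2) ?_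
  filter_upwards [eventually_gt_atTop 0] with s hs
  simp only [Function.comp_apply, id_eq]
  have e : s = a * s + b * s := by rw [← add_mul, hab, one_mul]
  have h3 := limMean_add_le hβ ⌊a * s * y⌋₊ ⌊b * s * y'⌋₊ (s := a * s) (t := b * s)
    (by positivity) (by positivity)
  rw [← e] at h3
  have h4 : ⌊a * s * y⌋₊ + ⌊b * s * y'⌋₊ ≤ ⌊s * (a * y + b * y')⌋₊ := by
    refine Nat.le_floor ?_
    push_cast
    have h5 := Nat.floor_le (show 0 ≤ a * s * y by positivity)
    have h6 := Nat.floor_le (show 0 ≤ b * s * y' by positivity)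
    calc _ ≤ a * s * y + b * s * y' := add_le_add h5 h6
      _ = _ := by ring
  have h7 := (limMean_antitone hβ h4 hs.le).trans h3
  rw [div_le_iff₀ hs]
  refine h7.trans (le_of_eq ?_)
  field_simp

lemma limDisp_natCast_le (m : ℕ) : limDisp β m ≤ realMoment β 1 ^ (m + 1) / (m + 1).factorial := by
  have h := limDisp_le hβ (m : ℝ) one_pos
  rw [one_mul, Nat.floor_natCast, div_one] at h
  exact h.trans (limMean_one_le hβ m)

/-- Far behind the front the limiting displacement vanishes. -/
lemma exists_limDisp_lt {ε : ℝ} (hε : 0 < ε) : ∃ C : ℝ, 0 ≤ C ∧ ∀ y, C ≤ y → limDisp β y < ε := by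
  have h := (FloorSemiring.tendsto_pow_div_factorial_atTop (realMoment β 1)).comp
    (tendsto_add_atTop_nat 1)
  obtain ⟨m, hm⟩ := (h.eventually (gt_mem_nhds hε)).exists
  exact ⟨m, m.cast_nonneg, fun y hy => ((limDisp_antitone hβ m.cast_nonneg hy).trans
    (limDisp_natCast_le hβ m)).trans_lt hm⟩

lemma le_limDisp {θ z y : ℝ} (hθ : 0 ≤ θ) (hz : 0 < z) (hz2 : z ≤ 1 / 2) (hy : 0 ≤ y) :
    y * Real.log z + (θ * limDisp β 0 - θ ^ 2 / 2 * (realMoment β 2 + realMoment β 1 ^ 2) - 2 * z) ≤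
      θ * limDisp β y := by
  have h0 : limDisp β 0 ≤ limMean β 0 1 := by
    simpa using limDisp_le hβ 0 one_pos
  refine ge_of_tendsto (((tendsto_limDisp hβ hy).comp tendsto_natCast_atTop_atTop).const_mul θ) ?_
  filter_upwards [eventually_gt_atTop 0] with n hn
  have hn' : (0 : ℝ) < n := by exact_mod_cast hn
  have h := le_limMean_natCast hβ hθ hz hz2 ⌊(n : ℝ) * y⌋₊ n
  have hlog : Real.log z ≤ 0 := Real.log_nonpos hz.le (by linarith)
  have h1 : n * y * Real.log z ≤ ⌊(n : ℝ) * y⌋₊ * Real.log z :=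
    mul_le_mul_of_nonpos_right (Nat.floor_le (by positivity)) hlog
  simp only [Function.comp_apply]
  rw [← mul_div_assoc, le_div_iff₀ hn']
  have h2 : n * (θ * limDisp β 0) ≤ n * (θ * limMean β 0 1) := by gcongr
  nlinarith

lemma continuousOn_limDisp : ContinuousOn (limDisp β) (Set.Ici 0) := by
  intro y hy
  rcases eq_or_lt_of_le (Set.mem_Ici.1 hy) with rfl | hy
  · -- continuity at the front: the lower bound with `θ`, then `z`, then `y` small
    rw [ContinuousWithinAt]
    refine tendsto_order.2 ⟨fun a ha => ?_, fun a ha => ?_⟩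
    · set C := realMoment β 2 + realMoment β 1 ^ 2
      have hC : 0 ≤ C := add_nonneg (realMoment_nonneg _ _) (sq_nonneg _)
      set ε := limDisp β 0 - a with hε
      have hε0 : 0 < ε := by linarith
      set θ := ε / (C + 1) with hθ
      have hθ0 : 0 < θ := by positivity
      have hθC : θ * C ≤ ε := by
        rw [hθ, div_mul_eq_mul_div, div_le_iff₀ (by linarith)]
        nlinarith
      set z := min (1 / 2) (θ * ε / 16) with hz
      have hz0 : 0 < z := by positivity
      have hz1 : z ≤ 1 / 2 := min_le_left _ _
      have hz2 : z ≤ θ * ε / 16 := min_le_right _ _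
      have hlim : Tendsto (fun y : ℝ => y * Real.log z) (𝓝[Set.Ici 0] 0) (𝓝 (0 * Real.log z)) :=
        (continuous_id.mul continuous_const).continuousWithinAt
      rw [zero_mul] at hlim
      have hneg : -(θ * ε / 16) < 0 := by
        have : 0 < θ * ε := by positivity
        linarith
      filter_upwards [hlim.eventually (lt_mem_nhds hneg), eventually_mem_nhdsWithin] with y hy1 hy2
      have h := le_limDisp hβ hθ0.le hz0 hz1 (y := y) hy2
      have h1 : θ * a < θ * limDisp β y := by
        have : a = limDisp β 0 - ε := by ring
        rw [this]
        nlinarith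
      exact lt_of_mul_lt_mul_left h1 hθ0.le
    · filter_upwards [eventually_mem_nhdsWithin] with y hy
      exact (limDisp_antitone hβ le_rfl hy).trans_lt ha
  · have h := (convexOn_limDisp hβ).subset Set.Ioi_subset_Ici_self (convex_Ioi 0)
    exact ((h.continuousOn isOpen_Ioi).continuousAt (isOpen_Ioi.mem_nhds hy)).continuousWithinAt

/-! ### Concentration -/

lemma integrable_excess (N a b m L : ℕ) (x : ℝ) :
    Integrable (fun c => max (dispFrom a b m L c - x) 0) (arrayLaw (stepRates β N)) :=
  ((integrable_dispFrom (stepRates_lt_top hβ N) a b m L).sub (integrable_const x)).sup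
    (integrable_const 0)

/-- The displacement does not exceed its limit: it is at most a sum of independent block
displacements whose mean is close to the limit. -/
lemma eventually_integral_excess_le {y : ℝ} (hy : 0 ≤ y) {δ : ℝ} (hδ : 0 < δ) :
    ∀ᶠ s : ℝ in atTop, ∀ᶠ N in (hyperfilter ℕ : Filter ℕ),
      ∫ c, max (dispFrom 0 0 ⌊s * y⌋₊ ⌈s * N⌉₊ c - s * limDisp β y) 0
        ∂(arrayLaw (stepRates β N)) ≤ δ * s := by
  have hlim := (tendsto_limDisp hβ hy).eventually
    (gt_mem_nhds (show limDisp β y < limDisp β y + δ / 8 by linarith))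
  obtain ⟨s₀, hs₀lt, hs₀⟩ := (hlim.and (eventually_gt_atTop 0)).exists
  rw [div_lt_iff₀ hs₀] at hs₀lt
  set b₁ := realMoment β 1 with hb₁
  set b₂ := realMoment β 2 with hb₂
  have hb₁0 : 0 ≤ b₁ := realMoment_nonneg _ _
  have hb₂0 : 0 ≤ b₂ := realMoment_nonneg _ _
  set V := (s₀ + 1) * b₂ + ((s₀ + 1) * b₁) ^ 2 with hV
  set δ' := δ * s₀ / 4 with hδ'
  have hδ'0 : 0 < δ' := by positivity
  set K := V / δ' + (s₀ + 1) * b₁ with hK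
  filter_upwards [eventually_ge_atTop (2 * K / δ), eventually_gt_atTop 0] with s hsK hs
  have hev := (tendsto_limMean hβ ⌊s₀ * y⌋₊ hs₀.le).eventually
    (gt_mem_nhds (show limMean β ⌊s₀ * y⌋₊ s₀ < limMean β ⌊s₀ * y⌋₊ s₀ + s₀ * (δ / 8) by
      have : 0 < s₀ * (δ / 8) := by positivity
      linarith))
  filter_upwards [hev, Nat.hyperfilter_le_atTop (eventually_ge_atTop 1)] with N hN hN1
  have hN0 : (1 : ℝ) ≤ N := by exact_mod_cast hN1
  set m₀ := ⌊s₀ * y⌋₊ with hm₀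
  set L₀ := ⌈s₀ * N⌉₊ with hL₀
  set n := ⌊s / s₀⌋₊ with hn
  have hn1 : (n : ℝ) ≤ s / s₀ := Nat.floor_le (by positivity)
  have hn2 : s / s₀ < n + 1 := Nat.lt_floor_add_one _
  have hn3 : n * s₀ ≤ s := by rwa [le_div_iff₀ hs₀] at hn1
  have hn4 : s < (n + 1) * s₀ := by rwa [div_lt_iff₀ hs₀] at hn2
  set ρ := s - n * s₀ with hρ
  have hρ0 : 0 ≤ ρ := by linarith
  have hρ1 : ρ ≤ s₀ := by linarith
  set Lρ := ⌈ρ * N⌉₊ with hLρ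
  have hm : n * m₀ ≤ ⌊s * y⌋₊ := by
    refine Nat.le_floor ?_
    push_cast
    have := Nat.floor_le (show 0 ≤ s₀ * y by positivity)
    calc (n : ℝ) * m₀ ≤ n * (s₀ * y) := by gcongr
      _ = (n * s₀) * y := by ring
      _ ≤ s * y := by gcongr
  have hL : ⌈s * N⌉₊ ≤ n * L₀ + Lρ := by
    refine Nat.ceil_le.2 ?_
    push_cast
    have h1 := Nat.le_ceil (s₀ * (N : ℝ))
    have h2 := Nat.le_ceil (ρ * (N : ℝ))
    calc s * N = n * (s₀ * N) + ρ * N := by rw [hρ]; ring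
      _ ≤ n * L₀ + Lρ := by gcongr
  have hpt : ∀ c, max (dispFrom 0 0 ⌊s * y⌋₊ ⌈s * N⌉₊ c - s * limDisp β y) 0 ≤
      max (dispFrom 0 0 (n * m₀) (n * L₀) c - n * gridMean β N m₀ s₀) 0 +
        dispFrom (n * m₀) (n * L₀) 0 Lρ c + s * (δ / 4) := by
    intro c
    have h1 : dispFrom 0 0 ⌊s * y⌋₊ ⌈s * N⌉₊ c ≤ dispFrom 0 0 (n * m₀ + 0) (n * L₀ + Lρ) c :=
      Nat.cast_le.2 ((disp_antitone_left _ hm _).trans (disp_monotone_right _ _ hL))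
    have h2 := dispFrom_add_le (n * m₀) (n * L₀) 0 Lρ c
    have h3 := dispFrom_nonneg (n * m₀) (n * L₀) 0 Lρ c
    have h4 := le_max_left (dispFrom 0 0 (n * m₀) (n * L₀) c - n * gridMean β N m₀ s₀) 0
    have h5 := le_max_right (dispFrom 0 0 (n * m₀) (n * L₀) c - n * gridMean β N m₀ s₀) 0
    have h6 : n * gridMean β N m₀ s₀ ≤ s * (limDisp β y + δ / 4) := by
      have hD := limDisp_nonneg hβ y
      calc n * gridMean β N m₀ s₀ ≤ n * (s₀ * (limDisp β y + δ / 4)) := by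
            gcongr
            linarith
        _ = (n * s₀) * (limDisp β y + δ / 4) := by ring
        _ ≤ _ := by gcongr
    refine max_le ?_ (by positivity)
    linarith
  have hint := stepRates_lt_top hβ N
  have hVN : sqBound (stepRates β N) L₀ ≤ V := by
    have h1 : (L₀ : ℝ) / N ≤ s₀ + 1 := ceil_div_le hs₀.le N
    rw [sqBound, realMoment_stepRates, realMoment_stepRates]
    calc (L₀ : ℝ) * (b₂ / N) + (L₀ * (b₁ / N)) ^ 2
        = (L₀ / N) * b₂ + ((L₀ / N) * b₁) ^ 2 := by ring
      _ ≤ V := by rw [hV]; gcongr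
  have hρN : meanDisp (stepRates β N) 0 Lρ ≤ (s₀ + 1) * b₁ := by
    have h1 : (Lρ : ℝ) / N ≤ ρ + 1 := ceil_div_le hρ0 N
    refine (meanDisp_zero_le hint _).trans ?_
    rw [realMoment_stepRates]
    calc (Lρ : ℝ) * (b₁ / N) = Lρ / N * b₁ := by ring
      _ ≤ (s₀ + 1) * b₁ := by gcongr; linarith
  calc _ ≤ ∫ c, (max (dispFrom 0 0 (n * m₀) (n * L₀) c - n * gridMean β N m₀ s₀) 0 +
        dispFrom (n * m₀) (n * L₀) 0 Lρ c + s * (δ / 4)) ∂(arrayLaw (stepRates β N)) :=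
        integral_mono (integrable_excess hβ _ _ _ _ _ _)
          (((integrable_excess hβ _ _ _ _ _ _).add (integrable_dispFrom hint _ _ _ _)).add
            (integrable_const _)) hpt
    _ = (∫ c, max (dispFrom 0 0 (n * m₀) (n * L₀) c - n * gridMean β N m₀ s₀) 0
          ∂(arrayLaw (stepRates β N))) + meanDisp (stepRates β N) 0 Lρ + s * (δ / 4) := by
        have hi : Integrable (fun c => max (dispFrom 0 0 (n * m₀) (n * L₀) c -
            n * gridMean β N m₀ s₀) 0 + dispFrom (n * m₀) (n * L₀) 0 Lρ c)
            (arrayLaw (stepRates β N)) :=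
          (integrable_excess hβ _ _ _ _ _ _).add (integrable_dispFrom hint _ _ _ _)
        rw [integral_add hi (integrable_const _),
          integral_add (integrable_excess hβ _ _ _ _ _ _) (integrable_dispFrom hint _ _ _ _),
          integral_dispFrom]
        simp
    _ ≤ (δ' * n + V / δ') + (s₀ + 1) * b₁ + s * (δ / 4) := by
        gcongr
        refine (integral_excess_le hint m₀ L₀ n hδ'0).trans ?_
        gcongr
    _ = δ / 4 * (n * s₀) + K + s * (δ / 4) := by rw [hK, hδ']; ring
    _ ≤ δ / 4 * s + δ / 2 * s + s * (δ / 4) := by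
        have : K ≤ δ / 2 * s := by
          rw [div_le_iff₀ hδ] at hsK
          linarith
        gcongr
    _ = δ * s := by ring

/-- The law of large numbers for displacements, in `L¹` and uniformly in fine discretizations: the
displacement does not exceed its limit, and its expectation is at least the limit. -/
lemma eventually_integral_abs_le {y : ℝ} (hy : 0 ≤ y) {m : ℕ → ℕ} {s : ℕ → ℝ}
    (hs : Tendsto s atTop atTop) (hm : Tendsto (fun n => (m n : ℝ) / s n) atTop (𝓝 y))
    {δ : ℝ} (hδ : 0 < δ) :
    ∀ᶠ n in atTop, ∀ᶠ N in (hyperfilter ℕ : Filter ℕ),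
      ∫ c, |dispFrom 0 0 (m n) ⌈s n * N⌉₊ c - s n * limDisp β y|
        ∂(arrayLaw (stepRates β N)) ≤ δ * s n := by
  set ε := δ / 8 with hε
  have hε0 : 0 < ε := by positivity
  obtain ⟨η, hη, hcont⟩ := Metric.continuousWithinAt_iff.1 (continuousOn_limDisp hβ y hy) ε hε0
  set y₁ := max (y - η / 2) 0 with hy₁
  set y₂ := y + η / 2 with hy₂
  have hy₁0 : 0 ≤ y₁ := le_max_right _ _
  have hy₂0 : 0 ≤ y₂ := by positivity
  have hD₁ : limDisp β y₁ ≤ limDisp β y + ε := by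
    have h := hcont (x := y₁) hy₁0 (by
      rw [Real.dist_eq, abs_lt]
      constructor
      · have := le_max_left (y - η / 2) 0
        linarith
      · have : y₁ ≤ y := max_le (by linarith) hy
        linarith)
    rw [Real.dist_eq, abs_lt] at h
    linarith
  have hD₂ : limDisp β y - ε ≤ limDisp β y₂ := by
    have h := hcont (x := y₂) hy₂0 (by
      rw [Real.dist_eq, abs_lt]
      constructor <;> linarith)
    rw [Real.dist_eq, abs_lt] at h
    linarith
  have hm₁ : ∀ᶠ n in atTop, y - η / 2 < (m n : ℝ) / s n := hm.eventually (lt_mem_nhds (by linarith))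
  have hm₂ : ∀ᶠ n in atTop, (m n : ℝ) / s n < y₂ := hm.eventually (gt_mem_nhds (by linarith))
  filter_upwards [hs.eventually (eventually_integral_excess_le hβ hy₁0 hε0), hm₁, hm₂,
    hs.eventually (eventually_gt_atTop 0)] with n hn hn₁ hn₂ hs0
  rw [lt_div_iff₀ hs0] at hn₁
  rw [div_lt_iff₀ hs0] at hn₂
  have hfl₁ : ⌊s n * y₁⌋₊ ≤ m n := by
    refine Nat.floor_le_of_le ?_
    rw [hy₁, mul_max_of_nonneg _ _ hs0.le, mul_zero]
    exact max_le (by linarith) (Nat.cast_nonneg _)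
  have hfl₂ : m n ≤ ⌊s n * y₂⌋₊ := Nat.le_floor (by linarith)
  have hlow : s n * limDisp β y₂ ≤ limMean β ⌊s n * y₂⌋₊ (s n) := by
    have := limDisp_le hβ y₂ hs0
    rw [le_div_iff₀ hs0] at this
    linarith
  have hev := (tendsto_limMean hβ ⌊s n * y₂⌋₊ hs0.le).eventually
    (lt_mem_nhds (show limMean β ⌊s n * y₂⌋₊ (s n) - ε * s n < limMean β ⌊s n * y₂⌋₊ (s n) by
      have : 0 < ε * s n := by positivity
      linarith))
  filter_upwards [hn, hev] with N hN hN2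
  have hr := stepRates_lt_top hβ N
  set L := ⌈s n * N⌉₊ with hL
  set x := s n * limDisp β y with hx
  have hmean : s n * limDisp β y₂ - ε * s n ≤ meanDisp (stepRates β N) (m n) L :=
    calc _ ≤ gridMean β N ⌊s n * y₂⌋₊ (s n) := by linarith
      _ ≤ _ := meanDisp_antitone hr hfl₂ _
  have hi := integrable_dispFrom hr 0 0 (m n) L
  have hi₁ := integrable_excess hβ N 0 0 ⌊s n * y₁⌋₊ L (s n * limDisp β y₁)
  have hi₂ : Integrable (fun c => max (dispFrom 0 0 ⌊s n * y₁⌋₊ L c - s n * limDisp β y₁) 0 +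
      s n * ε) (arrayLaw (stepRates β N)) := hi₁.add (integrable_const _)
  have hi₃ : Integrable (fun c => dispFrom 0 0 (m n) L c - x) (arrayLaw (stepRates β N)) :=
    hi.sub (integrable_const _)
  calc _ ≤ ∫ c, (2 * (max (dispFrom 0 0 ⌊s n * y₁⌋₊ L c - s n * limDisp β y₁) 0 + s n * ε) -
        (dispFrom 0 0 (m n) L c - x)) ∂(arrayLaw (stepRates β N)) := by
        refine integral_mono hi₃.abs ((hi₂.const_mul 2).sub hi₃) fun c => ?_
        have h1 : dispFrom 0 0 (m n) L c ≤ dispFrom 0 0 ⌊s n * y₁⌋₊ L c :=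
          Nat.cast_le.2 (disp_antitone_left _ hfl₁ _)
        have h2 := le_max_left (dispFrom 0 0 ⌊s n * y₁⌋₊ L c - s n * limDisp β y₁) 0
        have h3 := le_max_right (dispFrom 0 0 ⌊s n * y₁⌋₊ L c - s n * limDisp β y₁) 0
        have h4 : s n * limDisp β y₁ ≤ x + s n * ε := by
          rw [hx, ← mul_add]
          gcongr
        have h5 : 0 ≤ s n * ε := by positivity
        simp only
        rcases abs_cases (dispFrom 0 0 (m n) L c - x) with h | h <;> rw [h.1] <;> linarith
    _ = 2 * ((∫ c, max (dispFrom 0 0 ⌊s n * y₁⌋₊ L c - s n * limDisp β y₁) 0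
          ∂(arrayLaw (stepRates β N))) + s n * ε) - (meanDisp (stepRates β N) (m n) L - x) := by
        rw [integral_sub (hi₂.const_mul 2) hi₃, integral_const_mul,
          integral_add hi₁ (integrable_const _), integral_sub hi (integrable_const _)]
        simp [integral_dispFrom]
    _ ≤ 2 * (ε * s n + s n * ε) - (s n * limDisp β y₂ - ε * s n - x) := by gcongr
    _ ≤ 2 * (ε * s n + s n * ε) - (s n * (limDisp β y - ε) - ε * s n - x) := by gcongr
    _ = 6 * ε * s n := by rw [hx]; ring
    _ ≤ δ * s n := by rw [hε]; gcongr; linarith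

end Limits

/-! ### Comparison of the step process with its discretization -/

/-- The numbers of epochs in the time steps of length `1 / N`, with particles labelled from right
to left. -/
def gridCounts (D : ℤ → ℕ+ → Set ℝ≥0) (N : ℕ) : CountArray := fun j =>
  (D (-(j.1 : ℤ)) j.2.2 ∩ Set.Ico ((j.2.1 : ℝ≥0) / N) (((j.2.1 + 1 : ℕ) : ℝ≥0) / N)).encard

/-- Two different epochs of particles in `I` fall into the time interval `[a, b)`. -/
def Collision (D : ℤ → ℕ+ → Set ℝ≥0) (I : Finset ℤ) (a b : ℝ≥0) : Prop :=
  ∃ i ∈ I, ∃ i' ∈ I, ∃ k k' τ τ', τ ∈ D i k ∩ Set.Ico a b ∧ τ' ∈ D i' k' ∩ Set.Ico a b ∧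
    ¬ (i = i' ∧ k = k' ∧ τ = τ')

lemma evolution_step_one {D : ℤ → ℕ+ → Set ℝ≥0} (hD : GoodClocks D) (t : ℝ≥0) :
    evolution D stepConfiguration 1 t = Site.infty := by
  have h : IsEvolution D (fun _ => Site.infty) (fun _ _ => Site.infty) :=
    ⟨fun _ => rfl, fun _ _ _ _ _ => rfl, fun i k τ _ => Eventually.of_forall fun s => by
      rw [infty_add_ofInt, infty_add_ofInt, min_self]⟩
  refine (evolution_isEvolution hD stepConfiguration).unique hD h (fun j hj => ?_) t
  rw [stepConfiguration, if_neg (by omega)]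

lemma disp_succ_of_eq_zero {κ : ℕ → ℕ → ℕ} {m L : ℕ} (h : κ m L = 0) :
    disp κ m (L + 1) = disp κ m L :=
  le_antisymm (by simpa [h] using disp_succ_right_le_add κ m L) (disp_le_disp_succ κ m L)

lemma grid_le_grid_succ (l N : ℕ) : (l : ℝ≥0) / N ≤ ((l + 1 : ℕ) : ℝ≥0) / N :=
  div_le_div_of_nonneg_right (Nat.cast_le.2 (Nat.le_succ l)) zero_le

lemma grid_succ_sub_grid (l N : ℕ) :
    ((l + 1 : ℕ) : ℝ≥0) / N - (l : ℝ≥0) / N = (N : ℝ≥0)⁻¹ := by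
  rw [tsub_eq_iff_eq_add_of_le (grid_le_grid_succ l N), Nat.cast_succ, add_div, one_div, add_comm]

/-- If epochs of different particles are separated by the time grid then the parallel update of the
discrete-time process reproduces the step process at grid times. -/
lemma evolution_step_eq_disp {D : ℤ → ℕ+ → Set ℝ≥0} (hD : GoodClocks D) {N : ℕ} (hN : 0 < N)
    (M L : ℕ) (hgrid : ∀ p : ℕ, p ≤ M → ∀ l : ℕ, l ≤ L → ∀ k, (l : ℝ≥0) / N ∉ D (-(p : ℤ)) k)
    (hcol : ∀ l : ℕ, l < L → ¬ Collision D (Finset.Icc (-(M : ℤ)) 0) ((l : ℝ≥0) / N)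
      (((l + 1 : ℕ) : ℝ≥0) / N)) :
    ∀ l ≤ L, ∀ p ≤ M, evolution D stepConfiguration (-(p : ℤ)) ((l : ℝ≥0) / N) =
      Site.ofInt (-(p : ℤ) + (disp (jumps (gridCounts D N)) p l : ℕ)) := by
  have hη := evolution_isEvolution hD stepConfiguration
  set η := evolution D stepConfiguration with hηdef
  have hN' : (0 : ℝ≥0) < N := by exact_mod_cast hN
  intro l
  induction l with
  | zero =>
    intro _ p _
    have : ((0 : ℕ) : ℝ≥0) / N = 0 := by simp
    rw [this, hη.initial, stepConfiguration, if_pos (by omega), disp_zero_right]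
    simp
  | succ l ih =>
    intro hl p hp
    have ih := ih (by omega)
    set a : ℝ≥0 := (l : ℝ≥0) / N with ha
    set b : ℝ≥0 := ((l + 1 : ℕ) : ℝ≥0) / N with hb
    have hab : a < b := by
      rw [ha, hb]
      gcongr
      exact_mod_cast Nat.lt_succ_self l
    have hmem : ∀ p : ℕ, p ≤ M → -(p : ℤ) ∈ Finset.Icc (-(M : ℤ)) 0 := fun p hp => by
      rw [Finset.mem_Icc]; omega
    -- epochs in `(a, b]` lie in `[a, b)`
    have hIco : ∀ p ≤ M, ∀ k, ∀ τ ∈ D (-(p : ℤ)) k, a < τ → τ ≤ b → τ ∈ Set.Ico a b :=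
      fun p hp k τ hτ h1 h2 => ⟨h1.le, lt_of_le_of_ne h2 fun h =>
      hgrid p hp (l + 1) hl k (show b ∈ _ from h ▸ hτ)⟩
    have hcol := hcol l (by omega)
    by_cases hex : ∃ k τ, τ ∈ D (-(p : ℤ)) k ∩ Set.Ico a b
    · obtain ⟨k, τ, hτ⟩ := hex
      have huniq : ∀ p' ≤ M, ∀ k' τ', τ' ∈ D (-(p' : ℤ)) k' ∩ Set.Ico a b →
          p' = p ∧ k' = k ∧ τ' = τ := by
        intro p' hp' k' τ' hτ'
        by_contra hne
        exact hcol ⟨_, hmem p' hp', _, hmem p hp, k', k, τ', τ, hτ', hτ, fun h =>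
          hne ⟨by omega, h.2⟩⟩
      have haτ : a < τ := lt_of_le_of_ne hτ.2.1 fun h =>
        hgrid p hp l (by omega) k (show a ∈ _ from h ▸ hτ.1)
      have hconst : ∀ p' ≤ M, ∀ s, a ≤ s → s < τ → η (-(p' : ℤ)) s = η (-(p' : ℤ)) a := by
        intro p' hp' s has hsτ
        refine hη.constant _ a s has fun k' => Set.eq_empty_of_forall_notMem ?_
        rintro x ⟨hx, hx1, hx2⟩
        have := (huniq p' hp' k' x ⟨hx, hx1.le, (hx2.trans_lt hsτ).trans hτ.2.2⟩).2.2
        exact absurd (this ▸ hx2) (not_le.2 hsτ)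
      have hend : η (-(p : ℤ)) b = η (-(p : ℤ)) τ := by
        refine hη.constant _ τ b hτ.2.2.le fun k' => Set.eq_empty_of_forall_notMem ?_
        rintro x ⟨hx, hx1, hx2⟩
        have := (huniq p hp k' x ⟨hx, hIco p hp k' x hx (haτ.trans hx1) hx2⟩).2.2
        exact absurd hx1 (this ▸ lt_irrefl _)
      have hjl : jumps (gridCounts D N) p l = k := by
        refine (jumpLength_eq_iff _ k).2 ⟨?_, fun k' hk' => ?_⟩
        · exact Set.encard_ne_zero.2 ⟨τ, hτ⟩
        · refine Set.encard_eq_zero.2 (Set.eq_empty_of_forall_notMem fun x hx => ?_)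
          exact absurd hk' ((huniq p hp k' x hx).2.1 ▸ lt_irrefl _)
      have := nhdsLT_neBot_of_pos ((zero_le).trans_lt haτ)
      obtain ⟨s, hs1, hs2⟩ := ((hη.jump _ k τ hτ.1).and (Ioo_mem_nhdsLT haτ)).exists
      rw [hend, hs1, hconst p hp s hs2.1.le hs2.2, ih p hp, ← ofInt_add]
      cases p with
      | zero =>
        have e : -((0 : ℕ) : ℤ) + 1 = 1 := by simp
        rw [e, hηdef, evolution_step_one hD, infty_add_ofInt, min_eq_left (le_infty _),
          disp_zero_succ, hjl]
        congr 1
        push_cast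
        ring
      | succ p =>
        have e : -((p + 1 : ℕ) : ℤ) + 1 = -(p : ℤ) := by push_cast; ring
        rw [e, hconst p (by omega) s hs2.1.le hs2.2, ih p (by omega), ← ofInt_add, ← ofInt_min,
          disp_succ_succ, hjl]
        congr 1
        push_cast
        omega
    · push Not at hex
      have h0 : jumps (gridCounts D N) p l = 0 := by
        refine (jumpLength_eq_zero_iff _).2 fun k => ?_
        exact Set.encard_eq_zero.2 (Set.eq_empty_of_forall_notMem fun x hx => hex k x hx)
      rw [disp_succ_of_eq_zero h0, ← ih p hp]
      refine hη.constant _ a b hab.le fun k => Set.eq_empty_of_forall_notMem ?_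
      rintro x ⟨hx, hx1, hx2⟩
      exact hex k x ⟨hx, hIco p hp k x hx hx1 hx2⟩

/-! ### Almost sure properties of the clocks -/

section Clocks

variable {Ω : Type u} [MeasurableSpace Ω] {β : ℕ+ → ℝ≥0} {D : ℤ → ℕ+ → Ω → Set ℝ≥0}
  {P : Measure Ω}

omit [MeasurableSpace Ω] in
lemma count_eq_zero_iff {N : Ω → Set ℝ≥0} {a b : ℝ≥0} {ω : Ω} :
    count N a b ω = 0 ↔ ∀ τ ∈ N ω, ¬ (a ≤ τ ∧ τ < b) := by
  rw [count, Set.encard_eq_zero, Set.eq_empty_iff_forall_notMem]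
  simp [Set.mem_inter_iff]

lemma IsPoissonProcess.map_count {r : ℝ≥0} {N : Ω → Set ℝ≥0} (h : IsPoissonProcess r N P)
    {a b : ℝ≥0} (hab : a ≤ b) : P.map (count N a b) = countLaw (r * (b - a)) :=
  h.law_count a b hab

lemma IsPoissonProcess.measure_count {r : ℝ≥0} {N : Ω → Set ℝ≥0} (h : IsPoissonProcess r N P)
    {a b : ℝ≥0} (hab : a ≤ b) (s : Set ℕ∞) :
    P {ω | count N a b ω ∈ s} = countLaw (r * (b - a)) s := by
  rw [← h.map_count hab, Measure.map_apply (h.measurable_count a b)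
    (DiscreteMeasurableSpace.forall_measurableSet s)]
  rfl

lemma IsPoissonProcess.measure_count_ne_zero_le {r : ℝ≥0} {N : Ω → Set ℝ≥0}
    (h : IsPoissonProcess r N P) {a b : ℝ≥0} (hab : a ≤ b) :
    P {ω | count N a b ω ≠ 0} ≤ r * (b - a : ℝ≥0) := by
  have := (h.measure_count hab {n | n ≠ 0}).trans_le (countLaw_ne_zero_le _)
  rwa [ENNReal.coe_mul] at this

lemma IsPoissonProcess.ae_notMem {r : ℝ≥0} {N : Ω → Set ℝ≥0} (h : IsPoissonProcess r N P)
    (a : ℝ≥0) : ∀ᵐ ω ∂P, a ∉ N ω := by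
  rw [ae_iff]
  simp only [not_not]
  have hle : ∀ n : ℕ, P {ω | a ∈ N ω} ≤ r * ((n : ℝ≥0∞) + 1)⁻¹ := by
    intro n
    have h1 := h.measure_count_ne_zero_le (a := a) (b := a + ((n : ℝ≥0) + 1)⁻¹) (by simp)
    rw [add_tsub_cancel_left] at h1
    have e : (((((n : ℝ≥0) + 1)⁻¹ : ℝ≥0)) : ℝ≥0∞) = ((n : ℝ≥0∞) + 1)⁻¹ := by
      rw [ENNReal.coe_inv (by positivity)]
      simp
    rw [e] at h1
    refine (measure_mono fun ω hω => ?_).trans h1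
    intro h0
    exact count_eq_zero_iff.1 h0 a hω ⟨le_rfl, lt_add_of_pos_right _ (by positivity)⟩
  have hlim : Tendsto (fun n : ℕ => (r : ℝ≥0∞) * ((n : ℝ≥0∞) + 1)⁻¹) atTop (𝓝 (r * 0)) := by
    refine ENNReal.Tendsto.const_mul ?_ (Or.inr ENNReal.coe_ne_top)
    have := ENNReal.tendsto_inv_nat_nhds_zero.comp (tendsto_add_atTop_nat 1)
    refine this.congr fun n => ?_
    simp
  rw [mul_zero] at hlim
  exact le_antisymm (ge_of_tendsto' hlim hle) zero_le

lemma rateMoment_zero_eq : rateMoment β 0 = ∑' k, (β k : ℝ≥0∞) := by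
  simp [rateMoment]

variable (hβ : rateMoment β 2 < ∞) (hD : IsJumpClocks β D P)

include hD

/-- With small probability some clock of a particle rings in a short time interval. -/
lemma measure_exists_count_le (i : ℤ) {a b : ℝ≥0} (hab : a ≤ b) :
    P {ω | ∃ k, count (D i k) a b ω ≠ 0} ≤ rateMoment β 0 * (b - a : ℝ≥0) := by
  have e : {ω | ∃ k, count (D i k) a b ω ≠ 0} = ⋃ k, {ω | count (D i k) a b ω ≠ 0} := by
    ext; simp
  rw [e, rateMoment_zero_eq, ← ENNReal.tsum_mul_right]
  exact (measure_iUnion_le _).trans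
    (ENNReal.tsum_le_tsum fun k => (hD.poisson i k).measure_count_ne_zero_le hab)

lemma measure_inter_count_le {i i' : ℤ} {k k' : ℕ+} (hne : (i, k) ≠ (i', k')) {a b : ℝ≥0}
    (hab : a ≤ b) : P ({ω | count (D i k) a b ω ≠ 0} ∩ {ω | count (D i' k') a b ω ≠ 0}) ≤
      (β k * (b - a : ℝ≥0)) * (β k' * (b - a : ℝ≥0)) := by
  have hm : ∀ i k, MeasurableSet[pointSigma (D i k)] {ω | count (D i k) a b ω ≠ 0} := by
    intro i k
    have h1 : MeasurableSpace.comap (count (D i k) a b) ⊤ ≤ pointSigma (D i k) :=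
      le_iSup₂_of_le a b le_rfl
    exact h1 _ ⟨{n | n ≠ 0}, trivial, rfl⟩
  have h := (Indep_iff _ _ _).1 (hD.indep.indep hne) _ _ (hm i k) (hm i' k')
  rw [h]
  exact mul_le_mul' ((hD.poisson i k).measure_count_ne_zero_le hab)
    ((hD.poisson i' k').measure_count_ne_zero_le hab)

/-- Collisions in a time interval are quadratically unlikely in its length. -/
lemma measure_collision_le (I : Finset ℤ) {a b : ℝ≥0} (hab : a ≤ b) :
    P {ω | Collision (fun i k => D i k ω) I a b} ≤
      ((I.card : ℝ≥0∞) * rateMoment β 0 * (b - a : ℝ≥0)) ^ 2 := by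
  let S : I × ℕ+ → I × ℕ+ → Set Ω := fun x y =>
    if x = y then {ω | 1 < count (D x.1 x.2) a b ω} else
      {ω | count (D x.1 x.2) a b ω ≠ 0} ∩ {ω | count (D y.1 y.2) a b ω ≠ 0}
  have hS : ∀ x y, P (S x y) ≤ (β x.2 * (b - a : ℝ≥0)) * (β y.2 * (b - a : ℝ≥0)) := by
    intro x y
    by_cases hxy : x = y
    · subst hxy
      simp only [S, if_true]
      have h := ((hD.poisson x.1 x.2).measure_count hab {n | 1 < n}).trans_le
        (countLaw_one_lt_le _)
      rw [ENNReal.coe_mul, sq] at h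
      exact h
    · simp only [S, if_neg hxy]
      refine measure_inter_count_le hD (fun h => hxy ?_) hab
      rw [Prod.mk.injEq] at h
      exact Prod.ext (Subtype.ext h.1) h.2
  have hsub : {ω | Collision (fun i k => D i k ω) I a b} ⊆ ⋃ x, ⋃ y, S x y := by
    rintro ω ⟨i, hi, i', hi', k, k', τ, τ', hτ, hτ', hne⟩
    refine Set.mem_iUnion₂.2 ⟨(⟨i, hi⟩, k), (⟨i', hi'⟩, k'), ?_⟩
    by_cases h : ((⟨i, hi⟩, k) : I × ℕ+) = (⟨i', hi'⟩, k')
    · simp only [Prod.mk.injEq, Subtype.mk.injEq] at h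
      obtain ⟨rfl, rfl⟩ := h
      simp only [S, if_true]
      exact Set.one_lt_encard_iff.2 ⟨τ, τ', hτ, hτ', fun h => hne ⟨rfl, rfl, h⟩⟩
    · simp only [S, if_neg h]
      exact ⟨Set.encard_ne_zero.2 ⟨τ, hτ⟩, Set.encard_ne_zero.2 ⟨τ', hτ'⟩⟩
  have hsum : ∑' x : I × ℕ+, (β x.2 : ℝ≥0∞) = (I.card : ℝ≥0∞) * rateMoment β 0 := by
    rw [ENNReal.tsum_prod']
    simp [rateMoment_zero_eq]
  calc _ ≤ P (⋃ x, ⋃ y, S x y) := measure_mono hsub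
    _ ≤ ∑' x, ∑' y, P (S x y) :=
      (measure_iUnion_le _).trans (ENNReal.tsum_le_tsum fun x => measure_iUnion_le _)
    _ ≤ ∑' x : I × ℕ+, ∑' y : I × ℕ+, ((β x.2 : ℝ≥0∞) * (b - a : ℝ≥0)) * (β y.2 * (b - a : ℝ≥0)) :=
      ENNReal.tsum_le_tsum fun x => ENNReal.tsum_le_tsum fun y => hS x y
    _ = _ := by
      simp only [ENNReal.tsum_mul_left, ENNReal.tsum_mul_right]
      rw [hsum, sq]

lemma measure_exists_collision_le (I : Finset ℤ) (N L : ℕ) :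
    P {ω | ∃ l < L, Collision (fun i k => D i k ω) I ((l : ℝ≥0) / N) (((l + 1 : ℕ) : ℝ≥0) / N)} ≤
      L * ((I.card : ℝ≥0∞) * rateMoment β 0 * ((N : ℝ≥0)⁻¹ : ℝ≥0)) ^ 2 := by
  have e : {ω | ∃ l < L, Collision (fun i k => D i k ω) I ((l : ℝ≥0) / N)
      (((l + 1 : ℕ) : ℝ≥0) / N)} = ⋃ l ∈ Finset.range L, {ω | Collision (fun i k => D i k ω) I
        ((l : ℝ≥0) / N) (((l + 1 : ℕ) : ℝ≥0) / N)} := by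
    ext; simp
  rw [e]
  refine (measure_biUnion_finset_le _ _).trans ?_
  refine (Finset.sum_le_sum fun l _ => measure_collision_le hD I
    (grid_le_grid_succ l N)).trans ?_
  simp only [grid_succ_sub_grid, Finset.sum_const, Finset.card_range, nsmul_eq_mul]
  exact le_rfl

end Clocks

/-! ### Independence on a time grid -/

section Clocks

variable {Ω : Type u} [MeasurableSpace Ω] {β : ℕ+ → ℝ≥0} {D : ℤ → ℕ+ → Ω → Set ℝ≥0}
  {P : Measure Ω}

/-- Independence passes to events that depend on disjoint blocks of independent variables. -/
lemma measure_biInter_of_blocks [IsProbabilityMeasure P] {κ : Type*} {X : ℕ × κ → Ω → ℕ∞}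
    (hXm : ∀ j, Measurable (X j)) (hX : iIndepFun X P) {E : ℕ → Set Ω}
    (hE : ∀ n, MeasurableSet[⨆ k, MeasurableSpace.comap (X (n, k)) ⊤] (E n)) (n : ℕ) :
    P (⋂ j ∈ Finset.range n, E j) = ∏ j ∈ Finset.range n, P (E j) := by
  induction n with
  | zero => simp
  | succ n ih =>
    have hle : ∀ j, MeasurableSpace.comap (X j) ⊤ ≤ ‹MeasurableSpace Ω› := fun j =>
      measurable_iff_comap_le.1 (hXm j)
    have hind := indep_iSup_of_disjoint hle ((iIndepFun_iff_iIndep _ _ _).1 hX)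
      (S := {j : ℕ × κ | j.1 < n}) (T := {j : ℕ × κ | j.1 = n}) (by
        rw [Set.disjoint_left]
        rintro j (h1 : j.1 < n) (h2 : j.1 = n)
        omega)
    have h1 : MeasurableSet[⨆ j ∈ {j : ℕ × κ | j.1 < n}, MeasurableSpace.comap (X j) ⊤]
        (⋂ j ∈ Finset.range n, E j) := by
      refine Finset.measurableSet_biInter _ fun j hj => ?_
      refine (iSup_le fun k => ?_ : (⨆ k, MeasurableSpace.comap (X (j, k)) ⊤) ≤ _) _ (hE j)
      exact le_iSup₂_of_le (f := fun (j : ℕ × κ) (_ : j ∈ {j : ℕ × κ | j.1 < n}) =>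
        MeasurableSpace.comap (X j) ⊤) (j, k) (Finset.mem_range.1 hj) le_rfl
    have h2 : MeasurableSet[⨆ j ∈ {j : ℕ × κ | j.1 = n}, MeasurableSpace.comap (X j) ⊤] (E n) := by
      refine (iSup_le fun k => ?_ : (⨆ k, MeasurableSpace.comap (X (n, k)) ⊤) ≤ _) _ (hE n)
      exact le_iSup₂_of_le (f := fun (j : ℕ × κ) (_ : j ∈ {j : ℕ × κ | j.1 = n}) =>
        MeasurableSpace.comap (X j) ⊤) (n, k) rfl le_rfl
    rw [Finset.prod_range_succ, ← ih, Finset.range_add_one, Finset.set_biInter_insert,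
      Set.inter_comm]
    exact (Indep_iff _ _ _).1 hind _ _ h1 h2

/-- The clock counts in the time steps of a grid. -/
def cellCount (D : ℤ → ℕ+ → Ω → Set ℝ≥0) (N : ℕ) (i : ℤ) (l : ℕ) (k : ℕ+) : Ω → ℕ∞ :=
  count (D i k) ((l : ℝ≥0) / N) (((l + 1 : ℕ) : ℝ≥0) / N)

lemma measurable_cellCount (hD : IsJumpClocks β D P) (N : ℕ) (i : ℤ) (l : ℕ) (k : ℕ+) :
    Measurable (cellCount D N i l k) := (hD.poisson i k).measurable_count _ _

lemma iIndepFun_cellCount [IsProbabilityMeasure P] (hD : IsJumpClocks β D P) (N : ℕ) :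
    iIndepFun (fun j : (ℤ × ℕ+) × ℕ => cellCount D N j.1.1 j.2 j.1.2) P := by
  refine iIndepFun_uncurry' (X := fun (p : ℤ × ℕ+) (l : ℕ) => cellCount D N p.1 l p.2)
    (fun p l => measurable_cellCount hD N p.1 l p.2) ?_ fun p => ?_
  · rw [iIndepFun_iff_iIndep]
    have hle : ∀ p : ℤ × ℕ+, MeasurableSpace.comap (fun ω l => cellCount D N p.1 l p.2 ω)
        MeasurableSpace.pi ≤ pointSigma (D p.1 p.2) := by
      intro p
      rw [MeasurableSpace.pi, MeasurableSpace.comap_iSup]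
      refine iSup_le fun l => ?_
      rw [MeasurableSpace.comap_comp]
      exact le_iSup₂_of_le ((l : ℝ≥0) / N) (((l + 1 : ℕ) : ℝ≥0) / N) le_rfl
    rw [iIndep_iff]
    intro s f hf
    exact (iIndep_iff _ _).1 hD.indep s fun p hp => hle p _ (hf p hp)
  · refine (hD.poisson p.1 p.2).indep_increments (fun l => (l : ℝ≥0) / N) ?_
    exact monotone_nat_of_le_succ fun l => grid_le_grid_succ l N

/-- The clock counts on a time grid form an array of independent Poisson counts. -/
lemma map_gridCounts [IsProbabilityMeasure P] (hD : IsJumpClocks β D P) (N : ℕ) :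
    P.map (fun ω => gridCounts (fun i k => D i k ω) N) = arrayLaw (stepRates β N) := by
  have h := (iIndepFun_cellCount hD N).precomp
    (g := fun j : ℕ × ℕ × ℕ+ => ((-(j.1 : ℤ), j.2.2), j.2.1)) (by
      rintro ⟨p, l, k⟩ ⟨p', l', k'⟩ h
      simp only [Prod.mk.injEq, neg_inj, Nat.cast_inj] at h ⊢
      exact ⟨h.1.1, h.2, h.1.2⟩)
  rw [iIndepFun_iff_map_fun_eq_infinitePi_map fun j => measurable_cellCount hD N _ _ _] at h
  have e : ∀ j : ℕ × ℕ × ℕ+, P.map (cellCount D N (-(j.1 : ℤ)) j.2.1 j.2.2) =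
      countLaw (stepRates β N j.2.2) := by
    intro j
    rw [cellCount, (hD.poisson _ _).map_count (grid_le_grid_succ _ N), grid_succ_sub_grid]
    rfl
  simp only [e] at h
  exact h

lemma measurable_gridCounts (hD : IsJumpClocks β D P) (N : ℕ) :
    Measurable fun ω => gridCounts (fun i k => D i k ω) N :=
  measurable_pi_lambda _ fun _ => measurable_cellCount hD N _ _ _

/-! ### The clocks are almost surely good -/

lemma ae_finite_epochs (hβ : rateMoment β 2 < ∞) (hD : IsJumpClocks β D P) :
    ∀ᵐ ω ∂P, ∀ i T, (epochs (fun k => D i k ω) T).Finite := by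
  have h0 : rateMoment β 0 ≠ ∞ := ((rateMoment_mono β (by omega)).trans_lt hβ).ne
  have key : ∀ (i : ℤ) (n : ℕ), ∀ᵐ ω ∂P, (epochs (fun k => D i k ω) n).Finite := by
    intro i n
    have h1 : ∑' k, P {ω | count (D i k) 0 ((n : ℝ≥0) + 1) ω ≠ 0} ≠ ∞ := by
      refine ne_top_of_le_ne_top ?_ (ENNReal.tsum_le_tsum fun k =>
        (hD.poisson i k).measure_count_ne_zero_le zero_le)
      rw [ENNReal.tsum_mul_right, ← rateMoment_zero_eq]
      exact ENNReal.mul_ne_top h0 ENNReal.coe_ne_top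
    have h2 := measure_limsup_cofinite_eq_zero h1
    have h3 : ∀ k, ∀ᵐ ω ∂P, count (D i k) 0 ((n : ℝ≥0) + 1) ω ≠ ⊤ := fun k => by
      rw [ae_iff]
      simp only [not_not]
      exact ((hD.poisson i k).measure_count zero_le {⊤}).trans (countLaw_top _)
    have h4 : ∀ᵐ ω ∂P, {k | count (D i k) 0 ((n : ℝ≥0) + 1) ω ≠ 0}.Finite := by
      rw [ae_iff]
      convert h2 using 2
      ext ω
      rw [mem_limsup_iff_frequently_mem, Filter.frequently_cofinite_iff_infinite]
      rfl
    filter_upwards [ae_all_iff.2 h3, h4] with ω h3 h4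
    refine (h4.biUnion fun k _ => Set.encard_ne_top_iff.1 (h3 k)).subset ?_
    rintro τ ⟨-, hτ, k, hk⟩
    have hmem : τ ∈ D i k ω ∩ Set.Ico 0 ((n : ℝ≥0) + 1) :=
      ⟨hk, zero_le, hτ.trans_lt (lt_add_one _)⟩
    exact Set.mem_biUnion (show k ∈ {k | count (D i k) 0 ((n : ℝ≥0) + 1) ω ≠ 0} from
      Set.encard_ne_zero.2 ⟨τ, hmem⟩) hmem
  filter_upwards [ae_all_iff.2 fun i => ae_all_iff.2 (key i)] with ω h i T
  obtain ⟨n, hn⟩ := exists_nat_ge T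
  exact (h i n).subset fun τ hτ => ⟨hτ.1, hτ.2.1.trans hn, hτ.2.2⟩

lemma tendsto_const_mul_inv_nat {K : ℝ≥0∞} (hK : K ≠ ∞) :
    Tendsto (fun N : ℕ => K * ((N : ℝ≥0)⁻¹ : ℝ≥0)) atTop (𝓝 0) := by
  have h : Tendsto (fun N : ℕ => (((N : ℝ≥0)⁻¹ : ℝ≥0) : ℝ≥0∞)) atTop (𝓝 ((0 : ℝ≥0) : ℝ≥0∞)) :=
    ENNReal.tendsto_coe.2 (tendsto_inv_atTop_nhds_zero_nat (𝕜 := ℝ≥0))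
  have := ENNReal.Tendsto.const_mul h (Or.inr hK)
  simpa using this

lemma ae_disjoint (hβ : rateMoment β 2 < ∞) (hD : IsJumpClocks β D P) :
    ∀ᵐ ω ∂P, ∀ i k k' τ, τ ∈ D i k ω → τ ∈ D i k' ω → k = k' := by
  have h0 : rateMoment β 0 ≠ ∞ := ((rateMoment_mono β (by omega)).trans_lt hβ).ne
  have key : ∀ (i : ℤ) (T : ℕ), ∀ᵐ ω ∂P, ∀ k k' τ, τ < (T : ℝ≥0) → τ ∈ D i k ω → τ ∈ D i k' ω →
      k = k' := by
    intro i T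
    rw [ae_iff]
    set K : ℝ≥0∞ := T * (rateMoment β 0) ^ 2 with hK
    refine le_antisymm (ge_of_tendsto (tendsto_const_mul_inv_nat (K := K) (by
      rw [hK]; exact ENNReal.mul_ne_top (by simp) (ENNReal.pow_ne_top h0))) ?_) zero_le
    filter_upwards [eventually_gt_atTop 0] with N hN
    have hN' : (0 : ℝ≥0) < N := by exact_mod_cast hN
    refine (measure_mono ?_).trans ((measure_exists_collision_le hD {i} N (T * N)).trans ?_)
    · intro ω hω
      simp only [not_forall] at hω
      obtain ⟨k, k', τ, hτ, h1, h2, hne⟩ := hω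
      have h3 : ((⌊τ * N⌋₊ : ℕ) : ℝ≥0) ≤ τ * N := Nat.floor_le zero_le
      have h4 : τ * N < ((⌊τ * N⌋₊ + 1 : ℕ) : ℝ≥0) := by
        push_cast
        exact Nat.lt_floor_add_one _
      have hcell : τ ∈ Set.Ico ((⌊τ * N⌋₊ : ℝ≥0) / N) (((⌊τ * N⌋₊ + 1 : ℕ) : ℝ≥0) / N) :=
        ⟨(div_le_iff₀ hN').2 h3, (lt_div_iff₀ hN').2 h4⟩
      refine ⟨⌊τ * N⌋₊, ?_, i, by simp, i, by simp, k, k', τ, τ, ⟨h1, hcell⟩, ⟨h2, hcell⟩,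
        fun h => hne h.2.1⟩
      have h5 : ((⌊τ * N⌋₊ : ℕ) : ℝ≥0) < ((T * N : ℕ) : ℝ≥0) := by
        push_cast
        exact h3.trans_lt (by gcongr)
      exact_mod_cast h5
    · simp only [Finset.card_singleton, Nat.cast_one, one_mul, Nat.cast_mul]
      have e : (N : ℝ≥0∞) * ((N : ℝ≥0)⁻¹ : ℝ≥0) = 1 := by
        rw [← ENNReal.coe_natCast, ← ENNReal.coe_mul, mul_inv_cancel₀ hN'.ne', ENNReal.coe_one]
      calc (T : ℝ≥0∞) * N * (rateMoment β 0 * ((N : ℝ≥0)⁻¹ : ℝ≥0)) ^ 2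
          = T * rateMoment β 0 ^ 2 * ((N : ℝ≥0)⁻¹ : ℝ≥0) * (N * ((N : ℝ≥0)⁻¹ : ℝ≥0)) := by ring
        _ ≤ _ := by rw [e, mul_one]
  filter_upwards [ae_all_iff.2 fun i => ae_all_iff.2 (key i)] with ω h i k k' τ
  obtain ⟨n, hn⟩ := exists_nat_gt τ
  exact h i n k k' τ hn

lemma measure_cell_empty_ge [IsProbabilityMeasure P] (hD : IsJumpClocks β D P) {N : ℕ}
    (hN : rateMoment β 0 * ((N : ℝ≥0)⁻¹ : ℝ≥0) ≤ 1 / 2) (i : ℤ) (l : ℕ) :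
    1 / 2 ≤ P {ω | ∀ k, cellCount D N i l k ω = 0} := by
  have h1 := measure_exists_count_le hD i (grid_le_grid_succ l N)
  rw [grid_succ_sub_grid] at h1
  have h2 : P {ω | ∀ k, cellCount D N i l k ω = 0}ᶜ ≤ 1 / 2 := by
    refine le_trans (le_of_eq ?_) (h1.trans hN)
    congr 1
    ext ω
    simp [cellCount]
  have hm : MeasurableSet {ω | ∀ k, cellCount D N i l k ω = 0} := by
    rw [Set.ofPred_forall]
    exact MeasurableSet.iInter fun k => measurableSet_eq_fun (measurable_cellCount hD N i l k)
      measurable_const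
  have h3 := prob_add_prob_compl (μ := P) hm
  by_contra hlt
  rw [not_le] at hlt
  have h4 : P {ω | ∀ k, cellCount D N i l k ω = 0} + P {ω | ∀ k, cellCount D N i l k ω = 0}ᶜ <
      1 / 2 + 1 / 2 := ENNReal.add_lt_add_of_lt_of_le (by
        exact ne_top_of_le_ne_top (by simp) h2) hlt h2
  rw [h3, ENNReal.add_halves] at h4
  exact lt_irrefl _ h4

/-- By independence of the particles, some particle to the right of `i` does not attempt to move up
to time `T`. -/
lemma ae_frozen [IsProbabilityMeasure P] (hβ : rateMoment β 2 < ∞) (hD : IsJumpClocks β D P) :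
    ∀ᵐ ω ∂P, ∀ i T, ∃ m, i ≤ m ∧ epochs (fun k => D m k ω) T = ∅ := by
  have h0 : rateMoment β 0 ≠ ∞ := ((rateMoment_mono β (by omega)).trans_lt hβ).ne
  obtain ⟨N, hN, hN0⟩ : ∃ N : ℕ, rateMoment β 0 * ((N : ℝ≥0)⁻¹ : ℝ≥0) ≤ 1 / 2 ∧ 0 < N :=
    (((tendsto_const_mul_inv_nat h0).eventually (ge_mem_nhds (by norm_num))).and
      (eventually_gt_atTop 0)).exists
  have hN' : (0 : ℝ≥0) < N := by exact_mod_cast hN0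
  have hind := iIndepFun_cellCount hD N
  -- the event that particle `i` does not attempt to move in the first `L` time steps
  let Z : ℤ → ℕ → Set Ω := fun i L => ⋂ l ∈ Finset.range L, {ω | ∀ k, cellCount D N i l k ω = 0}
  have hZ : ∀ i L, ((1 : ℝ≥0∞) / 2) ^ L ≤ P (Z i L) := by
    intro i L
    have h := measure_biInter_of_blocks (P := P)
      (X := fun j : ℕ × ℕ+ => cellCount D N i j.1 j.2)
      (fun j => measurable_cellCount hD N i j.1 j.2)
      (hind.precomp (g := fun j : ℕ × ℕ+ => ((i, j.2), j.1)) (by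
        rintro ⟨l, k⟩ ⟨l', k'⟩ h
        simp only [Prod.mk.injEq] at h ⊢
        exact ⟨h.2, h.1.2⟩))
      (E := fun l => {ω | ∀ k, cellCount D N i l k ω = 0}) (fun l => by
        rw [Set.ofPred_forall]
        refine MeasurableSet.iInter fun k => ?_
        exact (le_iSup (fun k => MeasurableSpace.comap (cellCount D N i l k) ⊤) k) _
          ⟨{0}, trivial, rfl⟩) L
    change _ ≤ P (⋂ l ∈ Finset.range L, {ω | ∀ k, cellCount D N i l k ω = 0})
    rw [h]
    calc ((1 : ℝ≥0∞) / 2) ^ L = ∏ l ∈ Finset.range L, (1 / 2 : ℝ≥0∞) := by simp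
      _ ≤ _ := Finset.prod_le_prod' fun l _ => measure_cell_empty_ge hD hN i l
  have hZm : ∀ i L, MeasurableSet[⨆ j : ℕ × ℕ+, MeasurableSpace.comap (cellCount D N i j.1 j.2) ⊤]
      (Z i L) := by
    intro i L
    refine Finset.measurableSet_biInter _ fun l _ => ?_
    rw [Set.ofPred_forall]
    refine MeasurableSet.iInter fun k => ?_
    exact (le_iSup (fun j : ℕ × ℕ+ => MeasurableSpace.comap (cellCount D N i j.1 j.2) ⊤) (l, k)) _
      ⟨{0}, trivial, rfl⟩
  have hle : ∀ i, (⨆ j : ℕ × ℕ+, MeasurableSpace.comap (cellCount D N i j.1 j.2) ⊤) ≤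
      ‹MeasurableSpace Ω› := fun i => iSup_le fun j =>
        measurable_iff_comap_le.1 (measurable_cellCount hD N i j.1 j.2)
  have key : ∀ (i : ℤ) (L : ℕ), ∀ᵐ ω ∂P, ∃ p : ℕ, ω ∈ Z (i + p) L := by
    intro i L
    rw [ae_iff]
    have hq : (1 : ℝ≥0∞) - (1 / 2) ^ L < 1 :=
      ENNReal.sub_lt_self (by simp) (by simp) (by simp)
    refine le_antisymm (ge_of_tendsto' (ENNReal.tendsto_pow_atTop_nhds_zero_of_lt_one hq)
      fun n => ?_) zero_le
    have h := measure_biInter_of_blocks (P := P) (κ := ℕ × ℕ+)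
      (X := fun j => cellCount D N (i + (j.1 : ℤ)) j.2.1 j.2.2)
      (fun j => measurable_cellCount hD N _ _ _)
      (hind.precomp (g := fun j : ℕ × ℕ × ℕ+ => ((i + (j.1 : ℤ), j.2.2), j.2.1)) (by
        rintro ⟨p, l, k⟩ ⟨p', l', k'⟩ h
        simp only [Prod.mk.injEq] at h ⊢
        exact ⟨by omega, h.2, h.1.2⟩))
      (E := fun p => (Z (i + p) L)ᶜ) (fun p => (hZm (i + p) L).compl) n
    calc P {ω | ¬ ∃ p : ℕ, ω ∈ Z (i + p) L} ≤ P (⋂ j ∈ Finset.range n, (Z (i + j) L)ᶜ) := by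
          refine measure_mono fun ω hω => ?_
          simp only [Set.mem_iInter]
          exact fun p _ hp => hω ⟨p, hp⟩
      _ = ∏ j ∈ Finset.range n, P (Z (i + j) L)ᶜ := h
      _ ≤ ∏ j ∈ Finset.range n, (1 - (1 / 2 : ℝ≥0∞) ^ L) := by
          refine Finset.prod_le_prod' fun j _ => ?_
          rw [prob_compl_eq_one_sub (hle _ _ (hZm _ _))]
          exact tsub_le_tsub_left (hZ _ _) _
      _ = _ := by simp
  filter_upwards [ae_all_iff.2 fun i => ae_all_iff.2 (key i)] with ω h i T
  obtain ⟨L, hL⟩ := exists_nat_gt (T * N)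
  obtain ⟨p, hp⟩ := h i L
  refine ⟨i + p, by omega, Set.eq_empty_of_forall_notMem ?_⟩
  rintro τ ⟨-, hτ, k, hk⟩
  have h3 : ((⌊τ * N⌋₊ : ℕ) : ℝ≥0) ≤ τ * N := Nat.floor_le zero_le
  have h4 : τ * N < ((⌊τ * N⌋₊ + 1 : ℕ) : ℝ≥0) := by
    push_cast
    exact Nat.lt_floor_add_one _
  have h5 : ⌊τ * N⌋₊ < L := by
    have : ((⌊τ * N⌋₊ : ℕ) : ℝ≥0) < (L : ℝ≥0) := (h3.trans (by gcongr)).trans_lt hL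
    exact_mod_cast this
  simp only [Z, Set.mem_iInter] at hp
  have h6 := hp ⌊τ * N⌋₊ (Finset.mem_range.2 h5) k
  exact count_eq_zero_iff.1 h6 τ hk ⟨(div_le_iff₀ hN').2 h3, (lt_div_iff₀ hN').2 h4⟩

lemma ae_goodClocks [IsProbabilityMeasure P] (hβ : rateMoment β 2 < ∞)
    (hD : IsJumpClocks β D P) : ∀ᵐ ω ∂P, GoodClocks fun i k => D i k ω := by
  filter_upwards [ae_finite_epochs hβ hD, ae_disjoint hβ hD, ae_frozen hβ hD] with ω h1 h2 h3
  exact ⟨h1, h2, h3⟩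

/-! ### Convergence of the discretization -/

/-- The location of particle `-m` in the discretized step process at time `t`. -/
def gridStep (D : ℤ → ℕ+ → Ω → Set ℝ≥0) (N m : ℕ) (t : ℝ≥0) (ω : Ω) : ℤ :=
  -(m : ℤ) + (disp (jumps (gridCounts (fun i k => D i k ω) N)) m ⌈(t : ℝ) * N⌉₊ : ℕ)

lemma tendsto_measure_step_ne [IsProbabilityMeasure P] (hβ : rateMoment β 2 < ∞)
    (hD : IsJumpClocks β D P) (m : ℕ) (t : ℝ≥0) :
    Tendsto (fun N : ℕ => P {ω | process D (fun _ => stepConfiguration) (-(m : ℤ)) t ω ≠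
      Site.ofInt (gridStep D N m t ω)}) atTop (𝓝 0) := by
  have h0 : rateMoment β 0 ≠ ∞ := ((rateMoment_mono β (by omega)).trans_lt hβ).ne
  set I : Finset ℤ := Finset.Icc (-(m : ℤ)) 0 with hI
  set K : ℝ≥0∞ := ((t + 1 : ℝ≥0) : ℝ≥0∞) * (I.card * rateMoment β 0) ^ 2 + rateMoment β 0 * 2
    with hK
  have hKtop : K ≠ ∞ := by
    rw [hK]
    refine ENNReal.add_ne_top.2 ⟨ENNReal.mul_ne_top ENNReal.coe_ne_top
      (ENNReal.pow_ne_top (ENNReal.mul_ne_top (by simp) h0)), ENNReal.mul_ne_top h0 (by simp)⟩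
  refine tendsto_of_tendsto_of_tendsto_of_le_of_le' tendsto_const_nhds
    (tendsto_const_mul_inv_nat hKtop) (Eventually.of_forall fun _ => zero_le) ?_
  filter_upwards [eventually_gt_atTop 0] with N hN
  have hN' : (0 : ℝ≥0) < N := by exact_mod_cast hN
  set L := ⌈(t : ℝ) * N⌉₊ with hL
  have hL1 : t ≤ (L : ℝ≥0) / N := by
    rw [le_div_iff₀ hN', ← NNReal.coe_le_coe]
    push_cast
    exact Nat.le_ceil _
  have hL2 : (L : ℝ≥0) < t * N + 1 := by
    rw [← NNReal.coe_lt_coe]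
    push_cast
    exact Nat.ceil_lt_add_one (by positivity)
  have hL3 : (L : ℝ≥0) / N < t + 2 * (N : ℝ≥0)⁻¹ := by
    rw [div_lt_iff₀ hN', add_mul, mul_assoc, inv_mul_cancel₀ hN'.ne', mul_one]
    exact hL2.trans (by gcongr; norm_num)
  have hgrid : ∀ᵐ ω ∂P, ∀ (i : ℤ) (l : ℕ) (k : ℕ+), (l : ℝ≥0) / N ∉ D i k ω := by
    simp only [ae_all_iff]
    exact fun i l k => (hD.poisson i k).ae_notMem _
  set A := {ω | ∃ l < L, Collision (fun i k => D i k ω) I ((l : ℝ≥0) / N)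
    (((l + 1 : ℕ) : ℝ≥0) / N)} with hA
  set B := {ω | ∃ k, count (D (-(m : ℤ)) k) t (t + 2 * (N : ℝ≥0)⁻¹) ω ≠ 0} with hB
  have hae : {ω | process D (fun _ => stepConfiguration) (-(m : ℤ)) t ω ≠
      Site.ofInt (gridStep D N m t ω)} ≤ᵐ[P] (A ∪ B : Set Ω) := by
    filter_upwards [ae_goodClocks hβ hD, hgrid] with ω hgood hg hne
    by_contra hAB
    have hAB' : ω ∉ A ∪ B := hAB
    rw [Set.mem_union, not_or] at hAB'
    refine hne ?_
    have h1 := evolution_step_eq_disp hgood hN m L (fun p _ l _ k => hg _ l k)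
      (fun l hl hc => hAB'.1 ⟨l, hl, hc⟩) L le_rfl m le_rfl
    rw [gridStep, ← hL, ← h1, process]
    refine ((evolution_isEvolution hgood stepConfiguration).constant _ _ _ hL1 fun k =>
      Set.eq_empty_of_forall_notMem ?_).symm
    rintro x ⟨hx, hx1, hx2⟩
    refine hAB'.2 ⟨k, fun h => ?_⟩
    exact count_eq_zero_iff.1 h x hx ⟨hx1.le, hx2.trans_lt hL3⟩
  have hPA := measure_exists_collision_le hD I N L
  have hPB := measure_exists_count_le hD (-(m : ℤ)) (a := t) (b := t + 2 * (N : ℝ≥0)⁻¹) (by simp)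
  rw [add_tsub_cancel_left] at hPB
  have e : (N : ℝ≥0∞) * ((N : ℝ≥0)⁻¹ : ℝ≥0) = 1 := by
    rw [← ENNReal.coe_natCast, ← ENNReal.coe_mul, mul_inv_cancel₀ hN'.ne', ENNReal.coe_one]
  have hLN : (L : ℝ≥0∞) ≤ ((t + 1 : ℝ≥0) : ℝ≥0∞) * N := by
    rw [← ENNReal.coe_natCast, ← ENNReal.coe_natCast, ← ENNReal.coe_mul, ENNReal.coe_le_coe]
    refine hL2.le.trans ?_
    rw [add_mul, one_mul]
    gcongr
    exact_mod_cast hN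
  calc _ ≤ P (A ∪ B) := measure_mono_ae hae
    _ ≤ P A + P B := measure_union_le _ _
    _ ≤ L * ((I.card : ℝ≥0∞) * rateMoment β 0 * ((N : ℝ≥0)⁻¹ : ℝ≥0)) ^ 2 +
        rateMoment β 0 * (2 * (N : ℝ≥0)⁻¹ : ℝ≥0) := add_le_add hPA hPB
    _ ≤ ((t + 1 : ℝ≥0) : ℝ≥0∞) * N * ((I.card : ℝ≥0∞) * rateMoment β 0 *
          ((N : ℝ≥0)⁻¹ : ℝ≥0)) ^ 2 + rateMoment β 0 * (2 * (N : ℝ≥0)⁻¹ : ℝ≥0) := by gcongr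
    _ = ((t + 1 : ℝ≥0) : ℝ≥0∞) * ((I.card : ℝ≥0∞) * rateMoment β 0) ^ 2 *
          ((N : ℝ≥0)⁻¹ : ℝ≥0) * (N * ((N : ℝ≥0)⁻¹ : ℝ≥0)) +
          rateMoment β 0 * 2 * ((N : ℝ≥0)⁻¹ : ℝ≥0) := by
        rw [ENNReal.coe_mul]
        push_cast
        ring
    _ = K * ((N : ℝ≥0)⁻¹ : ℝ≥0) := by rw [e, mul_one, hK, add_mul]

end Clocks

/-! ### Convergence in probability of scaled locations -/

/-- The location `X` is finite and at distance less than `r` from `a`. -/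
def Near (X : Site) (a r : ℝ) : Prop := ∃ z : ℤ, X = Site.ofInt z ∧ |(z : ℝ) - a| < r

lemma ofReal_le_abs_iff (X : Site) (a r : ℝ) :
    ENNReal.ofReal r ≤ EReal.abs (Site.toEReal X - (a : EReal)) ↔ ¬ Near X a r := by
  induction X using WithBot.recBotCoe with
  | bot =>
    have e : Site.toEReal ⊥ = ⊥ := rfl
    rw [e, EReal.bot_sub, EReal.abs_bot]
    simp only [le_top, true_iff]
    rintro ⟨z, hz, -⟩
    exact WithBot.bot_ne_coe hz
  | coe X =>
    induction X using WithTop.recTopCoe with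
    | top =>
      have e : Site.toEReal ((⊤ : WithTop ℤ) : WithBot (WithTop ℤ)) = ⊤ := rfl
      rw [e, EReal.top_sub_coe, EReal.abs_top]
      simp only [le_top, true_iff]
      rintro ⟨z, hz, -⟩
      exact WithTop.top_ne_coe (WithBot.coe_injective hz)
    | coe z =>
      have e : Site.toEReal (((z : ℤ) : WithTop ℤ) : WithBot (WithTop ℤ)) = ((z : ℝ) : EReal) := rfl
      rw [e, ← EReal.coe_sub, EReal.abs_def]
      have hN : Near (((z : ℤ) : WithTop ℤ) : WithBot (WithTop ℤ)) a r ↔ |(z : ℝ) - a| < r := by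
        constructor
        · rintro ⟨z', hz', h⟩
          obtain rfl : z = z' := WithTop.coe_injective (WithBot.coe_injective hz')
          exact h
        · exact fun h => ⟨z, rfl, h⟩
      rw [hN, not_lt, ENNReal.ofReal_le_ofReal_iff (abs_nonneg _)]

lemma scaledTendstoInProb_iff {Ω : ℕ → Type*} [∀ n, MeasurableSpace (Ω n)]
    {P : ∀ n, Measure (Ω n)} {X : ∀ n, Ω n → Site} {c : ℝ} :
    ScaledTendstoInProb P X c ↔ ∀ ε : ℝ, 0 < ε →
      Tendsto (fun n : ℕ => P n {ω | ¬ Near (X n ω) (n * c) (n * ε)}) atTop (𝓝 0) := by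
  simp only [ScaledTendstoInProb, ofReal_le_abs_iff]

lemma Near.mono {X : Site} {a a' r r' : ℝ} (h : Near X a r) (hle : r + |a - a'| ≤ r') :
    Near X a' r' := by
  obtain ⟨z, rfl, hz⟩ := h
  refine ⟨z, rfl, ?_⟩
  have e : (z : ℝ) - a' = (z - a) + (a - a') := by ring
  rw [e]
  exact (abs_add_le _ _).trans_lt (by linarith)

/-! ### Law of large numbers for the step process -/

/-- The limit shape: initial location plus limiting displacement. -/
def limShape (β : ℕ+ → ℝ≥0) (x : ℝ) : ℝ := x + limDisp β (-x)

section Step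

variable {β : ℕ+ → ℝ≥0} (hβ : rateMoment β 2 < ∞) {Ω : ℕ → Type u} [∀ n, MeasurableSpace (Ω n)]
  {P : ∀ n, Measure (Ω n)} [∀ n, IsProbabilityMeasure (P n)]
  {D : ∀ n, ℤ → ℕ+ → Ω n → Set ℝ≥0} (hD : ∀ n, IsJumpClocks β (D n) (P n))

include hβ hD

lemma tendsto_measure_step_not_near {y : ℝ} (hy : 0 ≤ y) {t : ℝ≥0} (ht : 0 < t) {m : ℕ → ℕ}
    (hm : Tendsto (fun n => (m n : ℝ) / n) atTop (𝓝 y)) {ε : ℝ} (hε : 0 < ε) :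
    Tendsto (fun n : ℕ => P n {ω | ¬ Near (process (D n) (fun _ => stepConfiguration) (-(m n : ℤ))
      ((n : ℝ≥0) * t) ω) (n * (t * limShape β (-y / t))) (n * ε)}) atTop (𝓝 0) := by
  have ht' : (0 : ℝ) < t := by exact_mod_cast ht
  have hs : Tendsto (fun n : ℕ => (n : ℝ) * t) atTop atTop :=
    tendsto_natCast_atTop_atTop.atTop_mul_const ht'
  have hms : Tendsto (fun n : ℕ => (m n : ℝ) / (n * t)) atTop (𝓝 (y / t)) := by
    simpa only [div_div] using hm.div_const (t : ℝ)
  have hc : (t : ℝ) * limShape β (-y / t) = -y + t * limDisp β (y / t) := by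
    rw [limShape, neg_div, neg_neg]
    field_simp
  rw [ENNReal.tendsto_nhds_zero]
  intro δ hδ
  wlog hδtop : δ ≠ ∞ generalizing δ
  · rw [not_not] at hδtop
    rw [hδtop]
    exact Eventually.of_forall fun _ => le_top
  set d := δ.toReal with hd
  have hd0 : 0 < d := ENNReal.toReal_pos hδ.ne' hδtop
  have hm2 : ∀ᶠ n : ℕ in atTop, |(m n : ℝ) / n - y| < ε / 2 := by
    have := Metric.tendsto_nhds.1 hm (ε / 2) (by positivity)
    simpa [Real.dist_eq] using this
  filter_upwards [eventually_integral_abs_le hβ (div_nonneg hy ht'.le) hs hms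
    (show 0 < d * ε / (4 * t) by positivity), hm2, eventually_gt_atTop 0] with n hn hn2 hn0
  have hn' : (0 : ℝ) < n := by exact_mod_cast hn0
  have hgrid := (tendsto_measure_step_ne hβ (hD n) (m n) ((n : ℝ≥0) * t)).eventually
    (ge_mem_nhds (show (0 : ℝ≥0∞) < δ / 2 from ENNReal.half_pos hδ.ne'))
  obtain ⟨N, hN1, hN2⟩ := (hn.and (Nat.hyperfilter_le_atTop hgrid)).exists
  set x := (n : ℝ) * t * limDisp β (y / t) with hx
  set Y : CountArray → ℝ := fun c => |dispFrom 0 0 (m n) ⌈(n : ℝ) * t * N⌉₊ c - x| with hY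
  have hYm : Measurable Y := ((measurable_dispFrom _ _ _ _).sub_const x).abs
  have hYi : Integrable Y (arrayLaw (stepRates β N)) :=
    ((integrable_dispFrom (stepRates_lt_top hβ N) _ _ _ _).sub (integrable_const x)).abs
  have hmarkov : (arrayLaw (stepRates β N)) {c | n * (ε / 2) ≤ Y c} ≤ δ / 2 := by
    have h := mul_meas_ge_le_integral_of_nonneg (μ := arrayLaw (stepRates β N))
      (Eventually.of_forall fun c => abs_nonneg _ : 0 ≤ᵐ[_] Y) hYi (n * (ε / 2))
    have h1 : (n : ℝ) * (ε / 2) * (arrayLaw (stepRates β N)).real {c | n * (ε / 2) ≤ Y c} ≤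
        n * (ε / 2) * (d / 2) := by
      refine (h.trans hN1).trans (le_of_eq ?_)
      field_simp
      ring
    have h2 := le_of_mul_le_mul_left h1 (by positivity)
    rw [← ENNReal.ofReal_toReal hδtop, ← hd, show (2 : ℝ≥0∞) = ENNReal.ofReal 2 by simp,
      ← ENNReal.ofReal_div_of_pos two_pos, ← ofReal_measureReal]
    exact ENNReal.ofReal_le_ofReal h2
  have hmap : P n {ω | n * (ε / 2) ≤ Y (gridCounts (fun i k => D n i k ω) N)} =
      (arrayLaw (stepRates β N)) {c | n * (ε / 2) ≤ Y c} := by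
    rw [← map_gridCounts (hD n) N, Measure.map_apply (measurable_gridCounts (hD n) N)
      (measurableSet_le measurable_const hYm)]
    rfl
  calc _ ≤ P n ({ω | process (D n) (fun _ => stepConfiguration) (-(m n : ℤ)) ((n : ℝ≥0) * t) ω ≠
        Site.ofInt (gridStep (D n) N (m n) ((n : ℝ≥0) * t) ω)} ∪
        {ω | n * (ε / 2) ≤ Y (gridCounts (fun i k => D n i k ω) N)}) := by
        refine measure_mono fun ω hω => ?_
        by_contra hcon
        rw [Set.mem_union, not_or] at hcon
        obtain ⟨h1, h2⟩ := hcon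
        refine hω ?_
        have h1' : process (D n) (fun _ => stepConfiguration) (-(m n : ℤ)) ((n : ℝ≥0) * t) ω =
          Site.ofInt (gridStep (D n) N (m n) ((n : ℝ≥0) * t) ω) := not_not.1 h1
        have h2' : Y (gridCounts (fun i k => D n i k ω) N) < n * (ε / 2) := not_le.1 h2
        rw [h1']
        have hnear : Near (Site.ofInt (gridStep (D n) N (m n) ((n : ℝ≥0) * t) ω))
            (-(m n : ℝ) + x) (n * (ε / 2)) := by
          refine ⟨_, rfl, lt_of_le_of_lt (le_of_eq ?_) h2'⟩
          simp only [hY, gridStep, dispFrom]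
          push_cast
          congr 1
          have e : shiftJumps (jumps (gridCounts (fun i k => D n i k ω) N)) 0 0 =
            jumps (gridCounts (fun i k => D n i k ω) N) := rfl
          rw [e]
          ring
        refine hnear.mono ?_
        have e : -(m n : ℝ) + x - n * (t * limShape β (-y / t)) = -(n * ((m n : ℝ) / n - y)) := by
          rw [hc, hx]
          field_simp
          ring
        rw [e, abs_neg, abs_mul, abs_of_pos hn']
        nlinarith
    _ ≤ δ / 2 + δ / 2 := (measure_union_le _ _).trans (add_le_add hN2 (hmap.trans_le hmarkov))
    _ = δ := ENNReal.add_halves δ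

end Step

lemma tendsto_floor_mul_div (x : ℝ) :
    Tendsto (fun n : ℕ => (⌊(n : ℝ) * x⌋ : ℝ) / n) atTop (𝓝 x) := by
  have h1 : Tendsto (fun n : ℕ => x - 1 / (n : ℝ)) atTop (𝓝 x) := by
    simpa using (tendsto_const_nhds (x := x)).sub (tendsto_const_div_atTop_nhds_zero_nat (1 : ℝ))
  refine tendsto_of_tendsto_of_tendsto_of_le_of_le' h1 tendsto_const_nhds ?_ ?_
  · filter_upwards [eventually_gt_atTop 0] with n hn
    have hn' : (0 : ℝ) < n := by exact_mod_cast hn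
    rw [le_div_iff₀ hn', sub_mul, div_mul_cancel₀ _ hn'.ne', mul_comm x]
    exact (Int.sub_one_lt_floor _).le
  · filter_upwards [eventually_gt_atTop 0] with n hn
    have hn' : (0 : ℝ) < n := by exact_mod_cast hn
    rw [div_le_iff₀ hn', mul_comm x]
    exact Int.floor_le _

/-! ### The limit shape -/

section Shape

variable {β : ℕ+ → ℝ≥0} (hβ : rateMoment β 2 < ∞)
include hβ

lemma isLimitShape_limShape : IsLimitShape.{u} β (limShape β) := by
  intro Ω _ P _ D hD x t hx ht
  rw [scaledTendstoInProb_iff]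
  intro ε hε
  have hm : ∀ n : ℕ, -((((-⌊(n : ℝ) * x⌋).toNat : ℕ)) : ℤ) = ⌊(n : ℝ) * x⌋ := by
    intro n
    have : ⌊(n : ℝ) * x⌋ ≤ 0 := by
      have : (n : ℝ) * x ≤ 0 := mul_nonpos_of_nonneg_of_nonpos (Nat.cast_nonneg _) hx
      exact_mod_cast (Int.floor_le _).trans this
    omega
  have hlim : Tendsto (fun n : ℕ => (((-⌊(n : ℝ) * x⌋).toNat : ℕ) : ℝ) / n) atTop (𝓝 (-x)) := by
    refine (tendsto_floor_mul_div x).neg.congr fun n => ?_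
    have h : ((((-⌊(n : ℝ) * x⌋).toNat : ℕ) : ℤ) : ℝ) = ((-⌊(n : ℝ) * x⌋ : ℤ) : ℝ) := by
      rw [← hm n]; simp
    rw [Int.cast_natCast] at h
    rw [h, ← neg_div]
    push_cast
    rfl
  have h := tendsto_measure_step_not_near hβ (Ω := fun _ => Ω) (P := fun _ => P)
    (D := fun _ => D) (fun _ => hD) (neg_nonneg.2 hx) ht hlim hε
  simp only [hm, neg_neg] at h
  exact h

lemma convexOn_limShape : ConvexOn ℝ (Set.Iic 0) (limShape β) := by
  have h := (convexOn_limDisp hβ).comp_linearMap (-LinearMap.id : ℝ →ₗ[ℝ] ℝ)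
  have e : (-LinearMap.id : ℝ →ₗ[ℝ] ℝ) ⁻¹' Set.Ici 0 = Set.Iic 0 := by
    ext x
    simp
  rw [e] at h
  exact (convexOn_id (convex_Iic 0)).add h

lemma continuousOn_limShape : ContinuousOn (limShape β) (Set.Iic 0) :=
  continuousOn_id.add ((continuousOn_limDisp hβ).comp continuous_neg.continuousOn fun _ hx =>
    Set.mem_Ici.2 (neg_nonneg.2 (Set.mem_Iic.1 hx)))

lemma le_limShape (x : ℝ) : x ≤ limShape β x :=
  le_add_of_nonneg_right (limDisp_nonneg hβ _)

end Shape

/-! ### Hydrodynamic limit -/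

lemma IsJumpClocks.shift {Ω : Type u} [MeasurableSpace Ω] {P : Measure Ω} {β : ℕ+ → ℝ≥0}
    {D : ℤ → ℕ+ → Ω → Set ℝ≥0} (hD : IsJumpClocks β D P) (j : ℤ) :
    IsJumpClocks β (fun i => D (i + j)) P where
  poisson i k := hD.poisson (i + j) k
  indep := by
    have hinj : Function.Injective (fun p : ℤ × ℕ+ => (p.1 + j, p.2)) := by
      rintro ⟨a, k⟩ ⟨b, k'⟩ h
      simp only [Prod.mk.injEq] at h ⊢
      exact ⟨by omega, h.2⟩
    exact iIndep.precomp (g := fun p : ℤ × ℕ+ => (p.1 + j, p.2))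
      (m := fun p : ℤ × ℕ+ => pointSigma (D p.1 p.2)) hinj hD.indep

lemma exists_ofInt_of_le_of_le {X : Site} {a b : ℤ} (ha : Site.ofInt a ≤ X) (hb : X ≤ Site.ofInt b) :
    ∃ z : ℤ, X = Site.ofInt z ∧ a ≤ z ∧ z ≤ b := by
  induction X using WithBot.recBotCoe with
  | bot => exact absurd ha (not_le.2 (WithBot.bot_lt_coe _))
  | coe X =>
    induction X using WithTop.recTopCoe with
    | top => exact absurd (WithBot.coe_le_coe.1 hb) (not_le.2 (WithTop.coe_lt_top b))
    | coe z => exact ⟨z, rfl, ofInt_le.1 ha, ofInt_le.1 hb⟩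

section Hydrodynamic

variable {β : ℕ+ → ℝ≥0} (hβ : rateMoment β 2 < ∞) {Ω : ℕ → Type u} [∀ n, MeasurableSpace (Ω n)]
  {P : ∀ n, Measure (Ω n)} [∀ n, IsProbabilityMeasure (P n)]
  {D : ∀ n, ℤ → ℕ+ → Ω n → Set ℝ≥0} (hD : ∀ n, IsJumpClocks β (D n) (P n))
  {σ₀ : ∀ n, Ω n → ℤ → Site} (hσ : ∀ n, ∀ᵐ ω ∂(P n), IsConfiguration (σ₀ n ω))
  {u₀ : ℝ → ℝ} (hu : ∀ y : ℝ, ScaledTendstoInProb P (fun n ω => σ₀ n ω ⌊(n : ℝ) * y⌋) (u₀ y))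

include hσ hu in
/-- By the exclusion rule the limiting profile has slope at least `1`. -/
lemma sub_le_profile_sub {x y : ℝ} (hxy : x ≤ y) : y - x ≤ u₀ y - u₀ x := by
  refine le_of_forall_pos_le_add fun ε hε => ?_
  have hx := scaledTendstoInProb_iff.1 (hu x) (ε / 4) (by positivity)
  have hy := scaledTendstoInProb_iff.1 (hu y) (ε / 4) (by positivity)
  have hxy0 := hx.add hy
  rw [add_zero] at hxy0
  obtain ⟨n, ⟨hn, hn1⟩, hn0⟩ := ((hxy0.eventually (gt_mem_nhds one_pos)).and
    (tendsto_natCast_atTop_atTop.eventually (eventually_ge_atTop (2 / ε)))|>.and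
    (eventually_gt_atTop 0)).exists
  have hn' : (0 : ℝ) < n := by exact_mod_cast hn0
  obtain ⟨ω, hω1, hω2, hω3⟩ : ∃ ω, Near (σ₀ n ω ⌊(n : ℝ) * x⌋) (n * u₀ x) (n * (ε / 4)) ∧
      Near (σ₀ n ω ⌊(n : ℝ) * y⌋) (n * u₀ y) (n * (ε / 4)) ∧ IsConfiguration (σ₀ n ω) := by
    by_contra hcon
    push Not at hcon
    have h1 : P n Set.univ ≤
        P n {ω | ¬ Near (σ₀ n ω ⌊(n : ℝ) * x⌋) (n * u₀ x) (n * (ε / 4))} +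
        P n {ω | ¬ Near (σ₀ n ω ⌊(n : ℝ) * y⌋) (n * u₀ y) (n * (ε / 4))} := by
      refine le_trans (measure_mono_ae ?_) (measure_union_le _ _)
      filter_upwards [hσ n] with ω hω _
      by_contra h
      have h' := not_or.1 h
      exact hcon ω (not_not.1 h'.1) (not_not.1 h'.2) hω
    rw [measure_univ] at h1
    exact absurd hn (not_lt.2 h1)
  obtain ⟨a, ha, ha'⟩ := hω1
  obtain ⟨b, hb, hb'⟩ := hω2
  have h := hω3.add_le (show ⌊(n : ℝ) * x⌋ ≤ ⌊(n : ℝ) * y⌋ from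
    Int.floor_le_floor (by gcongr))
  rw [ha, hb, ← ofInt_add, ofInt_le] at h
  have h' : (a : ℝ) + (⌊(n : ℝ) * y⌋ - ⌊(n : ℝ) * x⌋) ≤ b := by exact_mod_cast h
  rw [abs_lt] at ha' hb'
  have h1 := Int.floor_le ((n : ℝ) * x)
  have h2 := Int.lt_floor_add_one ((n : ℝ) * y)
  rw [div_le_iff₀ hε] at hn1
  have h3 : n * (y - x) ≤ n * (u₀ y - u₀ x + ε) := by nlinarith
  exact le_of_mul_le_mul_left h3 hn'

include hβ hσ hu in
lemma le_hopfLaxValues {x : ℝ} {t : ℝ≥0} (ht : 0 < t) :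
    u₀ x ∈ lowerBounds (hopfLaxValues u₀ (limShape β) x t) := by
  rintro _ ⟨y, hy, rfl⟩
  have ht' : (0 : ℝ) < t := by exact_mod_cast ht
  have h1 := sub_le_profile_sub hσ hu hy
  have h2 : (t : ℝ) * ((x - y) / t) ≤ t * limShape β ((x - y) / t) := by
    gcongr
    exact le_limShape hβ _
  rw [mul_div_cancel₀ _ ht'.ne'] at h2
  linarith

include hβ hD hu in
/-- The initial location of the particle `[ny]`, and the location of particle `[nx]` in the process
started from the step configuration at `[ny]`, are close to their limits with high probability. -/
lemma tendsto_measure_not_near_or {x y : ℝ} (hxy : x ≤ y) {t : ℝ≥0} (ht : 0 < t) {ε : ℝ}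
    (hε : 0 < ε) :
    Tendsto (fun n : ℕ => P n {ω | ¬ (Near (σ₀ n ω ⌊(n : ℝ) * y⌋) (n * u₀ y) (n * ε) ∧
      Near (evolution (fun i k => D n i k ω) (stepAt ⌊(n : ℝ) * y⌋) ⌊(n : ℝ) * x⌋ ((n : ℝ≥0) * t))
        (n * (t * limShape β ((x - y) / t))) (n * ε))}) atTop (𝓝 0) := by
  have h1 := scaledTendstoInProb_iff.1 (hu y) ε hε
  have hle : ∀ n : ℕ, ⌊(n : ℝ) * x⌋ ≤ ⌊(n : ℝ) * y⌋ := fun n =>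
    Int.floor_le_floor (by gcongr)
  have hm : ∀ n : ℕ, -((((⌊(n : ℝ) * y⌋ - ⌊(n : ℝ) * x⌋).toNat : ℕ)) : ℤ) =
      ⌊(n : ℝ) * x⌋ - ⌊(n : ℝ) * y⌋ := fun n => by
    have := hle n
    omega
  have hlim : Tendsto (fun n : ℕ => (((⌊(n : ℝ) * y⌋ - ⌊(n : ℝ) * x⌋).toNat : ℕ) : ℝ) / n) atTop
      (𝓝 (y - x)) := by
    refine ((tendsto_floor_mul_div y).sub (tendsto_floor_mul_div x)).congr fun n => ?_
    have h : ((((⌊(n : ℝ) * y⌋ - ⌊(n : ℝ) * x⌋).toNat : ℕ) : ℤ) : ℝ) =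
        ((⌊(n : ℝ) * y⌋ - ⌊(n : ℝ) * x⌋ : ℤ) : ℝ) := by
      congr 1
      have := hle n
      omega
    rw [Int.cast_natCast] at h
    rw [h, ← sub_div]
    push_cast
    rfl
  have h2 := tendsto_measure_step_not_near hβ (fun n => (hD n).shift ⌊(n : ℝ) * y⌋)
    (sub_nonneg.2 hxy) ht hlim hε
  have h3 := h1.add h2
  rw [add_zero] at h3
  refine tendsto_of_tendsto_of_tendsto_of_le_of_le tendsto_const_nhds h3 (fun _ => zero_le) fun n => ?_
  refine le_trans (measure_mono_ae ?_) (measure_union_le _ _)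
  filter_upwards [ae_goodClocks hβ (hD n)] with ω hω hne
  rcases not_and_or.1 hne with h | h
  · exact Or.inl h
  · refine Or.inr fun hnear => h ?_
    rw [evolution_shift hω]
    simp only [process, hm, neg_sub] at hnear
    exact hnear

include hβ hD hσ hu in
lemma tendsto_hopfLax (x : ℝ) {t : ℝ≥0} (ht : 0 < t) :
    ScaledTendstoInProb P
      (fun n => process (D n) (σ₀ n) ⌊(n : ℝ) * x⌋ ((n : ℝ≥0) * t))
      (hopfLax u₀ (limShape β) x t) := by
  have ht' : (0 : ℝ) < t := by exact_mod_cast ht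
  rw [scaledTendstoInProb_iff]
  intro ε' hε'
  set ε := ε' / 4 with hεdef
  have hε : 0 < ε := by positivity
  set φ : ℝ → ℝ := fun y => t * limShape β ((x - y) / t) with hφ
  set v := hopfLax u₀ (limShape β) x t with hv
  have hbdd : BddBelow (hopfLaxValues u₀ (limShape β) x t) := ⟨_, le_hopfLaxValues hβ hσ hu ht⟩
  have hv_le : ∀ y, x ≤ y → v ≤ u₀ y + φ y := fun y hy => csInf_le hbdd ⟨y, hy, rfl⟩
  obtain ⟨y', hy', hvy'⟩ : ∃ y, x ≤ y ∧ u₀ y + φ y < v + ε := by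
    have hne : (hopfLaxValues u₀ (limShape β) x t).Nonempty := ⟨_, x, le_rfl, rfl⟩
    obtain ⟨_, ⟨y, hy, rfl⟩, hlt⟩ := exists_lt_of_csInf_lt hne
      (show sInf (hopfLaxValues u₀ (limShape β) x t) < v + ε by rw [hv, hopfLax]; linarith)
    exact ⟨y, hy, hlt⟩
  -- beyond distance `C` the step process has not moved, so that the infimum may be truncated
  obtain ⟨C₀, hC₀, hC₀'⟩ := exists_limDisp_lt hβ (show 0 < ε / t by positivity)
  set C := t * (C₀ + 1) with hC
  have hC0 : 0 < C := by positivity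
  have hφC : φ (x + C) ≤ -C + ε := by
    have h1 := hC₀' (C / t) (by rw [hC, mul_div_cancel_left₀ _ ht'.ne']; linarith)
    have e : φ (x + C) = -C + t * limDisp β (C / t) := by
      simp only [hφ, limShape]
      rw [show x - (x + C) = -C by ring, neg_div, neg_neg]
      field_simp
    rw [e]
    have : t * limDisp β (C / t) ≤ t * (ε / t) := by gcongr
    rw [mul_div_cancel₀ _ ht'.ne'] at this
    linarith
  have hφcont : ContinuousOn φ (Set.Icc x (x + C)) := by
    refine continuousOn_const.mul ((continuousOn_limShape hβ).comp (by fun_prop) fun y hy => ?_)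
    exact div_nonpos_of_nonpos_of_nonneg (by linarith [hy.1]) ht'.le
  obtain ⟨δ, hδ, hunif⟩ := Metric.uniformContinuousOn_iff.1
    (isCompact_Icc.uniformContinuousOn_of_continuous hφcont) ε hε
  obtain ⟨K, hK⟩ := exists_nat_gt (C / δ)
  have hK0 : (0 : ℝ) < K := lt_of_le_of_lt (by positivity) hK
  set yy : ℕ → ℝ := fun l => x + l * (C / K) with hyy
  have hyy_le : ∀ l, x ≤ yy l := fun l => by
    simp only [hyy]
    have : 0 ≤ (l : ℝ) * (C / K) := by positivity
    linarith
  have hyyK : yy K = x + C := by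
    simp only [hyy]
    rw [mul_div_cancel₀ _ hK0.ne']
  have hyy0 : yy 0 = x := by simp [hyy]
  have hyy_mem : ∀ l ≤ K, yy l ∈ Set.Icc x (x + C) := fun l hl => by
    refine ⟨hyy_le l, ?_⟩
    rw [← hyyK]
    simp only [hyy]
    gcongr
  have hstep : ∀ l < K, φ (yy l) - ε ≤ φ (yy (l + 1)) := by
    intro l hl
    have hdist : dist (yy l) (yy (l + 1)) < δ := by
      rw [Real.dist_eq]
      have e : yy l - yy (l + 1) = -(C / K) := by simp only [hyy]; push_cast; ring
      rw [e, abs_neg, abs_of_pos (by positivity), div_lt_iff₀ hK0]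
      rwa [div_lt_iff₀ hδ, mul_comm] at hK
    have h := hunif _ (hyy_mem l hl.le) _ (hyy_mem (l + 1) hl) hdist
    rw [Real.dist_eq, abs_lt] at h
    linarith
  let Good : ∀ n, ℝ → Set (Ω n) := fun n y =>
    {ω | Near (σ₀ n ω ⌊(n : ℝ) * y⌋) (n * u₀ y) (n * ε) ∧
      Near (evolution (fun i k => D n i k ω) (stepAt ⌊(n : ℝ) * y⌋) ⌊(n : ℝ) * x⌋ ((n : ℝ≥0) * t))
        (n * φ y) (n * ε)}
  have hGood : ∀ y, x ≤ y → Tendsto (fun n => P n (Good n y)ᶜ) atTop (𝓝 0) := fun y hy =>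
    tendsto_measure_not_near_or hβ hD hu hy ht hε
  have hsum : Tendsto (fun n => P n (Good n y')ᶜ + ∑ l ∈ Finset.range (K + 1),
      P n (Good n (yy l))ᶜ) atTop (𝓝 0) := by
    have h := (hGood y' hy').add (tendsto_finsetSum (Finset.range (K + 1)) fun l _ =>
      hGood (yy l) (hyy_le l))
    simpa using h
  refine tendsto_of_tendsto_of_tendsto_of_le_of_le' tendsto_const_nhds hsum
    (Eventually.of_forall fun _ => zero_le) ?_
  filter_upwards [eventually_gt_atTop 0,
    tendsto_natCast_atTop_atTop.eventually (eventually_ge_atTop (1 / ε))] with n hn0 hnε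
  have hn' : (0 : ℝ) < n := by exact_mod_cast hn0
  rw [div_le_iff₀ hε] at hnε
  have hae : ({ω | ¬ Near (process (D n) (σ₀ n) ⌊(n : ℝ) * x⌋ ((n : ℝ≥0) * t) ω) (n * v) (n * ε')} :
      Set (Ω n)) ≤ᵐ[P n] ((Good n y')ᶜ ∪ ⋃ l ∈ Finset.range (K + 1), (Good n (yy l))ᶜ : Set (Ω n)) := by
    filter_upwards [ae_goodClocks hβ (hD n), hσ n] with ω hω hconf hne
    by_contra hcon
    have hcon' : ω ∉ (Good n y')ᶜ ∪ ⋃ l ∈ Finset.range (K + 1), (Good n (yy l))ᶜ := hcon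
    simp only [Set.mem_union, Set.mem_iUnion, Set.mem_compl_iff, not_or, not_not, not_exists,
      Finset.mem_range, Nat.lt_succ_iff] at hcon'
    obtain ⟨⟨⟨a, ha, ha'⟩, ⟨b, hb, hb'⟩⟩, hgrid⟩ := hcon'
    refine hne ?_
    -- upper bound from a nearly optimal `y'`
    have hup := evolution_le_of_stepAt hω hconf ⌊(n : ℝ) * x⌋ ⌊(n : ℝ) * y'⌋ a ha.le
      ((n : ℝ≥0) * t)
    rw [hb, ← ofInt_add] at hup
    -- lower bound from the grid
    have hex : ∀ l, ∃ z w : ℤ, l ≤ K → σ₀ n ω ⌊(n : ℝ) * yy l⌋ = Site.ofInt z ∧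
        |(z : ℝ) - n * u₀ (yy l)| < n * ε ∧
        evolution (fun i k => D n i k ω) (stepAt ⌊(n : ℝ) * yy l⌋) ⌊(n : ℝ) * x⌋ ((n : ℝ≥0) * t) =
          Site.ofInt w ∧ |(w : ℝ) - n * φ (yy l)| < n * ε := by
      intro l
      by_cases hl : l ≤ K
      · obtain ⟨⟨z, hz, hz'⟩, ⟨w, hw, hw'⟩⟩ := hgrid l hl
        exact ⟨z, w, fun _ => ⟨hz, hz', hw, hw'⟩⟩
      · exact ⟨0, 0, fun h => absurd h hl⟩
    choose z w hzw using hex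
    have hx0 : ⌊(n : ℝ) * yy 0⌋ = ⌊(n : ℝ) * x⌋ := by rw [hyy0]
    have hlow := le_evolution_of_grid hω hconf (fun l => ⌊(n : ℝ) * yy l⌋) z K
      (fun l hl => (hzw l hl).1.ge) ((n : ℝ≥0) * t) (Site.ofInt ⌈(n : ℝ) * (v - 3 * ε)⌉) (by
        intro l hl
        simp only [hx0]
        rw [(hzw (l + 1) hl).2.2.1, ← ofInt_add, ofInt_le, Int.ceil_le]
        push_cast
        have h1 := abs_lt.1 (hzw l hl.le).2.1
        have h2 := abs_lt.1 (hzw (l + 1) hl).2.2.2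
        have h3 := hv_le (yy l) (hyy_le l)
        have h4 := hstep l hl
        have h5 : (n : ℝ) * (v - 3 * ε) ≤ n * (φ (yy (l + 1)) + u₀ (yy l) - 2 * ε) :=
          mul_le_mul_of_nonneg_left (by linarith) hn'.le
        linarith) (by
        simp only [hx0]
        rw [ofInt_le, Int.ceil_le]
        push_cast
        have h1 := abs_lt.1 (hzw K le_rfl).2.1
        have h2 := Int.lt_floor_add_one ((n : ℝ) * x)
        have h3 := Int.floor_le ((n : ℝ) * yy K)
        have h4 := hv_le (yy K) (hyy_le K)
        rw [hyyK] at h1 h3 h4 ⊢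
        have h5 : (n : ℝ) * (v - 3 * ε) ≤ n * (u₀ (x + C) - C - 2 * ε) :=
          mul_le_mul_of_nonneg_left (by linarith) hn'.le
        linarith)
    simp only [hx0] at hlow
    obtain ⟨q, hq, hq1, hq2⟩ := exists_ofInt_of_le_of_le hlow hup
    refine ⟨q, hq, ?_⟩
    have h1 : (n : ℝ) * (v - 3 * ε) ≤ q := Int.ceil_le.1 hq1
    have h2 : (q : ℝ) ≤ b + a := by exact_mod_cast hq2
    rw [abs_lt] at ha' hb'
    have h3 : (n : ℝ) * (u₀ y' + φ y') < n * (v + ε) := by gcongr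
    have h4 : (n : ℝ) * ε' = 4 * (n * ε) := by rw [hεdef]; ring
    have h5 : 0 < n * ε := by positivity
    rw [abs_lt, h4]
    constructor <;> nlinarith
  calc _ ≤ P n ((Good n y')ᶜ ∪ ⋃ l ∈ Finset.range (K + 1), (Good n (yy l))ᶜ) := measure_mono_ae hae
    _ ≤ _ := (measure_union_le _ _).trans (add_le_add le_rfl (measure_biUnion_finset_le _ _))

end Hydrodynamic

end LongJumpExclusion

end

theorem theorem1 (β : ℕ+ → ℝ≥0) (hβ : LongJumpExclusion.rateMoment β 2 < ∞) :
    ∃ g : ℝ → ℝ,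
      ConvexOn ℝ (Set.Iic 0) g ∧ ContinuousOn g (Set.Iic 0) ∧
      LongJumpExclusion.IsLimitShape.{u} β g ∧
      ∀ (Ω : ℕ → Type u) [∀ n, MeasurableSpace (Ω n)] (P : ∀ n, Measure (Ω n))
        [∀ n, IsProbabilityMeasure (P n)]
        (D : ∀ n, ℤ → ℕ+ → Ω n → Set ℝ≥0) (σ₀ : ∀ n, Ω n → ℤ → LongJumpExclusion.Site)
        (u₀ : ℝ → ℝ),
        (∀ n, LongJumpExclusion.IsJumpClocks β (D n) (P n)) →
        (∀ n, LongJumpExclusion.IsInitialConfiguration (D n) (σ₀ n) (P n)) →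
        Monotone u₀ →
        (∀ y : ℝ, LongJumpExclusion.ScaledTendstoInProb P
          (fun n ω => σ₀ n ω ⌊(n : ℝ) * y⌋) (u₀ y)) →
        ∀ (x : ℝ) (t : ℝ≥0), 0 < t →
          BddBelow (LongJumpExclusion.hopfLaxValues u₀ g x t) ∧
          LongJumpExclusion.ScaledTendstoInProb P
            (fun n => LongJumpExclusion.process (D n) (σ₀ n) ⌊(n : ℝ) * x⌋ ((n : ℝ≥0) * t))
            (LongJumpExclusion.hopfLax u₀ g x t) := by
  refine ⟨LongJumpExclusion.limShape β, LongJumpExclusion.convexOn_limShape hβ,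
    LongJumpExclusion.continuousOn_limShape hβ, LongJumpExclusion.isLimitShape_limShape hβ, ?_⟩
  intro Ω _ P _ D σ₀ u₀ hD hσ _ hu x t ht
  have hconf := fun n => (hσ n).configuration
  exact ⟨⟨_, LongJumpExclusion.le_hopfLaxValues hβ hconf hu ht⟩,
    LongJumpExclusion.tendsto_hopfLax hβ hD hconf hu x ht⟩
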